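/- **Setting.** For each sample size $n$ let $p=p_n\ge n$ (for $n$ large), let $X=X_n\in\mathbb R^{n\times p}$ be a deterministic design with rows $x_i'$ and nonzero columns $X_j$, let $\beta^\star,\theta^\star\in\mathbb R^p$ be parameters (all of these may depend on $n$), and let $$y_i=x_i'\beta^\star+\sigma_i\,\epsilon_i,\qquad 2\log\sigma_i=x_i'\theta^\star,\qquad \epsilon_1,\dots,\epsilon_n\ \text{i.i.d. } \mathcal N(0,1).$$ Put $T=\operatorname{supp}(\theta^\star)$, $t=|T|$, write $x_{i,T}$ for the subvector of $x_i$ on $T$, $\hat\Sigma_{TT}=\frac1n\sum_i x_{i,T}x_{i,T}'$, $\Lambda_{\max}(\hat\Sigma^{(k)}_T)=\sup_{\|z\|=1}\frac1n\sum_i(x_{i,T}'z)^k$ and $\Lambda_{\min}(\hat\Sigma_{TT})=\inf_{\|z\|=1}\frac1n\sum_i(x_{i,T}'z)^2$. For $a\in\mathbb R^p$, $a'\hat\Sigma_{TT}^{-1}a$ means $a_T'\hat\Sigma_{TT}^{-1}a_T$. For a sequence $f$, write $f=\tilde O(1)$ if $f(n)=o(n^\gamma)$ for all $\gamma>0$,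 $f=\tilde o(1)$ if $f(n)=O(n^{-\gamma})$ for some $\gamma>0$, and $f=\tilde O(g)$, $f=\tilde o(g)$ if $f/g=\tilde O(1)$, $f/g=\tilde o(1)$. Orders refer to $n\to\infty$; a minimum over the empty set is $+\infty$. **Penalty.** For $\lambda>0$, $\rho_\lambda:[0,\infty)\to[0,\infty)$ satisfies: $\rho_\lambda(0)=0$; $\rho_\lambda(u+v)\le\rho_\lambda(u)+\rho_\lambda(v)$ for $u,v\ge0$; $\rho_\lambda$ is continuously differentiable on $(0,\infty)$ with $\lim_{u\to0+}\rho_\lambda'(u)=\lambda$; and for some constant $b>0$ not depending on $\lambda$, $\rho'_\lambda(u)\le\lambda$ for $0<u<b\lambda$ and $\rho'_\lambda(u)=0$ for $u\ge b\lambda$. **Program.** With the true mean plugged in, consider $$Q_n(\theta)=\sum_{i=1}^n x_i'\theta+\sum_{i=1}^n (y_i-x_i'\beta^\star)^2e^{-x_i'\theta}+4n\sum_{j=1}^p\rho_{\lambda_j}(|\theta_j|),\qquad \lambda_j=\lambda_T\,\frac{\|X_j\|}{\sqrt n}.$$ **Theorem.** Assume * (A1) $\max_i\|x_{i,T}\|=O(\sqrt{t\log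 p})$, $\sum_i\|x_{i,T}\|^2=O(nt)$, $\sum_i\|x_{i,T}\|^3=O(nt^{3/2})$; * (A2) $\Lambda_{\max}(\hat\Sigma_T^{(k)})=O(1)$ for $k=2,3,4,6$, and for some $c_2>0$, $\Lambda_{\min}(\hat\Sigma_{TT})>c_2$ for all large $n$; * $t=\tilde o(\sqrt n)$, $\log p=\tilde O(1)$, $\max_i\sigma_i=\tilde O(1)$, $(\min_i\sigma_i)^{-1}=\tilde O(1)$; * (incoherence) $\max_{j\notin T}\big\|\sum_i x_{i,T}\,x_{i,j}/\|X_j\|\big\|=\tilde O(n^{1/4})$ and $\max_{i\le n,\,j\le p}|x_{i,j}|/\|X_j\|=O((\log p)^{-1/2})$; * $\min_{j\in T}|\theta^\star_j|=\omega(\sqrt{\log p}/\sqrt n)$. Then for every positive sequence $\lambda_T$ with $\lambda_T=o(\min_{j\in T}|\theta_j^\star|)$ and $\sqrt{\log p}/\sqrt n=o(\lambda_T)$ there are measurable functions $\hat\theta=\hat\theta_n(y)\in\mathbb R^p$ with $\hat\theta_{T^c}=0$ such that $\hat\theta$ is a local minimizer of $Q_n$ over $\mathbb R^p$ with probability tending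 to $1$, and 1. for every sequence $a=a_n\in\mathbb R^{p}$ such that $v=\lim_n a'\hat\Sigma_{TT}^{-1}a$ exists in $\mathbb R$, $\ \sqrt n\,a'(\hat\theta-\theta^\star)\to\mathcal N(0,2v)$ in distribution; 2. $\displaystyle\max_{j\le n} n|x_j'(\hat\theta-\theta^\star)|=O_{\mathbb P}\Big(\max_{j\le n}\Big[\sqrt{n\,x_{j,T}'\hat\Sigma_{TT}^{-1}x_{j,T}\log p}+\max_{i\le n}x_{j,T}'\hat\Sigma_{TT}^{-1}x_{i,T}\log p\Big]\Big)$; 3. $\|\hat\theta-\theta^\star\|=O_{\mathbb P}(\sqrt{t/n})$. -/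

import Mathlib

open Filter Topology MeasureTheory ProbabilityTheory Asymptotics
open scoped Matrix NNReal ENNReal

noncomputable section

namespace Hippo

/-! ### Orders of magnitude -/

/-- `f` is sub-polynomial: `f(n) = o(n ^ γ)` for every `γ > 0`. -/
def SubPoly (f : ℕ → ℝ) : Prop :=
  ∀ γ : ℝ, 0 < γ → f =o[atTop] fun n : ℕ => (n : ℝ) ^ γ

/-- `f` has polynomial decay: `f(n) = O(n ^ (-γ))` for some `γ > 0`. -/
def PolyDecay (f : ℕ → ℝ) : Prop :=
  ∃ γ : ℝ, 0 < γ ∧ f =O[atTop] fun n : ℕ => (n : ℝ) ^ (-γ)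

/-- `Z n = O_P(r n)`, where `Z n` lives on its own probability space. -/
def IsBigOP {Ω : ℕ → Type*} [∀ n, MeasurableSpace (Ω n)] (P : ∀ n, Measure (Ω n))
    (Z : ∀ n, Ω n → ℝ) (r : ℕ → ℝ) : Prop :=
  ∀ δ : ℝ, 0 < δ → ∃ M : ℝ, ∀ᶠ n in atTop,
    P n {ω | M * r n < |Z n ω|} ≤ ENNReal.ofReal δ

/-! ### Penalties -/

/-- The folded penalties `ρ lam β` (`lam > 0`, `β ≥ 0`): non-negative, zero at zero, subadditive,
continuously differentiable on `(0, ∞)` with slope `lam` at `0+`, slope at most `lam` before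
`b * lam` and zero slope from `b * lam` on, the constant `b` being the same for all `lam`. -/
structure IsPenalty (ρ : ℝ → ℝ → ℝ) : Prop where
  nonneg : ∀ lam, 0 < lam → ∀ β, 0 ≤ β → 0 ≤ ρ lam β
  map_zero : ∀ lam, 0 < lam → ρ lam 0 = 0
  subadd : ∀ lam, 0 < lam → ∀ β₀ β₁, 0 ≤ β₀ → 0 ≤ β₁ → ρ lam (β₀ + β₁) ≤ ρ lam β₀ + ρ lam β₁
  differentiableAt : ∀ lam, 0 < lam → ∀ β, 0 < β → DifferentiableAt ℝ (ρ lam) β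
  continuousOn_deriv : ∀ lam, 0 < lam → ContinuousOn (deriv (ρ lam)) (Set.Ioi 0)
  tendsto_deriv : ∀ lam, 0 < lam → Tendsto (deriv (ρ lam)) (𝓝[>] 0) (𝓝 lam)
  exists_flat : ∃ b : ℝ, 0 < b ∧ ∀ lam, 0 < lam →
    (∀ β, 0 < β → β < b * lam → deriv (ρ lam) β ≤ lam) ∧ ∀ β, b * lam ≤ β → deriv (ρ lam) β = 0

/-! ### The model and the program, for one sample size -/

section

variable {n p : ℕ}

/-- The `i`-th covariate vector `x_i ∈ ℝᵖ`. -/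
def row (X : Matrix (Fin n) (Fin p) ℝ) (i : Fin n) : EuclideanSpace ℝ (Fin p) :=
  WithLp.toLp 2 fun j => X i j

/-- The `j`-th column `X_j ∈ ℝⁿ` of the design. -/
def col (X : Matrix (Fin n) (Fin p) ℝ) (j : Fin p) : EuclideanSpace ℝ (Fin n) :=
  WithLp.toLp 2 fun i => X i j

/-- The support of a parameter. -/
def supp (θ : EuclideanSpace ℝ (Fin p)) : Finset (Fin p) :=
  Finset.univ.filter fun j => θ j ≠ 0

/-- The subvector `a_T`. -/
def restr (T : Finset (Fin p)) (a : EuclideanSpace ℝ (Fin p)) : EuclideanSpace ℝ T :=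
  WithLp.toLp 2 fun j => a j

/-- The standard deviations `σ(x_i, θ)`, where `2 log σ(x_i, θ) = x_i' θ`. -/
def sigma (X : Matrix (Fin n) (Fin p) ℝ) (θ : EuclideanSpace ℝ (Fin p)) (i : Fin n) : ℝ :=
  Real.exp (inner ℝ (row X i) θ / 2)

/-- The observations `y_i = x_i' β + σ(x_i, θ) ε_i`. -/
def response (X : Matrix (Fin n) (Fin p) ℝ) (β θ : EuclideanSpace ℝ (Fin p)) (ε : Fin n → ℝ) :
    Fin n → ℝ :=
  fun i => inner ℝ (row X i) β + sigma X θ i * ε i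

/-- The penalized pseudo-likelihood in `θ`, with residuals `y_i - x_i' β` and penalty levels
`lamT * ‖X_j‖ / √n`. -/
def objective (ρ : ℝ → ℝ → ℝ) (X : Matrix (Fin n) (Fin p) ℝ) (y : Fin n → ℝ)
    (β : EuclideanSpace ℝ (Fin p)) (lamT : ℝ) (θ : EuclideanSpace ℝ (Fin p)) : ℝ :=
  ∑ i, inner ℝ (row X i) θ
    + ∑ i, (y i - inner ℝ (row X i) β) ^ 2 * Real.exp (-inner ℝ (row X i) θ)
    + 4 * n * ∑ j, ρ (lamT * ‖col X j‖ / √(n : ℝ)) |θ j|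

/-- The empirical covariance `Σ̂_TT = n⁻¹ ∑ x_{i,T} x_{i,T}'`. -/
def gram (X : Matrix (Fin n) (Fin p) ℝ) (T : Finset (Fin p)) : Matrix T T ℝ :=
  Matrix.of fun j k => (n : ℝ)⁻¹ * ∑ i, X i j * X i k

/-- The bilinear form `u' Σ̂_TT⁻¹ w`. -/
def invForm (X : Matrix (Fin n) (Fin p) ℝ) (T : Finset (Fin p)) (u w : EuclideanSpace ℝ T) : ℝ :=
  u.ofLp ⬝ᵥ ((gram X T)⁻¹ *ᵥ w.ofLp)

/-- The form `n⁻¹ ∑ (x_{i,T}' z) ^ k` of the empirical moment tensor of order `k`. -/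
def momentForm (X : Matrix (Fin n) (Fin p) ℝ) (T : Finset (Fin p)) (k : ℕ)
    (z : EuclideanSpace ℝ T) : ℝ :=
  (n : ℝ)⁻¹ * ∑ i, (inner ℝ (restr T (row X i)) z) ^ k

/-- `Λ_max(Σ̂_T^(k))`, the largest value of the moment form on the unit sphere. -/
def lambdaMax (X : Matrix (Fin n) (Fin p) ℝ) (T : Finset (Fin p)) (k : ℕ) : ℝ :=
  ⨆ z : Metric.sphere (0 : EuclideanSpace ℝ T) 1, momentForm X T k z

end

end Hippo

end

namespace Hippo

/-! ### Centred squares of standard normal variables -/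

section ChiSquare

/-! The estimator is an oracle. Put `u = θ - θ⋆` with `u` supported on `T`. Since `(y_i - x_i'β⋆)²
exp(-x_i'θ⋆) = ε_i²`, the unpenalized criterion on `T` becomes, up to a constant, the convex
function `∑ (x_i'u + ε_i² exp(-x_i'u))`. Let `û` minimize it over a ball of radius `r = L²
√((t+1)/n)`, where `L = log p`, and put `θ̂ = θ⋆ + û`. The construction may use `θ⋆`, because only
existence of a function of `y` is claimed.

Write `η_i = ε_i² - 1`. The score at `0` is of order at most `L √(nt)`, and the Hessian `∑ ε_i² x_i
x_i'` stays above `(c/2) n` because its fluctuation, measured in Frobenius norm, is `o(n)` when `t`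
is polynomially smaller than `√n`. Hence `û` is interior, thus stationary, and `‖û‖` is bounded by a
multiple of `‖∑ η_i x_i‖ / n` (`RegularDesign.ballArgmin_spec`). Chebyshev's inequality for this sum
gives the rate `√(t/n)` without logarithms.

The central tool is a linearization valid for every weight vector `q`, uniformly over the ball
(`RegularDesign.linearization_le`): `∑ q_i (1 - ε_i² exp(-x_i'u)) = -∑ η_i q_i + (∑ q_i x_i)'u + O(t
L⁵ ‖q‖ / √n)`, with `t + 1` in place of `t`. Two choices of `q` are used.

With `q_i = x_i' Σ̂⁻¹ a` the left side vanishes at `û` and `∑ q_i x_i = n a`, so `n a'û = ∑ η_i q_i`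
up to a small error. A central limit theorem for weighted centred chi-squares, of variance `2`,
gives the normal limit. An exponential inequality with a union bound gives the fitted-value bound,
and, for `a` a coordinate vector, `|û_k| = O(√(log p / n))` simultaneously in `k`.

With `q = X_j / ‖X_j‖`, `j ∉ T`, incoherence bounds the linear term, so the normalized score off the
support is `O(√(log p))`, below the penalty slope. On the support the signal dominates both `û_k`
and `λ_k`, so the penalty is flat near `θ̂_k`. These facts make `θ̂` a local minimizer of the full
program (`isLocalMin_objective`): the smooth part is convex, and off `T` the kink of the penalty
beats the score. -/

lemma integral_sq_gaussianReal_zero_one : ∫ x, x ^ 2 ∂(gaussianReal 0 1) = 1 := by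
  have h := variance_fun_id_gaussianReal (μ := 0) (v := 1)
  rw [variance_eq_integral (by fun_prop)] at h
  simpa using h

lemma integral_pow_four_gaussianReal_zero_one : ∫ x, x ^ 4 ∂(gaussianReal 0 1) = 3 := by
  have h := iteratedDeriv_mgf_zero (X := fun x : ℝ => x) (μ := gaussianReal 0 1) (by simp) 4
  have e : ∀ t : ℝ, HasDerivAt (fun t : ℝ => Real.exp (t ^ 2 / 2)) (t * Real.exp (t ^ 2 / 2)) t := by
    intro t
    have := ((hasDerivAt_pow 2 t).div_const 2).exp
    convert this using 1
    simp; ring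
  have d1 : deriv (fun t : ℝ => Real.exp (t ^ 2 / 2)) = fun t => t * Real.exp (t ^ 2 / 2) :=
    funext fun t => (e t).deriv
  have d2 : deriv (fun t : ℝ => t * Real.exp (t ^ 2 / 2))
      = fun t => (1 + t ^ 2) * Real.exp (t ^ 2 / 2) := by
    funext t
    refine (((hasDerivAt_id t).mul (e t)).congr_deriv ?_).deriv
    simp; ring
  have d3 : deriv (fun t : ℝ => (1 + t ^ 2) * Real.exp (t ^ 2 / 2))
      = fun t => (3 * t + t ^ 3) * Real.exp (t ^ 2 / 2) := by
    funext t
    refine ((((hasDerivAt_pow 2 t).const_add 1).mul (e t)).congr_deriv ?_).deriv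
    simp; ring
  have d4 : deriv (fun t : ℝ => (3 * t + t ^ 3) * Real.exp (t ^ 2 / 2))
      = fun t => (3 + 6 * t ^ 2 + t ^ 4) * Real.exp (t ^ 2 / 2) := by
    funext t
    refine (((((hasDerivAt_id t).const_mul 3).add (hasDerivAt_pow 3 t)).mul (e t)).congr_deriv
      ?_).deriv
    simp; ring
  rw [mgf_fun_id_gaussianReal] at h
  simp only [zero_mul, zero_add, NNReal.coe_one, one_mul] at h
  rw [iteratedDeriv_succ', iteratedDeriv_succ', iteratedDeriv_succ', iteratedDeriv_succ',
    iteratedDeriv_zero, d1, d2, d3, d4] at h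
  simpa using h.symm

lemma integral_sq_sub_one_gaussianReal : ∫ x, (x ^ 2 - 1) ∂(gaussianReal 0 1) = 0 := by
  -- A non-integrable function has Bochner integral `0` by convention, so a nonzero value certifies
  -- integrability.
  have hi : Integrable (fun x : ℝ => x ^ 2) (gaussianReal 0 1) :=
    .of_integral_ne_zero (by rw [integral_sq_gaussianReal_zero_one]; norm_num)
  rw [integral_sub hi (integrable_const _), integral_sq_gaussianReal_zero_one]
  simp

lemma integral_sq_sub_one_sq_gaussianReal : ∫ x, (x ^ 2 - 1) ^ 2 ∂(gaussianReal 0 1) = 2 := by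
  have hi : Integrable (fun x : ℝ => x ^ 2) (gaussianReal 0 1) :=
    .of_integral_ne_zero (by rw [integral_sq_gaussianReal_zero_one]; norm_num)
  have hi4 : Integrable (fun x : ℝ => x ^ 4) (gaussianReal 0 1) :=
    .of_integral_ne_zero (by rw [integral_pow_four_gaussianReal_zero_one]; norm_num)
  have : (fun x : ℝ => (x ^ 2 - 1) ^ 2) = fun x => x ^ 4 - 2 * x ^ 2 + 1 := by
    funext x; ring
  have ha := integral_add (hi4.sub (hi.const_mul 2)) (integrable_const (1 : ℝ))
  simp only [Pi.sub_apply] at ha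
  rw [this, ha, integral_sub hi4 (hi.const_mul 2), integral_const_mul, integral_sq_gaussianReal_zero_one,
    integral_pow_four_gaussianReal_zero_one]
  simp; norm_num

lemma neg_sub_two_mul_sq_le_log {u : ℝ} (h : |u| ≤ 1 / 2) :
    -u - 2 * u ^ 2 ≤ Real.log (1 - u) := by
  obtain ⟨h1, h2⟩ := abs_le.1 h
  have hpos : 0 < 1 - u := by linarith
  refine le_trans ?_ (Real.one_sub_inv_le_log_of_pos hpos)
  have : 1 - (1 - u)⁻¹ = -u / (1 - u) := by field_simp; ring
  rw [this, le_div_iff₀ hpos]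
  nlinarith [sq_nonneg u, mul_nonneg (sq_nonneg u) (by linarith : (0 : ℝ) ≤ 1 - 2 * u)]

lemma integral_exp_mul_sq_sub_one_gaussianReal {s : ℝ} (hs : s < 1 / 2) :
    ∫ x, Real.exp (s * (x ^ 2 - 1)) ∂(gaussianReal 0 1) = Real.exp (-s) / √(1 - 2 * s) := by
  rw [integral_gaussianReal_eq_integral_smul (by norm_num)]
  have : ∀ x : ℝ, gaussianPDFReal 0 1 x • Real.exp (s * (x ^ 2 - 1))
      = (√(2 * Real.pi))⁻¹ * Real.exp (-s) * Real.exp (-(1 / 2 - s) * x ^ 2) := by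
    intro x
    simp only [gaussianPDFReal, NNReal.coe_one, mul_one, sub_zero, smul_eq_mul]
    rw [mul_assoc, mul_assoc, ← Real.exp_add, ← Real.exp_add]
    congr 2; ring
  simp_rw [this]
  rw [integral_const_mul, integral_gaussian]
  have h1 : (0 : ℝ) < 1 - 2 * s := by linarith
  have : Real.pi / (1 / 2 - s) = (2 * Real.pi) / (1 - 2 * s) := by
    rw [div_eq_div_iff (by linarith) h1.ne']; ring
  rw [this, Real.sqrt_div (by positivity)]
  have : √(2 * Real.pi) ≠ 0 := by positivity
  field_simp

/-- The exact value is `exp(-s) / √(1 - 2s)`, and `-log(1 - 2s)/2 ≤ s + 4s²` when `|2s| ≤ 1/2`. So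
the centred chi-square is sub-Gaussian for small `s`, which is what a Bernstein bound needs. -/
lemma integral_exp_mul_sq_sub_one_gaussianReal_le {s : ℝ} (hs : |s| ≤ 1 / 4) :
    ∫ x, Real.exp (s * (x ^ 2 - 1)) ∂(gaussianReal 0 1) ≤ Real.exp (4 * s ^ 2) := by
  have hs' := abs_le.1 hs
  have h1 : (0 : ℝ) < 1 - 2 * s := by linarith [hs'.2]
  rw [integral_exp_mul_sq_sub_one_gaussianReal (by linarith [hs'.2]),
    ← Real.exp_log (Real.sqrt_pos.2 h1), ← Real.exp_sub, Real.exp_le_exp, Real.log_sqrt h1.le]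
  have := neg_sub_two_mul_sq_le_log (u := 2 * s) (by rw [abs_mul]; norm_num; linarith)
  linarith

variable {Ω : Type*} [MeasurableSpace Ω] {P : Measure Ω} {X : Ω → ℝ}

lemma _root_.ProbabilityTheory.HasLaw.mgf_sq_sub_one_pos (hX : HasLaw X (gaussianReal 0 1) P)
    {s : ℝ} (hs : |s| ≤ 1 / 4) : 0 < mgf (fun ω => X ω ^ 2 - 1) P s := by
  have hs' := abs_le.1 hs
  have h1 : (0 : ℝ) < 1 - 2 * s := by linarith [hs'.2]
  have := hX.integral_comp (f := fun x : ℝ => Real.exp (s * (x ^ 2 - 1))) (by fun_prop)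
  simp only [Function.comp_def] at this
  rw [mgf, this, integral_exp_mul_sq_sub_one_gaussianReal (by linarith [hs'.2])]
  positivity

lemma _root_.ProbabilityTheory.HasLaw.mgf_sq_sub_one_le (hX : HasLaw X (gaussianReal 0 1) P)
    {s : ℝ} (hs : |s| ≤ 1 / 4) : mgf (fun ω => X ω ^ 2 - 1) P s ≤ Real.exp (4 * s ^ 2) := by
  have := hX.integral_comp (f := fun x : ℝ => Real.exp (s * (x ^ 2 - 1))) (by fun_prop)
  simp only [Function.comp_def] at this
  rw [mgf, this]
  exact integral_exp_mul_sq_sub_one_gaussianReal_le hs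

lemma _root_.ProbabilityTheory.HasLaw.integral_sq_sub_one (hX : HasLaw X (gaussianReal 0 1) P) :
    P[fun ω => X ω ^ 2 - 1] = 0 := by
  have := hX.integral_comp (f := fun x : ℝ => x ^ 2 - 1) (by fun_prop)
  simp only [Function.comp_def] at this
  rw [this, integral_sq_sub_one_gaussianReal]

lemma _root_.ProbabilityTheory.HasLaw.integral_sq_sub_one_sq
    (hX : HasLaw X (gaussianReal 0 1) P) : P[fun ω => (X ω ^ 2 - 1) ^ 2] = 2 := by
  have := hX.integral_comp (f := fun x : ℝ => (x ^ 2 - 1) ^ 2) (by fun_prop)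
  simp only [Function.comp_def] at this
  rw [this, integral_sq_sub_one_sq_gaussianReal]

lemma _root_.ProbabilityTheory.HasLaw.memLp_sq_sub_one [IsProbabilityMeasure P]
    (hX : HasLaw X (gaussianReal 0 1) P) : MemLp (fun ω => X ω ^ 2 - 1) 2 P := by
  have hm := hX.aemeasurable
  refine (memLp_two_iff_integrable_sq (by fun_prop)).2 (.of_integral_ne_zero ?_)
  rw [hX.integral_sq_sub_one_sq]; norm_num

end ChiSquare

/-! ### Deviation inequalities for weighted sums -/

section Deviation

variable {ι κ Ω : Type*} [Fintype ι] [Fintype κ] [MeasurableSpace Ω] {P : Measure Ω}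
  [IsProbabilityMeasure P] {ε : ι → Ω → ℝ}

/-- Bernstein's inequality by Chernoff's method. The exponent `4L` is chosen so that, with `L = log
p`, a union bound over `p²` events still vanishes. -/
lemma measureReal_sum_mul_sq_sub_one_ge_le (hlaw : ∀ i, HasLaw (ε i) (gaussianReal 0 1) P)
    (hind : iIndepFun ε P) (c : ι → ℝ) {V B L : ℝ} (hL : 0 < L) (hV : 0 < V)
    (hcV : ∑ i, c i ^ 2 ≤ V) (hB : 0 ≤ B) (hcB : ∀ i, |c i| ≤ B) :
    P.real {ω | 32 * (√(L * V) + L * B) ≤ ∑ i, (ε i ω ^ 2 - 1) * c i} ≤ Real.exp (-(4 * L)) := by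
  have hm : ∀ i, AEMeasurable (ε i) P := fun i => (hlaw i).aemeasurable
  -- With `s = 1/D`, the summand `4B` keeps each `s c_i` within `1/4`, and the summand `√V/√L` keeps
  -- the log-moment `4s²V` below `4L`. Since `D L = √(LV) + 4LB`, the threshold contributes at least
  -- `8L`, leaving `-4L`.
  set D : ℝ := √V / √L + 4 * B with hD
  have hsV : 0 < √V := Real.sqrt_pos.2 hV
  have hsL : 0 < √L := Real.sqrt_pos.2 hL
  have hD0 : 0 < D := by positivity
  have hVL : √V / √L ≤ D := by linarith
  have hBD : 4 * B ≤ D := by have : 0 < √V / √L := by positivity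
                             linarith
  set s : ℝ := D⁻¹ with hs
  have hs0 : 0 < s := by positivity
  have hsc : ∀ i, |s * c i| ≤ 1 / 4 := fun i => by
    rw [abs_mul, abs_of_pos hs0, hs, inv_mul_le_iff₀ hD0]
    linarith [hcB i]
  have hmgf : mgf (fun ω => ∑ i, (ε i ω ^ 2 - 1) * c i) P s
      = ∏ i, mgf (fun ω => ε i ω ^ 2 - 1) P (s * c i) := by
    have hi : iIndepFun (fun i ω => (ε i ω ^ 2 - 1) * c i) P :=
      hind.comp (fun i x => (x ^ 2 - 1) * c i) (fun i => by fun_prop)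
    have := hi.mgf_sum₀ (t := s) (fun i => by fun_prop) Finset.univ
    rw [Finset.sum_fn] at this
    rw [this]
    refine Finset.prod_congr rfl fun i _ => ?_
    simp only [mgf]
    congr 1; funext ω; congr 1; ring
  have hpos : 0 < mgf (fun ω => ∑ i, (ε i ω ^ 2 - 1) * c i) P s := by
    rw [hmgf]
    exact Finset.prod_pos fun i _ => (hlaw i).mgf_sq_sub_one_pos (hsc i)
  have hle : mgf (fun ω => ∑ i, (ε i ω ^ 2 - 1) * c i) P s ≤ Real.exp (4 * s ^ 2 * V) := by
    rw [hmgf]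
    calc ∏ i, mgf (fun ω => ε i ω ^ 2 - 1) P (s * c i)
        ≤ ∏ i, Real.exp (4 * (s * c i) ^ 2) :=
          Finset.prod_le_prod (fun i _ => mgf_nonneg) fun i _ => (hlaw i).mgf_sq_sub_one_le (hsc i)
      _ = Real.exp (4 * s ^ 2 * ∑ i, c i ^ 2) := by
          rw [← Real.exp_sum, Finset.mul_sum]
          congr 1; refine Finset.sum_congr rfl fun i _ => by ring
      _ ≤ _ := by gcongr
  refine (measure_ge_le_exp_mul_mgf _ hs0.le (.of_integral_ne_zero hpos.ne')).trans ?_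
  refine (mul_le_mul_of_nonneg_left hle (Real.exp_pos _).le).trans ?_
  rw [← Real.exp_add, Real.exp_le_exp]
  have e1 : 4 * s ^ 2 * V ≤ 4 * L := by
    have : s * √V ≤ √L := by
      rw [hs, inv_mul_le_iff₀ hD0]
      calc √V = √V / √L * √L := by field_simp
        _ ≤ D * √L := by gcongr
    calc 4 * s ^ 2 * V = 4 * (s * √V) ^ 2 := by rw [mul_pow, Real.sq_sqrt hV.le]; ring
      _ ≤ 4 * √L ^ 2 := by gcongr
      _ = 4 * L := by rw [Real.sq_sqrt hL.le]
  have e2 : 8 * L ≤ s * (32 * (√(L * V) + L * B)) := by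
    have : D * L = √(L * V) + 4 * (L * B) := by
      rw [hD, Real.sqrt_mul hL.le]
      have : √V / √L * L = √L * √V := by
        nth_rewrite 2 [← Real.sq_sqrt hL.le]
        field_simp
      rw [add_mul, this]; ring
    rw [hs, le_inv_mul_iff₀ hD0]
    have := Real.sqrt_nonneg (L * V)
    nlinarith
  linarith

lemma measure_abs_sum_mul_sq_sub_one_gt_le (hlaw : ∀ i, HasLaw (ε i) (gaussianReal 0 1) P)
    (hind : iIndepFun ε P) (c : ι → ℝ) {V B L : ℝ} (hL : 0 < L)
    (hcV : ∑ i, c i ^ 2 ≤ V) (hB : 0 ≤ B) (hcB : ∀ i, |c i| ≤ B) :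
    P {ω | 32 * (√(L * V) + L * B) < |∑ i, (ε i ω ^ 2 - 1) * c i|}
      ≤ ENNReal.ofReal (2 * Real.exp (-(4 * L))) := by
  rcases lt_or_ge 0 V with hV | hV
  · have h1 := measureReal_sum_mul_sq_sub_one_ge_le hlaw hind c hL hV hcV hB hcB
    have h2 := measureReal_sum_mul_sq_sub_one_ge_le hlaw hind (fun i => -c i) hL hV
      (by simpa using hcV) hB (by simpa using hcB)
    rw [two_mul, ENNReal.ofReal_add (Real.exp_pos _).le (Real.exp_pos _).le]
    refine (measure_mono (t := {ω | 32 * (√(L * V) + L * B) ≤ ∑ i, (ε i ω ^ 2 - 1) * c i} ∪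
      {ω | 32 * (√(L * V) + L * B) ≤ ∑ i, (ε i ω ^ 2 - 1) * -c i}) fun ω hω => ?_).trans
      ((measure_union_le _ _).trans (add_le_add ?_ ?_))
    · simp only [Set.mem_ofPred_eq, Set.mem_union, mul_neg, Finset.sum_neg_distrib] at hω ⊢
      rcases lt_abs.1 hω with h | h
      exacts [Or.inl h.le, Or.inr h.le]
    · exact (ENNReal.le_ofReal_iff_toReal_le (measure_ne_top _ _) (Real.exp_pos _).le).2 h1
    · exact (ENNReal.le_ofReal_iff_toReal_le (measure_ne_top _ _) (Real.exp_pos _).le).2 h2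
  -- Here `V ≤ 0` forces all weights to vanish, so the event is empty.
  · have h0 : ∀ i, c i = 0 := fun i => by
      have h := Finset.single_le_sum (f := fun i => c i ^ 2) (fun j _ => sq_nonneg (c j))
        (Finset.mem_univ i)
      exact pow_eq_zero_iff two_ne_zero |>.1 (le_antisymm (h.trans (hcV.trans hV)) (sq_nonneg _))
    have : {ω | 32 * (√(L * V) + L * B) < |∑ i, (ε i ω ^ 2 - 1) * c i|} = ∅ := by
      ext ω
      simp only [h0, mul_zero, Finset.sum_const_zero, abs_zero, Set.mem_ofPred_eq,
        Set.mem_empty_iff_false, iff_false, not_lt]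
      positivity
    rw [this]; simp

/-- The scalar bound is applied to each coordinate with `B = √(V k)`, which always dominates the
entries. This costs a factor `L` instead of `√L` but needs no separate control of the largest entry.
-/
lemma measure_norm_sum_smul_gt_le (hlaw : ∀ i, HasLaw (ε i) (gaussianReal 0 1) P)
    (hind : iIndepFun ε P) (y : ι → EuclideanSpace ℝ κ) {L : ℝ} (hL : 1 ≤ L) :
    P {ω | 64 * L * √(∑ i, ‖y i‖ ^ 2) < ‖∑ i, (ε i ω ^ 2 - 1) • y i‖}
      ≤ Fintype.card κ * ENNReal.ofReal (2 * Real.exp (-(4 * L))) := by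
  have hL0 : 0 < L := by linarith
  set V : κ → ℝ := fun k => ∑ i, y i k ^ 2 with hV
  have hV0 : ∀ k, 0 ≤ V k := fun k => Finset.sum_nonneg fun i _ => sq_nonneg _
  have hsum : ∑ k, V k = ∑ i, ‖y i‖ ^ 2 := by
    simp only [hV, EuclideanSpace.real_norm_sq_eq]
    exact Finset.sum_comm
  calc _ ≤ P (⋃ k, {ω | 32 * (√(L * V k) + L * √(V k)) < |∑ i, (ε i ω ^ 2 - 1) * y i k|}) := by
        refine measure_mono fun ω hω => ?_
        by_contra hcon
        simp only [Set.mem_iUnion, Set.mem_ofPred_eq, not_exists, not_lt] at hcon hω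
        refine absurd hω (not_lt.2 ?_)
        have hS0 : 0 ≤ ∑ i, ‖y i‖ ^ 2 := Finset.sum_nonneg fun i _ => sq_nonneg _
        refine (pow_le_pow_iff_left₀ (norm_nonneg _)
          (mul_nonneg (by linarith) (Real.sqrt_nonneg _)) two_ne_zero).1 ?_
        rw [EuclideanSpace.real_norm_sq_eq, mul_pow, Real.sq_sqrt hS0, ← hsum,
          Finset.mul_sum]
        refine Finset.sum_le_sum fun k _ => ?_
        have h1 : |∑ i, (ε i ω ^ 2 - 1) * y i k| ≤ 64 * L * √(V k) := by
          refine (hcon k).trans ?_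
          have : √(L * V k) ≤ L * √(V k) := by
            rw [Real.sqrt_mul hL0.le]
            gcongr
            exact Real.sqrt_le_iff.2 ⟨hL0.le, by nlinarith⟩
          linarith
        have h2 : (∑ i, (ε i ω ^ 2 - 1) • y i).ofLp k = ∑ i, (ε i ω ^ 2 - 1) * y i k := by
          simp [WithLp.ofLp_sum]
        rw [h2, ← sq_abs, ← Real.sq_sqrt (hV0 k), ← mul_pow]
        gcongr
    _ ≤ ∑ k, P {ω | 32 * (√(L * V k) + L * √(V k)) < |∑ i, (ε i ω ^ 2 - 1) * y i k|} :=
        measure_iUnion_fintype_le _ _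
    _ ≤ ∑ k : κ, ENNReal.ofReal (2 * Real.exp (-(4 * L))) := by
        refine Finset.sum_le_sum fun k _ => measure_abs_sum_mul_sq_sub_one_gt_le hlaw hind _ hL0
          le_rfl (Real.sqrt_nonneg _) fun i => Real.abs_le_sqrt ?_
        exact Finset.single_le_sum (f := fun i => y i k ^ 2) (fun j _ => sq_nonneg _)
          (Finset.mem_univ i)
    _ = _ := by simp

lemma integral_sum_mul_sq_sub_one_sq (hlaw : ∀ i, HasLaw (ε i) (gaussianReal 0 1) P)
    (hind : iIndepFun ε P) (c : ι → ℝ) :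
    MemLp (fun ω => ∑ i, (ε i ω ^ 2 - 1) * c i) 2 P ∧
      P[fun ω => (∑ i, (ε i ω ^ 2 - 1) * c i) ^ 2] = 2 * ∑ i, c i ^ 2 := by
  have hm : ∀ i, AEMeasurable (ε i) P := fun i => (hlaw i).aemeasurable
  have hmem : ∀ i, MemLp (fun ω => (ε i ω ^ 2 - 1) * c i) 2 P := fun i => by
    simpa [mul_comm] using (hlaw i).memLp_sq_sub_one.const_mul (c i)
  have hmean : ∀ i, P[fun ω => (ε i ω ^ 2 - 1) * c i] = 0 := fun i => by
    rw [integral_mul_const, (hlaw i).integral_sq_sub_one, zero_mul]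
  have hvar : ∀ i, Var[fun ω => (ε i ω ^ 2 - 1) * c i; P] = 2 * c i ^ 2 := fun i => by
    rw [variance_of_integral_eq_zero (by fun_prop) (hmean i)]
    simp_rw [mul_pow]
    rw [integral_mul_const, (hlaw i).integral_sq_sub_one_sq]
  have hi : iIndepFun (fun i ω => (ε i ω ^ 2 - 1) * c i) P :=
    hind.comp (fun i x => (x ^ 2 - 1) * c i) (fun i => by fun_prop)
  refine ⟨memLp_finsetSum _ fun i _ => hmem i, ?_⟩
  have hs := IndepFun.variance_sum (s := Finset.univ) (fun i _ => hmem i)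
    (fun i _ j _ hij => hi.indepFun hij)
  rw [Finset.sum_fn, variance_of_integral_eq_zero (by fun_prop), Finset.sum_congr rfl
    fun i _ => hvar i, ← Finset.mul_sum] at hs
  · exact hs
  · rw [integral_finsetSum _ fun i _ => (hmem i).integrable (by norm_num)]
    exact Finset.sum_eq_zero fun i _ => hmean i

/-- Chebyshev, from `E‖∑ η_i y_i‖² = 2 ∑ ‖y_i‖²`. Weaker tails than the exponential bound, but no
logarithm and no dimension factor; the Euclidean rate requires this. -/
lemma measure_norm_sum_smul_gt_le_div_sq (hlaw : ∀ i, HasLaw (ε i) (gaussianReal 0 1) P)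
    (hind : iIndepFun ε P) (y : ι → EuclideanSpace ℝ κ) {A : ℝ} (hA : 0 < A) :
    P {ω | A * √(∑ i, ‖y i‖ ^ 2) < ‖∑ i, (ε i ω ^ 2 - 1) • y i‖}
      ≤ ENNReal.ofReal (2 / A ^ 2) := by
  have h2 : ∀ ω k, (∑ i, (ε i ω ^ 2 - 1) • y i).ofLp k = ∑ i, (ε i ω ^ 2 - 1) * y i k := by
    intro ω k; simp [WithLp.ofLp_sum]
  set S : ℝ := ∑ i, ‖y i‖ ^ 2 with hS
  have hS0 : 0 ≤ S := Finset.sum_nonneg fun i _ => by positivity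
  rcases hS0.eq_or_lt with h0 | hpos
  · have hy : ∀ i, y i = 0 := fun i => by
      have h := (Finset.sum_eq_zero_iff_of_nonneg (fun i _ => by positivity)).1 h0.symm i
        (Finset.mem_univ i)
      simpa using h
    have : {ω | A * √S < ‖∑ i, (ε i ω ^ 2 - 1) • y i‖} = ∅ := by
      ext ω; simp [hy]; positivity
    rw [this]; simp
  set Z : Ω → ℝ := fun ω => ∑ k, (∑ i, (ε i ω ^ 2 - 1) * y i k) ^ 2 with hZ
  have hi : ∀ k, Integrable (fun ω => (∑ i, (ε i ω ^ 2 - 1) * y i k) ^ 2) P := fun k =>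
    (integral_sum_mul_sq_sub_one_sq hlaw hind fun i => y i k).1.integrable_sq
  have hZi : Integrable Z P := integrable_finsetSum _ fun k _ => hi k
  have hEZ : ∫ ω, Z ω ∂P = 2 * S := by
    rw [hZ, integral_finsetSum _ fun k _ => hi k, Finset.sum_congr rfl fun k _ =>
      (integral_sum_mul_sq_sub_one_sq hlaw hind fun i => y i k).2, ← Finset.mul_sum, hS]
    simp only [EuclideanSpace.real_norm_sq_eq]
    rw [Finset.sum_comm]
  have hM := mul_meas_ge_le_integral_of_nonneg (μ := P) (f := Z)
    (ae_of_all _ fun ω => Finset.sum_nonneg fun k _ => sq_nonneg _) hZi (A ^ 2 * S)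
  rw [hEZ] at hM
  have hM' : P.real {ω | A ^ 2 * S ≤ Z ω} ≤ 2 / A ^ 2 := by
    rw [le_div_iff₀ (by positivity)]
    have := hpos
    refine le_of_mul_le_mul_right ?_ hpos
    calc P.real {ω | A ^ 2 * S ≤ Z ω} * A ^ 2 * S
        = A ^ 2 * S * P.real {ω | A ^ 2 * S ≤ Z ω} := by ring
      _ ≤ 2 * S := hM
  refine (measure_mono fun ω hω => ?_).trans
    ((ENNReal.le_ofReal_iff_toReal_le (measure_ne_top _ _) (by positivity)).2 hM')
  simp only [Set.mem_ofPred_eq] at hω ⊢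
  have h3 : ‖∑ i, (ε i ω ^ 2 - 1) • y i‖ ^ 2 = Z ω := by
    rw [EuclideanSpace.real_norm_sq_eq, hZ]
    exact Finset.sum_congr rfl fun k _ => by rw [h2]
  rw [← h3, ← Real.sq_sqrt hS0, ← mul_pow]
  exact pow_le_pow_left₀ (mul_nonneg hA.le (Real.sqrt_nonneg _)) hω.le 2

end Deviation

/-! ### A central limit theorem for weighted sums -/

section CentralLimit

/-- Telescoping: exchange one factor at a time, all other factors having modulus at most one. -/
lemma norm_prod_sub_prod_le_sum {ι : Type*} (s : Finset ι) {f g : ι → ℂ}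
    (hf : ∀ i ∈ s, ‖f i‖ ≤ 1) (hg : ∀ i ∈ s, ‖g i‖ ≤ 1) :
    ‖∏ i ∈ s, f i - ∏ i ∈ s, g i‖ ≤ ∑ i ∈ s, ‖f i - g i‖ := by
  classical
  induction s using Finset.induction_on with
  | empty => simp
  | insert a s ha ih =>
    rw [Finset.prod_insert ha, Finset.prod_insert ha, Finset.sum_insert ha]
    have hf' : ∀ i ∈ s, ‖f i‖ ≤ 1 := fun i hi => hf i (Finset.mem_insert_of_mem hi)
    have hg' : ∀ i ∈ s, ‖g i‖ ≤ 1 := fun i hi => hg i (Finset.mem_insert_of_mem hi)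
    have e : f a * ∏ i ∈ s, f i - g a * ∏ i ∈ s, g i
        = (f a - g a) * ∏ i ∈ s, f i + g a * (∏ i ∈ s, f i - ∏ i ∈ s, g i) := by ring
    rw [e]
    refine (norm_add_le _ _).trans (add_le_add ?_ ?_)
    · rw [norm_mul, norm_prod]
      exact mul_le_of_le_one_right (norm_nonneg _)
        (Finset.prod_le_one (fun i _ => norm_nonneg _) hf')
    · rw [norm_mul]
      exact (mul_le_of_le_one_left (norm_nonneg _) (hg a (Finset.mem_insert_self _ _))).trans
        (ih hf' hg')

/-- Both functions equal `1 - u² + o(u²)`. The standard second-order expansion assumes unit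
variance, hence the rescaling by `√2`. -/
lemma charFun_map_sq_sub_one_isLittleO :
    (fun u : ℝ => charFun ((gaussianReal 0 1).map fun x : ℝ => x ^ 2 - 1) u
      - Complex.exp (-(u : ℂ) ^ 2)) =o[𝓝 0] fun u => u ^ 2 := by
  have hX : AEMeasurable (fun x : ℝ => (√2)⁻¹ * (x ^ 2 - 1)) (gaussianReal 0 1) := by fun_prop
  have h := taylor_charFun_two hX (by
      rw [integral_const_mul, integral_sq_sub_one_gaussianReal, mul_zero]) (by
      simp only [Pi.pow_apply, mul_pow]
      rw [integral_const_mul, integral_sq_sub_one_sq_gaussianReal]; simp)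
  have ht : Tendsto (fun u : ℝ => √2 * u) (𝓝 0) (𝓝 0) := by
    have : Continuous fun u : ℝ => √2 * u := by fun_prop
    simpa using this.tendsto 0
  have h1 := h.comp_tendsto ht
  have h2 : (fun u : ℝ => charFun ((gaussianReal 0 1).map fun x : ℝ => x ^ 2 - 1) u
      - (1 - (u : ℂ) ^ 2)) =o[𝓝 0] fun u => u ^ 2 := by
    have h3 : (fun u : ℝ => charFun ((gaussianReal 0 1).map fun x : ℝ => x ^ 2 - 1) u
      - (1 - (u : ℂ) ^ 2)) =o[𝓝 0] fun u => (√2 * u) ^ 2 := by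
      refine h1.congr_left fun u => ?_
      simp only [Function.comp_apply]
      rw [charFun_map_mul_comp (by fun_prop), inv_mul_cancel_left₀ (by positivity)]
      have : ((√2 : ℝ) : ℂ) ^ 2 = 2 := by
        rw [← Complex.ofReal_pow, Real.sq_sqrt (by norm_num)]; norm_num
      push_cast
      rw [mul_pow, this]; ring
    refine h3.trans_isBigO (.of_bound 2 (Eventually.of_forall fun u => ?_))
    rw [mul_pow, Real.sq_sqrt (by norm_num), norm_mul]; simp
  have h4 : (fun u : ℝ => Complex.exp (-(u : ℂ) ^ 2) - (1 - (u : ℂ) ^ 2))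
      =o[𝓝 0] fun u : ℝ => u ^ 2 := by
    have hd : HasDerivAt Complex.exp 1 0 := by simpa using Complex.hasDerivAt_exp 0
    have hd' := (hasDerivAt_iff_isLittleO.1 hd)
    have ht2 : Tendsto (fun u : ℝ => -(u : ℂ) ^ 2) (𝓝 0) (𝓝 0) := by
      have : Continuous fun u : ℝ => -(u : ℂ) ^ 2 := by fun_prop
      simpa using this.tendsto 0
    have h5 := hd'.comp_tendsto ht2
    rw [← isLittleO_norm_right] at h5 ⊢
    refine (h5.congr_left fun u => ?_).congr_right fun u => ?_
    · simp; ring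
    · simp
  refine (h2.sub h4).congr_left fun u => by ring

variable {Ω : ℕ → Type*} [∀ n, MeasurableSpace (Ω n)] {P : ∀ n, Measure (Ω n)}
  {ε : ∀ n, Fin n → Ω n → ℝ}

/-- Lindeberg's argument: the factors `φ(c_i u)` are replaced by `exp(-c_i² u²)` at total cost `o(1)
· u² ∑ c_i²`, where uniform smallness of the weights brings every argument near `0`. -/
lemma tendsto_charFun_sum_mul_sq_sub_one (hlaw : ∀ n i, HasLaw (ε n i) (gaussianReal 0 1) (P n))
    (hind : ∀ n, iIndepFun (ε n) (P n)) {c : ∀ n, Fin n → ℝ} {v : ℝ}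
    (hv : Tendsto (fun n => ∑ i, c n i ^ 2) atTop (𝓝 v))
    (hc : ∀ δ : ℝ, 0 < δ → ∀ᶠ n in atTop, ∀ i, |c n i| ≤ δ) (u : ℝ) :
    Tendsto (fun n => charFun ((P n).map fun ω => ∑ i, (ε n i ω ^ 2 - 1) * c n i) u) atTop
      (𝓝 (Complex.exp (-(v * u ^ 2 : ℝ)))) := by
  set φ : ℝ → ℂ := charFun ((gaussianReal 0 1).map fun x : ℝ => x ^ 2 - 1) with hφ
  have hprob : IsProbabilityMeasure ((gaussianReal 0 1).map fun x : ℝ => x ^ 2 - 1) :=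
    Measure.isProbabilityMeasure_map (by fun_prop)
  have hprod : ∀ n, charFun ((P n).map fun ω => ∑ i, (ε n i ω ^ 2 - 1) * c n i) u
      = ∏ i, φ (c n i * u) := fun n => by
    have hm : ∀ i, AEMeasurable (ε n i) (P n) := fun i => (hlaw n i).aemeasurable
    have hi : iIndepFun (fun i ω => (ε n i ω ^ 2 - 1) * c n i) (P n) :=
      (hind n).comp (fun i x => (x ^ 2 - 1) * c n i) (fun i => by fun_prop)
    rw [hi.charFun_map_fun_sum_eq_prod (fun i => by fun_prop), Finset.prod_apply]
    refine Finset.prod_congr rfl fun i _ => ?_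
    have : (fun ω => (ε n i ω ^ 2 - 1) * c n i) = fun ω => c n i * (ε n i ω ^ 2 - 1) := by
      funext ω; ring
    rw [this, charFun_map_mul_comp (by fun_prop), hφ, ← (hlaw n i).map_eq,
      AEMeasurable.map_map_of_aemeasurable (by fun_prop) (hm i)]
    rfl
  have hg : Tendsto (fun n => ∏ i, Complex.exp (-((c n i * u : ℝ) : ℂ) ^ 2)) atTop
      (𝓝 (Complex.exp (-(v * u ^ 2 : ℝ)))) := by
    have e : ∀ n, ∏ i, Complex.exp (-((c n i * u : ℝ) : ℂ) ^ 2)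
        = Complex.exp (-(((∑ i, c n i ^ 2) * u ^ 2 : ℝ) : ℂ)) := fun n => by
      rw [← Complex.exp_sum]; congr 1
      push_cast
      rw [Finset.sum_neg_distrib, Finset.sum_mul]
      simp [mul_pow]
    simp_rw [e]
    have hcont : Continuous fun x : ℝ => Complex.exp (-((x * u ^ 2 : ℝ) : ℂ)) := by fun_prop
    exact (hcont.tendsto v).comp hv
  have hdiff : Tendsto (fun n => ∏ i, φ (c n i * u)
      - ∏ i, Complex.exp (-((c n i * u : ℝ) : ℂ) ^ 2)) atTop (𝓝 0) := by
    rw [Metric.tendsto_nhds]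
    intro η hη
    set κ := η / (2 * (u ^ 2 + 1) * (|v| + 1)) with hκ
    have hκ0 : 0 < κ := by positivity
    obtain ⟨r, hr, hball⟩ := Metric.eventually_nhds_iff.1
      (charFun_map_sq_sub_one_isLittleO.def hκ0)
    have hv' : ∀ᶠ n in atTop, ∑ i, c n i ^ 2 < |v| + 1 :=
      hv.eventually_lt_const (by linarith [le_abs_self v])
    filter_upwards [hv', hc (r / (2 * (|u| + 1))) (by positivity)] with n hn hcn
    rw [dist_zero_right]
    refine (norm_prod_sub_prod_le_sum _ (fun i _ => norm_charFun_le_one _) fun i _ => ?_).trans_lt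
      ?_
    · rw [← Complex.ofReal_pow, ← Complex.ofReal_neg, Complex.norm_exp_ofReal, Real.exp_le_one_iff]
      exact neg_nonpos.2 (sq_nonneg _)
    calc ∑ i, ‖φ (c n i * u) - Complex.exp (-((c n i * u : ℝ) : ℂ) ^ 2)‖
        ≤ ∑ i, κ * (c n i * u) ^ 2 := by
          refine Finset.sum_le_sum fun i _ => ?_
          have := hball (y := c n i * u) (by
            rw [dist_zero_right, Real.norm_eq_abs, abs_mul]
            refine (mul_le_mul_of_nonneg_right (hcn i) (abs_nonneg u)).trans_lt ?_
            rw [div_mul_eq_mul_div, div_lt_iff₀ (by positivity)]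
            nlinarith [abs_nonneg u])
          rwa [Real.norm_of_nonneg (sq_nonneg _)] at this
      _ = κ * u ^ 2 * ∑ i, c n i ^ 2 := by
          rw [Finset.mul_sum]; exact Finset.sum_congr rfl fun i _ => by ring
      _ ≤ κ * (u ^ 2 + 1) * (|v| + 1) := by gcongr; linarith
      _ = η / 2 := by rw [hκ]; field_simp
      _ < η := by linarith
  have := hdiff.add hg
  simp only [sub_add_cancel, zero_add] at this
  simpa only [hprod] using this

/-- The integrand `exp(iuY) - exp(iuX)` is at most `|u| δ` where `X` and `Y` are `δ`-close, and at
most `2` elsewhere. This is the quantitative form of Slutsky's lemma used below, one probability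
space at a time. -/
lemma norm_charFun_map_sub_le {Ω : Type*} [MeasurableSpace Ω] {P : Measure Ω}
    [IsProbabilityMeasure P] {X Y : Ω → ℝ} (hX : AEMeasurable X P) (hY : AEMeasurable Y P)
    (u : ℝ) {δ : ℝ} (hδ : 0 ≤ δ) :
    ‖charFun (P.map Y) u - charFun (P.map X) u‖
      ≤ |u| * δ + 2 * P.real {ω | δ < |Y ω - X ω|} := by
  have hS : NullMeasurableSet {ω | δ < |Y ω - X ω|} P :=
    nullMeasurableSet_lt (by fun_prop) (by fun_prop)
  have hi : ∀ Z : Ω → ℝ, AEMeasurable Z P →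
      Integrable (fun ω => Complex.exp (u * Z ω * Complex.I)) P := fun Z hZ => by
    refine Integrable.of_bound (by fun_prop) 1 (ae_of_all _ fun ω => ?_)
    rw [← Complex.ofReal_mul, Complex.norm_exp_ofReal_mul_I]
  rw [charFun_apply_real, charFun_apply_real, integral_map hY (by fun_prop),
    integral_map hX (by fun_prop), ← integral_sub (hi Y hY) (hi X hX)]
  refine (norm_integral_le_of_norm_le (g := fun ω => |u| * δ
    + {ω | δ < |Y ω - X ω|}.indicator (fun _ => (2 : ℝ)) ω) ?_ (ae_of_all _ fun ω => ?_)).trans ?_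
  · exact (integrable_const _).add ((integrable_const _).indicator₀ hS)
  · by_cases h : δ < |Y ω - X ω|
    · rw [Set.indicator_of_mem (by exact h)]
      refine (norm_sub_le _ _).trans ?_
      rw [← Complex.ofReal_mul, ← Complex.ofReal_mul, Complex.norm_exp_ofReal_mul_I,
        Complex.norm_exp_ofReal_mul_I]
      have : 0 ≤ |u| * δ := by positivity
      linarith
    · rw [Set.indicator_of_notMem (by exact h), add_zero]
      have e : Complex.exp (u * Y ω * Complex.I) - Complex.exp (u * X ω * Complex.I)
          = Complex.exp ((u * X ω : ℝ) * Complex.I)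
            * (Complex.exp (Complex.I * (u * (Y ω - X ω) : ℝ)) - 1) := by
        rw [mul_sub, ← Complex.exp_add, mul_one]
        congr 2 <;> push_cast <;> ring
      rw [e, norm_mul, Complex.norm_exp_ofReal_mul_I, one_mul]
      refine (Real.norm_exp_I_mul_ofReal_sub_one_le).trans ?_
      rw [Real.norm_eq_abs, abs_mul]
      gcongr
      exact not_lt.1 h
  · rw [integral_add (integrable_const _) ((integrable_const _).indicator₀ hS),
      integral_indicator₀ hS]
    simp [mul_comm]

theorem tendstoInDistribution_of_sub_sum_mul_sq_sub_one [∀ n, IsProbabilityMeasure (P n)]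
    (hlaw : ∀ n i, HasLaw (ε n i) (gaussianReal 0 1) (P n))
    (hind : ∀ n, iIndepFun (ε n) (P n)) {c : ∀ n, Fin n → ℝ} {v : ℝ≥0}
    (hv : Tendsto (fun n => ∑ i, c n i ^ 2) atTop (𝓝 (v : ℝ)))
    (hc : ∀ δ : ℝ, 0 < δ → ∀ᶠ n in atTop, ∀ i, |c n i| ≤ δ)
    {Y : ∀ n, Ω n → ℝ} (hY : ∀ n, AEMeasurable (Y n) (P n))
    (hYc : ∀ δ : ℝ, 0 < δ → Tendsto
      (fun n => P n {ω | δ < |Y n ω - ∑ i, (ε n i ω ^ 2 - 1) * c n i|}) atTop (𝓝 0)) :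
    TendstoInDistribution Y atTop (id : ℝ → ℝ) P (gaussianReal 0 (2 * v)) where
  forall_aemeasurable := hY
  aemeasurable_limit := aemeasurable_id
  tendsto := by
    refine ProbabilityMeasure.tendsto_of_tendsto_charFun fun u => ?_
    have hm : ∀ n i, AEMeasurable (ε n i) (P n) := fun n i => (hlaw n i).aemeasurable
    have h1 := tendsto_charFun_sum_mul_sq_sub_one hlaw hind hv hc u
    have h2 : Tendsto (fun n => charFun ((P n).map (Y n)) u
        - charFun ((P n).map fun ω => ∑ i, (ε n i ω ^ 2 - 1) * c n i) u) atTop (𝓝 0) := by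
      rw [Metric.tendsto_nhds]
      intro η hη
      set δ := η / (2 * (|u| + 1)) with hδ
      have hδ0 : 0 < δ := by positivity
      have h3 := (ENNReal.tendsto_toReal ENNReal.zero_ne_top).comp (hYc δ hδ0)
      rw [ENNReal.toReal_zero] at h3
      filter_upwards [h3.eventually_lt_const (show 0 < η / 4 by positivity)] with n hn
      rw [dist_zero_right]
      refine (norm_charFun_map_sub_le (by fun_prop) (hY n) u hδ0.le).trans_lt ?_
      have h4 : |u| * δ ≤ η / 2 := by
        rw [hδ, ← mul_div_assoc, div_le_div_iff₀ (by positivity) (by norm_num)]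
        nlinarith [abs_nonneg u]
      have h5 : (P n).real {ω | δ < |Y n ω - ∑ i, (ε n i ω ^ 2 - 1) * c n i|} < η / 4 := hn
      linarith
    have h3 := h2.add h1
    simp only [sub_add_cancel, zero_add] at h3
    have e : charFun ((gaussianReal 0 (2 * v)).map id) u = Complex.exp (-(v * u ^ 2 : ℝ)) := by
      rw [Measure.map_id, charFun_gaussianReal]
      congr 1
      push_cast; ring
    simpa only [ProbabilityMeasure.coe_mk, e] using h3

end CentralLimit

/-! ### The unpenalized criterion on the support and its minimizer over a ball -/

section Loss

variable {ι E : Type*} [Fintype ι] [NormedAddCommGroup E] [InnerProductSpace ℝ E]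

/-- The criterion `∑ᵢ (xᵢ'u + sᵢ exp(-xᵢ'u))`. -/
noncomputable def expLoss (x : ι → E) (s : ι → ℝ) (u : E) : ℝ :=
  ∑ i, (inner ℝ (x i) u + s i * Real.exp (-inner ℝ (x i) u))

lemma continuous_expLoss_uncurry (x : ι → E) :
    Continuous fun q : (ι → ℝ) × E => expLoss x q.1 q.2 := by
  unfold expLoss
  fun_prop

lemma continuous_expLoss (x : ι → E) (s : ι → ℝ) : Continuous (expLoss x s) :=
  (continuous_expLoss_uncurry x).comp (by fun_prop : Continuous fun u : E => (s, u))

/-- The average minus the midpoint value is half of `∑ s_i (exp(-x_i'u/2) - exp(-x_i'v/2))²`,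
positive as soon as one row separates `u` from `v`. -/
lemma expLoss_midpoint_lt {x : ι → E} (hx : ∀ u : E, u ≠ 0 → ∃ i, inner ℝ (x i) u ≠ 0)
    {s : ι → ℝ} (hs : ∀ i, 0 < s i) {u v : E} (huv : u ≠ v) :
    expLoss x s ((1 / 2 : ℝ) • (u + v)) < (expLoss x s u + expLoss x s v) / 2 := by
  obtain ⟨i₀, hi₀⟩ := hx (u - v) (sub_ne_zero.2 huv)
  have key : (expLoss x s u + expLoss x s v) / 2 - expLoss x s ((1 / 2 : ℝ) • (u + v))
      = ∑ i, s i * (Real.exp (-inner ℝ (x i) u / 2) - Real.exp (-inner ℝ (x i) v / 2)) ^ 2 / 2 := by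
    unfold expLoss
    rw [← Finset.sum_add_distrib, Finset.sum_div, ← Finset.sum_sub_distrib]
    refine Finset.sum_congr rfl fun i _ => ?_
    rw [inner_smul_right, inner_add_right]
    set a : ℝ := inner ℝ (x i) u
    set b : ℝ := inner ℝ (x i) v
    have h1 : Real.exp (-a) = Real.exp (-a / 2) ^ 2 := by rw [← Real.exp_nat_mul]; congr 1; simp; ring
    have h2 : Real.exp (-b) = Real.exp (-b / 2) ^ 2 := by rw [← Real.exp_nat_mul]; congr 1; simp; ring
    have h3 : Real.exp (-(1 / 2 * (a + b))) = Real.exp (-a / 2) * Real.exp (-b / 2) := by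
      rw [← Real.exp_add]; congr 1; ring
    rw [h1, h2, h3]; ring
  rw [← sub_pos, key]
  refine Finset.sum_pos' (fun i _ => ?_) ⟨i₀, Finset.mem_univ _, ?_⟩
  · have := (hs i).le; positivity
  · have hne : Real.exp (-inner ℝ (x i₀) u / 2) - Real.exp (-inner ℝ (x i₀) v / 2) ≠ 0 := by
      rw [sub_ne_zero, Ne, Real.exp_eq_exp]
      intro h
      apply hi₀
      rw [inner_sub_right]; linarith
    have := hs i₀; positivity

lemma exists_isMinOn_expLoss_closedBall [FiniteDimensional ℝ E] (x : ι → E) (s : ι → ℝ) {r : ℝ}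
    (hr : 0 ≤ r) : ∃ u ∈ Metric.closedBall (0 : E) r,
      IsMinOn (expLoss x s) (Metric.closedBall 0 r) u :=
  haveI := FiniteDimensional.proper ℝ E
  (isCompact_closedBall (0 : E) r).exists_isMinOn ⟨0, by simpa using hr⟩
    (continuous_expLoss x s).continuousOn

open Classical in
/-- A minimizer of the criterion over the ball of radius `r` (zero for degenerate data). -/
noncomputable def ballArgmin [FiniteDimensional ℝ E] (x : ι → E) (r : ℝ) (s : ι → ℝ) : E :=
  if h : 0 ≤ r ∧ (∀ u : E, u ≠ 0 → ∃ i, inner ℝ (x i) u ≠ 0) ∧ ∀ i, 0 < s i then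
    (exists_isMinOn_expLoss_closedBall x s h.1).choose
  else 0

lemma ballArgmin_spec [FiniteDimensional ℝ E] {x : ι → E} {r : ℝ} {s : ι → ℝ} (hr : 0 ≤ r)
    (hx : ∀ u : E, u ≠ 0 → ∃ i, inner ℝ (x i) u ≠ 0) (hs : ∀ i, 0 < s i) :
    ballArgmin x r s ∈ Metric.closedBall (0 : E) r ∧
      IsMinOn (expLoss x s) (Metric.closedBall 0 r) (ballArgmin x r s) := by
  rw [ballArgmin, dif_pos ⟨hr, hx, hs⟩]
  exact (exists_isMinOn_expLoss_closedBall x s hr).choose_spec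

lemma eq_of_isMinOn_expLoss {x : ι → E} {r : ℝ} {s : ι → ℝ}
    (hx : ∀ u : E, u ≠ 0 → ∃ i, inner ℝ (x i) u ≠ 0) (hs : ∀ i, 0 < s i) {u v : E}
    (hu : u ∈ Metric.closedBall (0 : E) r) (hv : v ∈ Metric.closedBall (0 : E) r)
    (hmu : IsMinOn (expLoss x s) (Metric.closedBall 0 r) u)
    (hmv : IsMinOn (expLoss x s) (Metric.closedBall 0 r) v) : u = v := by
  by_contra huv
  have hmid : (1 / 2 : ℝ) • (u + v) ∈ Metric.closedBall (0 : E) r := by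
    rw [smul_add]
    exact convex_closedBall 0 r hu hv (by norm_num) (by norm_num) (by norm_num)
  have h1 := expLoss_midpoint_lt hx hs huv
  have h2 := hmu hmid
  have h3 := hmv hmid
  simp only [Set.mem_ofPred_eq] at h2 h3
  linarith

/-- Every cluster point of minimizers minimizes the limiting criterion; in a compact ball,
uniqueness of the minimizer turns this into convergence. -/
lemma continuousOn_ballArgmin [FiniteDimensional ℝ E] {x : ι → E} {r : ℝ} (hr : 0 ≤ r)
    (hx : ∀ u : E, u ≠ 0 → ∃ i, inner ℝ (x i) u ≠ 0) :
    ContinuousOn (ballArgmin x r) {s | ∀ i, 0 < s i} := by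
  have := FiniteDimensional.proper ℝ E
  intro s hs
  refine (isCompact_closedBall (0 : E) r).tendsto_nhds_of_unique_mapClusterPt ?_ ?_
  · filter_upwards [self_mem_nhdsWithin] with s' hs'
    exact (ballArgmin_spec hr hx hs').1
  · intro y hy hcl
    have hsp := ballArgmin_spec hr hx hs
    refine eq_of_isMinOn_expLoss hx hs hy hsp.1 (fun z hz => ?_) hsp.2
    simp only [Set.mem_ofPred_eq]
    by_contra hlt
    rw [not_le] at hlt
    -- If `z` did strictly better than `y` at `s`, it would also do so for nearby data and nearby
    -- points, in particular against the minimizers that cluster at `y`.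
    have hopen : ∀ᶠ q : (ι → ℝ) × E in 𝓝 s ×ˢ 𝓝 y, expLoss x q.1 z < expLoss x q.1 q.2 := by
      rw [← nhds_prod_eq]
      have c1 : Continuous fun q : (ι → ℝ) × E => expLoss x q.1 z :=
        (continuous_expLoss_uncurry x).comp
          (by fun_prop : Continuous fun q : (ι → ℝ) × E => (q.1, z))
      exact (c1.tendsto (s, y)).eventually_lt
        ((continuous_expLoss_uncurry x).tendsto (s, y)) hlt
    obtain ⟨pa, hpa, pb, hpb, hab⟩ := eventually_prod_iff.1 hopen
    have hfr := (mapClusterPt_iff_frequently.1 hcl) {w | pb w} hpb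
    obtain ⟨s', ⟨hs'b, hs'a⟩, hs'⟩ :=
      ((hfr.and_eventually (nhdsWithin_le_nhds hpa)).and_eventually self_mem_nhdsWithin).exists
    have h1 := hab hs'a hs'b
    have h2 := (ballArgmin_spec hr hx hs').2 hz
    simp only [Set.mem_ofPred_eq] at h2
    exact absurd h1 (not_lt.2 h2)

/-- Continuity holds on the open orthant of positive data; the convention `0` elsewhere makes the
choice-based minimizer measurable everywhere. -/
lemma measurable_ballArgmin [FiniteDimensional ℝ E] [MeasurableSpace E] [BorelSpace E] (x : ι → E) (r : ℝ) :
    Measurable (ballArgmin x r) := by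
  classical
  by_cases h : 0 ≤ r ∧ ∀ u : E, u ≠ 0 → ∃ i, inner ℝ (x i) u ≠ 0
  · have hS : MeasurableSet {s : ι → ℝ | ∀ i, 0 < s i} := by
      simp only [Set.ofPred_forall]
      exact MeasurableSet.iInter fun i => measurableSet_lt measurable_const (measurable_pi_apply i)
    have := (continuousOn_ballArgmin h.1 h.2).measurable_piecewise
      (g := fun _ => (0 : E)) continuousOn_const hS
    convert this using 1
    funext s
    by_cases hs : s ∈ {s : ι → ℝ | ∀ i, 0 < s i}
    · rw [Set.piecewise_eq_of_mem _ _ _ hs]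
    · rw [Set.piecewise_eq_of_notMem _ _ _ hs, ballArgmin, dif_neg fun h' => hs h'.2.2]
  · have : ballArgmin x r = fun _ => 0 := by
      funext s
      rw [ballArgmin, dif_neg fun h' => h ⟨h'.1, h'.2.1⟩]
    rw [this]; exact measurable_const

lemma sum_smul_eq_zero_of_isLocalMin_expLoss {x : ι → E} {s : ι → ℝ} {u : E}
    (hu : IsLocalMin (expLoss x s) u) :
    ∑ i, (1 - s i * Real.exp (-inner ℝ (x i) u)) • x i = 0 := by
  refine ext_inner_right ℝ fun h => ?_
  have hd : HasDerivAt (fun t : ℝ => expLoss x s (u + t • h))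
      (∑ i, (inner ℝ (x i) h + s i * (Real.exp (-inner ℝ (x i) u) * -inner ℝ (x i) h))) 0 := by
    unfold expLoss
    refine HasDerivAt.fun_sum fun i _ => ?_
    have h1 : HasDerivAt (fun t : ℝ => inner ℝ (x i) (u + t • h)) (inner ℝ (x i) h) 0 := by
      simp only [inner_add_right, inner_smul_right]
      simpa using ((hasDerivAt_id (0 : ℝ)).mul_const (inner ℝ (x i) h)).const_add
        (inner ℝ (x i) u)
    have h2 := (h1.neg.exp.const_mul (s i))
    simp only [Pi.neg_apply, zero_smul, add_zero] at h2
    exact h1.add h2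
  have hmin : IsLocalMin (fun t : ℝ => expLoss x s (u + t • h)) 0 := by
    have hc : ContinuousAt (fun t : ℝ => u + t • h) 0 := by fun_prop
    have : Tendsto (fun t : ℝ => u + t • h) (𝓝 0) (𝓝 u) := by simpa using hc.tendsto
    have := this.eventually hu
    simpa [IsLocalMin, IsMinFilter] using this
  have h0 := hmin.hasDerivAt_eq_zero hd
  rw [sum_inner, inner_zero_left, ← h0]
  refine Finset.sum_congr rfl fun i _ => ?_
  rw [real_inner_smul_left]; ring

lemma one_sub_add_sq_div_le_exp_neg {v : ℝ} (hv : |v| ≤ 1) : 1 - v + v ^ 2 / 4 ≤ Real.exp (-v) := by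
  -- The remainder after the quadratic term is at most `(2/9)|v|³ ≤ (2/9) v²`, so `v²/2` loses less
  -- than `v²/4`.
  have h := Real.exp_bound (x := -v) (by rwa [abs_neg]) (n := 3) (by norm_num)
  simp only [Finset.sum_range_succ, Finset.range_zero, Finset.sum_empty, abs_neg] at h
  norm_num [Nat.factorial] at h
  have h2 := (abs_le.1 h).1
  have h3 : |v| ^ 3 ≤ v ^ 2 := by
    rw [pow_succ, sq_abs]; exact mul_le_of_le_one_right (sq_nonneg _) hv
  nlinarith [sq_nonneg v]

/-- Only the Hessian at `0` appears in this lower bound. Curvature therefore has to be controlled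
for a single random matrix, not along the ball. -/
lemma expLoss_sub_expLoss_zero_ge {x : ι → E} {s : ι → ℝ} (hs : ∀ i, 0 ≤ s i) {u : E}
    (hu : ∀ i, |inner ℝ (x i) u| ≤ 1) :
    (∑ i, s i * inner ℝ (x i) u ^ 2) / 4 - inner ℝ (∑ i, (s i - 1) • x i) u
      ≤ expLoss x s u - expLoss x s 0 := by
  unfold expLoss
  rw [sum_inner, Finset.sum_div, ← Finset.sum_sub_distrib, ← Finset.sum_sub_distrib]
  refine Finset.sum_le_sum fun i _ => ?_
  rw [real_inner_smul_left, inner_zero_right]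
  have := mul_le_mul_of_nonneg_left (one_sub_add_sq_div_le_exp_neg (hu i)) (hs i)
  simp only [neg_zero, Real.exp_zero]
  nlinarith

/-- Under a lower curvature bound, the minimizer over a large enough ball is an interior stationary
point, at a distance controlled by the score at `0`. -/
lemma norm_le_and_sum_smul_eq_zero_of_isMinOn {x : ι → E} {s : ι → ℝ} (hs : ∀ i, 0 ≤ s i) {r m : ℝ}
    (hm : 0 < m) (hcurv : ∀ z : E, m * ‖z‖ ^ 2 ≤ ∑ i, s i * inner ℝ (x i) z ^ 2)
    (hrow : ∀ i, ‖x i‖ * r ≤ 1) (hscore : 4 * ‖∑ i, (s i - 1) • x i‖ / m < r) {u : E}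
    (hu : u ∈ Metric.closedBall (0 : E) r)
    (hmin : IsMinOn (expLoss x s) (Metric.closedBall 0 r) u) :
    ‖u‖ ≤ 4 * ‖∑ i, (s i - 1) • x i‖ / m ∧
      ∑ i, (1 - s i * Real.exp (-inner ℝ (x i) u)) • x i = 0 := by
  have hur : ‖u‖ ≤ r := by simpa using hu
  have hr : 0 ≤ r := (norm_nonneg _).trans hur
  have hle : ‖u‖ ≤ 4 * ‖∑ i, (s i - 1) • x i‖ / m := by
    -- The basic inequality: `u` does no worse than `0`, so the quadratic gain `m‖u‖²/4` is at most
    -- `‖score‖ ‖u‖`.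
    have h0 : expLoss x s u ≤ expLoss x s 0 := hmin (by simpa using hr)
    have h1 := expLoss_sub_expLoss_zero_ge (x := x) hs (u := u) fun i =>
      (abs_real_inner_le_norm _ _).trans
        ((mul_le_mul_of_nonneg_left hur (norm_nonneg _)).trans (hrow i))
    have h2 := hcurv u
    have h3 := real_inner_le_norm (∑ i, (s i - 1) • x i) u
    rw [le_div_iff₀ hm]
    rcases (norm_nonneg u).eq_or_lt with h | h
    · rw [← h, zero_mul]; positivity
    · refine le_of_mul_le_mul_right ?_ h
      nlinarith
  refine ⟨hle, sum_smul_eq_zero_of_isLocalMin_expLoss (hmin.isLocalMin ?_)⟩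
  refine mem_of_superset (Metric.isOpen_ball.mem_nhds (x := u) ?_) Metric.ball_subset_closedBall
  simpa using hle.trans_lt hscore

/-- First-order expansion of weighted score residuals. -/
lemma abs_weighted_residual_sub_linearization_le {x : ι → E} {η : ι → ℝ} {S : ℝ}
    (hη : ∀ i, |1 + η i| ≤ S) {u : E} (hu : ∀ i, |inner ℝ (x i) u| ≤ 1) (q : ι → ℝ) :
    |∑ i, q i * (1 - (1 + η i) * Real.exp (-inner ℝ (x i) u))
        + ∑ i, η i * q i - inner ℝ (∑ i, q i • x i) u|
      ≤ ‖∑ i, η i • q i • x i‖ * ‖u‖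
        + S * (√(∑ i, q i ^ 2) * √(∑ i, inner ℝ (x i) u ^ 4)) := by
  -- An exact identity: the error splits into the random fluctuation of the derivative in `u`, kept
  -- as one vector sum, and the second-order Taylor remainder.
  have hkey : ∑ i, q i * (1 - (1 + η i) * Real.exp (-inner ℝ (x i) u))
        + ∑ i, η i * q i - inner ℝ (∑ i, q i • x i) u
      = inner ℝ (∑ i, η i • q i • x i) u
        - ∑ i, (1 + η i) * q i * (Real.exp (-inner ℝ (x i) u) - 1 - -inner ℝ (x i) u) := by
    simp only [sum_inner, real_inner_smul_left]
    rw [← Finset.sum_add_distrib, ← Finset.sum_sub_distrib, ← Finset.sum_sub_distrib]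
    exact Finset.sum_congr rfl fun i _ => by ring
  rw [hkey]
  refine (abs_sub _ _).trans (add_le_add (abs_real_inner_le_norm _ _) ?_)
  calc |∑ i, (1 + η i) * q i * (Real.exp (-inner ℝ (x i) u) - 1 - -inner ℝ (x i) u)|
      ≤ ∑ i, S * (|q i| * inner ℝ (x i) u ^ 2) := by
        refine (Finset.abs_sum_le_sum_abs _ _).trans (Finset.sum_le_sum fun i _ => ?_)
        rw [abs_mul, abs_mul, mul_assoc]
        have h1 := Real.abs_exp_sub_one_sub_id_le (x := -inner ℝ (x i) u)
          (by rw [abs_neg]; exact hu i)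
        rw [neg_sq] at h1
        have := (abs_nonneg _).trans (hη i)
        gcongr
        exact hη i
    _ = S * ∑ i, |q i| * inner ℝ (x i) u ^ 2 := by rw [Finset.mul_sum]
    _ ≤ _ := by
        -- Nonnegativity of `S` comes from an index; with no index both sides are `0`.
        rcases isEmpty_or_nonempty ι with h | ⟨⟨i₀⟩⟩
        · simp
        refine mul_le_mul_of_nonneg_left ?_ ((abs_nonneg _).trans (hη i₀))
        have := Real.sum_mul_le_sqrt_mul_sqrt Finset.univ (fun i => |q i|)
          fun i => inner ℝ (x i) u ^ 2
        simpa [sq_abs, ← pow_mul] using this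

end Loss

/-! ### Operator norm of a weighted sum of rank-one forms. -/

section Frobenius

variable {ι κ : Type*} [Fintype ι] [Fintype κ]

/-- The operator norm of a symmetric form is at most its Frobenius norm. -/
lemma abs_sum_mul_inner_sq_le (x : ι → EuclideanSpace ℝ κ) (η : ι → ℝ)
    (z : EuclideanSpace ℝ κ) :
    |∑ i, η i * inner ℝ (x i) z ^ 2|
      ≤ √(∑ k, ‖∑ i, η i • x i k • x i‖ ^ 2) * ‖z‖ ^ 2 := by
  have h1 : ∑ i, η i * inner ℝ (x i) z ^ 2 = ∑ k, z k * inner ℝ (∑ i, η i • x i k • x i) z := by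
    simp only [sum_inner, real_inner_smul_left, Finset.mul_sum]
    rw [Finset.sum_comm]
    refine Finset.sum_congr rfl fun i _ => ?_
    have : inner ℝ (x i) z = ∑ k, z k * x i k := by simp [PiLp.inner_apply]
    nth_rewrite 1 [sq, this]
    rw [Finset.sum_mul, Finset.mul_sum]
    exact Finset.sum_congr rfl fun k _ => by ring
  have h2 : √(∑ k, z k ^ 2) = ‖z‖ := by
    rw [EuclideanSpace.norm_eq]; simp
  rw [h1]
  calc |∑ k, z k * inner ℝ (∑ i, η i • x i k • x i) z|
      ≤ ∑ k, |z k| * (‖∑ i, η i • x i k • x i‖ * ‖z‖) := by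
        refine (Finset.abs_sum_le_sum_abs _ _).trans (Finset.sum_le_sum fun k _ => ?_)
        rw [abs_mul]
        gcongr
        exact abs_real_inner_le_norm _ _
    _ = (∑ k, |z k| * ‖∑ i, η i • x i k • x i‖) * ‖z‖ := by
        rw [Finset.sum_mul]; exact Finset.sum_congr rfl fun k _ => by ring
    _ ≤ (‖z‖ * √(∑ k, ‖∑ i, η i • x i k • x i‖ ^ 2)) * ‖z‖ := by
        gcongr
        have := Real.sum_mul_le_sqrt_mul_sqrt Finset.univ (fun k => |z k|)
          fun k => ‖∑ i, η i • x i k • x i‖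
        simpa only [sq_abs, h2] using this
    _ = _ := by ring

end Frobenius

/-! ### Penalties near zero and in their flat region -/

section Penalty

variable {ρ : ℝ → ℝ → ℝ}

lemma IsPenalty.eventually_half_mul_le (hρ : IsPenalty ρ) {lam : ℝ} (hlam : 0 < lam) :
    ∀ᶠ u in 𝓝 (0 : ℝ), lam / 2 * |u| ≤ ρ lam |u| := by
  have h := (hρ.tendsto_deriv lam hlam).eventually_const_lt (half_lt_self hlam)
  obtain ⟨δ, hδ, hball⟩ := (mem_nhdsGT_iff_exists_Ioo_subset).1 h
  have hδ' : (0 : ℝ) < δ := hδ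
  filter_upwards [Metric.ball_mem_nhds (0 : ℝ) hδ'] with u hu
  rw [Metric.mem_ball, dist_zero_right, Real.norm_eq_abs] at hu
  rcases (abs_nonneg u).eq_or_lt with h0 | hpos
  · rw [← h0, mul_zero]
    exact hρ.nonneg lam hlam 0 le_rfl
  set w := |u|
  -- The mean value inequality is used on `[v, w]` with `v > 0`, and then `v → 0`. Nonnegativity of
  -- the penalty at `v` replaces any appeal to continuity at `0`.
  have hstep : ∀ v ∈ Set.Ioo 0 w, lam / 2 * (w - v) ≤ ρ lam w := fun v hv => by
    have hmv := Convex.mul_sub_le_image_sub_of_le_deriv (convex_Icc v w)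
      (f := ρ lam) (C := lam / 2)
      (fun z hz => (hρ.differentiableAt lam hlam z
        (hv.1.trans_le hz.1)).continuousAt.continuousWithinAt)
      (fun z hz => (hρ.differentiableAt lam hlam z
        (hv.1.trans_le (interior_subset hz).1)).differentiableWithinAt)
      (fun z hz => (hball ⟨hv.1.trans_le (interior_subset hz).1,
        (interior_subset hz).2.trans_lt hu⟩).le)
      v ⟨le_rfl, hv.2.le⟩ w ⟨hv.2.le, le_rfl⟩ hv.2.le
    have := hρ.nonneg lam hlam v hv.1.le
    linarith
  have hlim : Tendsto (fun v : ℝ => lam / 2 * (w - v)) (𝓝[>] 0) (𝓝 (lam / 2 * (w - 0))) := by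
    have hc : Continuous fun v : ℝ => lam / 2 * (w - v) := by fun_prop
    exact (hc.tendsto 0).mono_left nhdsWithin_le_nhds
  rw [sub_zero] at hlim
  exact le_of_tendsto hlim (mem_of_superset (Ioo_mem_nhdsGT hpos) hstep)

lemma IsPenalty.eq_of_flat (hρ : IsPenalty ρ) {lam c u v : ℝ} (hlam : 0 < lam) (hc : 0 < c)
    (hflat : ∀ w, c ≤ w → deriv (ρ lam) w = 0) (hu : c ≤ u) (hv : c ≤ v) : ρ lam u = ρ lam v := by
  refine (convex_Ici c).is_const_of_fderivWithin_eq_zero (𝕜 := ℝ) (f := ρ lam)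
    (fun z hz => (hρ.differentiableAt lam hlam z
      (hc.trans_le hz)).differentiableWithinAt) (fun z hz => ?_) hu hv
  have hd := hρ.differentiableAt lam hlam z (hc.trans_le hz)
  rw [hd.fderivWithin (uniqueDiffOn_Ici c z hz)]
  ext
  simpa using hflat z hz

end Penalty

/-! ### Local minimizers of the penalized criterion -/

section Objective

variable {n p : ℕ}

/-- Zero extension of a vector indexed by `T`. -/
noncomputable def extend (T : Finset (Fin p)) (u : EuclideanSpace ℝ T) :
    EuclideanSpace ℝ (Fin p) :=
  WithLp.toLp 2 fun j => if h : j ∈ T then u ⟨j, h⟩ else 0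

lemma extend_apply_mem {T : Finset (Fin p)} (u : EuclideanSpace ℝ T) (k : T) :
    extend T u k = u k := by
  simp [extend]

lemma extend_apply_notMem {T : Finset (Fin p)} (u : EuclideanSpace ℝ T) {j : Fin p} (hj : j ∉ T) :
    extend T u j = 0 := by
  simp [extend, hj]

lemma inner_extend (T : Finset (Fin p)) (a : EuclideanSpace ℝ (Fin p)) (u : EuclideanSpace ℝ T) :
    inner ℝ a (extend T u) = inner ℝ (restr T a) u := by
  simp only [PiLp.inner_apply, RCLike.inner_apply, conj_trivial, restr]
  rw [← Finset.sum_subset (Finset.subset_univ T) (fun j _ hj => by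
    rw [extend_apply_notMem u hj, zero_mul]), ← Finset.sum_coe_sort]
  exact Finset.sum_congr rfl fun k _ => by rw [extend_apply_mem]

lemma norm_extend (T : Finset (Fin p)) (u : EuclideanSpace ℝ T) : ‖extend T u‖ = ‖u‖ := by
  have h : restr T (extend T u) = u := by
    ext k; exact extend_apply_mem u k
  rw [norm_eq_sqrt_real_inner, inner_extend, h, ← norm_eq_sqrt_real_inner]

lemma measurable_extend (T : Finset (Fin p)) : Measurable (extend T) := by
  unfold extend
  refine (WithLp.measurable_toLp 2 _).comp (measurable_pi_lambda _ fun j => ?_)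
  by_cases h : j ∈ T
  · simp only [h, dite_true]
    fun_prop
  · simp only [h, dite_false]
    fun_prop

lemma inner_row (X : Matrix (Fin n) (Fin p) ℝ) (i : Fin n) (h : EuclideanSpace ℝ (Fin p)) :
    inner ℝ (row X i) h = ∑ j, X i j * h j := by
  simp [PiLp.inner_apply, row, mul_comm]

/-- Sufficient conditions for a local minimum: stationarity and a flat penalty on `T`, a small
score outside `T`. -/
theorem isLocalMin_objective {ρ : ℝ → ℝ → ℝ} (hρ : IsPenalty ρ) {X : Matrix (Fin n) (Fin p) ℝ}
    {y : Fin n → ℝ} {β θ : EuclideanSpace ℝ (Fin p)} {lamT : ℝ} {T : Finset (Fin p)} {b : ℝ}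
    (hb : 0 < b) (hflat : ∀ lam, 0 < lam → ∀ u, b * lam ≤ u → deriv (ρ lam) u = 0)
    (hlam : ∀ j, 0 < lamT * ‖col X j‖ / √(n : ℝ)) (hθ : ∀ j ∉ T, θ j = 0)
    (hlarge : ∀ j ∈ T, b * (lamT * ‖col X j‖ / √(n : ℝ)) < |θ j|)
    (hstat : ∀ j ∈ T, ∑ i, X i j * (1 - (y i - inner ℝ (row X i) β) ^ 2
      * Real.exp (-inner ℝ (row X i) θ)) = 0)
    (hsmall : ∀ j ∉ T, |∑ i, X i j * (1 - (y i - inner ℝ (row X i) β) ^ 2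
      * Real.exp (-inner ℝ (row X i) θ))| ≤ 2 * n * (lamT * ‖col X j‖ / √(n : ℝ))) :
    IsLocalMin (objective ρ X y β lamT) θ := by
  set lam : Fin p → ℝ := fun j => lamT * ‖col X j‖ / √(n : ℝ) with hlam_def
  set R : Fin n → ℝ := fun i => (y i - inner ℝ (row X i) β) ^ 2 with hR
  set G : Fin p → ℝ := fun j => ∑ i, X i j * (1 - R i * Real.exp (-inner ℝ (row X i) θ)) with hG
  have hR0 : ∀ i, 0 ≤ R i := fun i => sq_nonneg _
  have hcoord : ∀ j, Tendsto (fun θ' : EuclideanSpace ℝ (Fin p) => θ' j) (𝓝 θ) (𝓝 (θ j)) :=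
    fun j => by
      have hc : Continuous fun θ' : EuclideanSpace ℝ (Fin p) => θ' j := by fun_prop
      exact hc.tendsto θ
  -- The perturbation separates over coordinates. On `T` both terms are unchanged to first order:
  -- flat penalty, zero score. Off `T` the local slope `4n · λ_j/2 = 2nλ_j` absorbs the score.
  have hpen : ∀ j, ∀ᶠ θ' in 𝓝 θ,
      4 * n * ρ (lam j) |θ j| ≤ 4 * n * ρ (lam j) |θ' j| + G j * (θ' j - θ j) := fun j => by
    by_cases hj : j ∈ T
    · have : ∀ᶠ θ' in 𝓝 θ, b * lam j < |θ' j| :=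
        ((hcoord j).abs).eventually_const_lt (hlarge j hj)
      filter_upwards [this] with θ' hθ'
      have h0 : G j = 0 := hstat j hj
      rw [hρ.eq_of_flat (hlam j) (mul_pos hb (hlam j)) (hflat _ (hlam j)) (hlarge j hj).le hθ'.le,
        h0, zero_mul, add_zero]
    · have h0 := hθ j hj
      have := (h0 ▸ hcoord j).eventually (hρ.eventually_half_mul_le (hlam j))
      filter_upwards [this] with θ' hθ'
      rw [h0, abs_zero, hρ.map_zero _ (hlam j), sub_zero, mul_zero]
      have h1 : -(|G j| * |θ' j|) ≤ G j * θ' j := by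
        rw [← abs_mul]; exact neg_abs_le _
      have h2 : |G j| * |θ' j| ≤ 2 * n * lam j * |θ' j| :=
        mul_le_mul_of_nonneg_right (hsmall j hj) (abs_nonneg _)
      have h3 : (4 * n : ℝ) * (lam j / 2 * |θ' j|) ≤ 4 * n * ρ (lam j) |θ' j| := by gcongr
      linarith
  filter_upwards [eventually_all.2 hpen] with θ' hθ'
  -- The smooth part is convex and hence lies above its tangent at `θ`, whose gradient is `G`.
  have hsm : ∑ j, G j * (θ' j - θ j) ≤
      (∑ i, inner ℝ (row X i) θ' + ∑ i, R i * Real.exp (-inner ℝ (row X i) θ'))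
      - (∑ i, inner ℝ (row X i) θ + ∑ i, R i * Real.exp (-inner ℝ (row X i) θ)) := by
    have e : ∑ j, G j * (θ' j - θ j) = ∑ i, (1 - R i * Real.exp (-inner ℝ (row X i) θ))
        * (inner ℝ (row X i) θ' - inner ℝ (row X i) θ) := by
      simp only [hG, Finset.sum_mul]
      rw [Finset.sum_comm]
      refine Finset.sum_congr rfl fun i _ => ?_
      rw [inner_row, inner_row, ← Finset.sum_sub_distrib, Finset.mul_sum]
      exact Finset.sum_congr rfl fun j _ => by ring
    rw [e, ← Finset.sum_add_distrib, ← Finset.sum_add_distrib, ← Finset.sum_sub_distrib]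
    refine Finset.sum_le_sum fun i _ => ?_
    set u : ℝ := inner ℝ (row X i) θ
    set v : ℝ := inner ℝ (row X i) θ'
    have h1 : Real.exp (-u) * (1 - (v - u)) ≤ Real.exp (-v) := by
      have := Real.add_one_le_exp (-(v - u))
      calc Real.exp (-u) * (1 - (v - u)) ≤ Real.exp (-u) * Real.exp (-(v - u)) := by
            gcongr; linarith
        _ = Real.exp (-v) := by rw [← Real.exp_add]; congr 1; ring
    have h2 := mul_le_mul_of_nonneg_left h1 (hR0 i)
    linarith
  have hsum := Finset.sum_le_sum fun j (_ : j ∈ Finset.univ) => hθ' j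
  rw [Finset.sum_add_distrib, ← Finset.mul_sum, ← Finset.mul_sum] at hsum
  unfold objective
  have hc : ∀ θ₀ : EuclideanSpace ℝ (Fin p), ∑ j, ρ (lamT * ‖col X j‖ / √(n : ℝ)) |θ₀ j|
      = ∑ j, ρ (lam j) |θ₀ j| := fun _ => rfl
  rw [hc, hc]
  change ∑ i, inner ℝ (row X i) θ + ∑ i, R i * Real.exp (-inner ℝ (row X i) θ) + _ ≤
    ∑ i, inner ℝ (row X i) θ' + ∑ i, R i * Real.exp (-inner ℝ (row X i) θ') + _
  linarith

/-- Standardized squared residuals `(yᵢ - xᵢ'β)² exp(-xᵢ'θ)`. -/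
noncomputable def stdSqResidual (X : Matrix (Fin n) (Fin p) ℝ) (β θ : EuclideanSpace ℝ (Fin p))
    (y : Fin n → ℝ) (i : Fin n) : ℝ :=
  (y i - inner ℝ (row X i) β) ^ 2 * Real.exp (-inner ℝ (row X i) θ)

/-- The factor `σ_i²` cancels exactly, so the minimization sees only the squared noise and no longer
depends on the true parameters except through `T`. -/
lemma stdSqResidual_response (X : Matrix (Fin n) (Fin p) ℝ) (β θ : EuclideanSpace ℝ (Fin p))
    (e : Fin n → ℝ) (i : Fin n) : stdSqResidual X β θ (response X β θ e) i = e i ^ 2 := by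
  have : Real.exp (inner ℝ (row X i) θ / 2) ^ 2 * Real.exp (-inner ℝ (row X i) θ) = 1 := by
    rw [← Real.exp_nat_mul, ← Real.exp_add, Real.exp_eq_one_iff]; push_cast; ring
  simp only [stdSqResidual, response, sigma, add_sub_cancel_left, mul_pow]
  linear_combination e i ^ 2 * this

/-- The parameter plus the zero extension of the constrained minimizer on the support. -/
noncomputable def oracleEstimator (X : Matrix (Fin n) (Fin p) ℝ) (T : Finset (Fin p))
    (β θ : EuclideanSpace ℝ (Fin p)) (r : ℝ) (y : Fin n → ℝ) : EuclideanSpace ℝ (Fin p) :=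
  θ + extend T (ballArgmin (fun i => restr T (row X i)) r (stdSqResidual X β θ y))

lemma measurable_oracleEstimator (X : Matrix (Fin n) (Fin p) ℝ) (T : Finset (Fin p))
    (β θ : EuclideanSpace ℝ (Fin p)) (r : ℝ) : Measurable (oracleEstimator X T β θ r) := by
  have h : Measurable (stdSqResidual X β θ) := by
    refine measurable_pi_lambda _ fun i => ?_
    unfold stdSqResidual
    fun_prop
  exact (((measurable_extend T).comp (measurable_ballArgmin _ r)).comp h).const_add θ

end Objective

/-! ### The empirical covariance and its inverse -/

section Gram

variable {n p : ℕ}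

/-- `Σ̂_TT⁻¹ a`. -/
noncomputable def invGram (X : Matrix (Fin n) (Fin p) ℝ) (T : Finset (Fin p))
    (a : EuclideanSpace ℝ T) : EuclideanSpace ℝ T :=
  WithLp.toLp 2 ((gram X T)⁻¹ *ᵥ a.ofLp)

lemma invForm_eq_inner (X : Matrix (Fin n) (Fin p) ℝ) (T : Finset (Fin p))
    (u a : EuclideanSpace ℝ T) : invForm X T u a = inner ℝ u (invGram X T a) := by
  simp [invForm, invGram, dotProduct, PiLp.inner_apply, mul_comm]

lemma gram_mulVec (X : Matrix (Fin n) (Fin p) ℝ) (T : Finset (Fin p)) (z : EuclideanSpace ℝ T) :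
    gram X T *ᵥ z.ofLp
      = ((n : ℝ)⁻¹ • ∑ i, inner ℝ (restr T (row X i)) z • restr T (row X i)).ofLp := by
  funext k
  simp only [Matrix.mulVec, dotProduct, gram, Matrix.of_apply, WithLp.ofLp_smul, WithLp.ofLp_sum,
    Pi.smul_apply, Finset.sum_apply, smul_eq_mul, PiLp.inner_apply, RCLike.inner_apply,
    conj_trivial, restr, row]
  simp only [mul_assoc, Finset.sum_mul, ← Finset.mul_sum]
  rw [Finset.sum_comm]
  congr 1
  refine Finset.sum_congr rfl fun i _ => Finset.sum_congr rfl fun j _ => by ring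

lemma isUnit_gram {X : Matrix (Fin n) (Fin p) ℝ} {T : Finset (Fin p)} {c : ℝ} (hc : 0 < c)
    (hn : 0 < n) (hlow : ∀ z : EuclideanSpace ℝ T,
      c * n * ‖z‖ ^ 2 ≤ ∑ i, inner ℝ (restr T (row X i)) z ^ 2) :
    IsUnit (gram X T) := by
  have hn' : (0 : ℝ) < n := by exact_mod_cast hn
  rw [← Matrix.mulVec_injective_iff_isUnit]
  refine (injective_iff_map_eq_zero (gram X T).mulVecLin).2 fun z hz => ?_
  set z' : EuclideanSpace ℝ T := WithLp.toLp 2 z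
  have h1 : gram X T *ᵥ z'.ofLp = 0 := hz
  rw [gram_mulVec] at h1
  have h2 : ∑ i, inner ℝ (restr T (row X i)) z' • restr T (row X i) = 0 := by
    have : (n : ℝ)⁻¹ • ∑ i, inner ℝ (restr T (row X i)) z' • restr T (row X i) = 0 := by
      ext k; exact congrFun h1 k
    exact (smul_eq_zero.1 this).resolve_left (by positivity)
  have h3 : ∑ i, inner ℝ (restr T (row X i)) z' ^ 2 = 0 := by
    have := congrArg (fun w => inner ℝ w z') h2
    simpa [sum_inner, real_inner_smul_left, sq] using this
  have h4 := hlow z'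
  rw [h3] at h4
  have h5 : ‖z'‖ ^ 2 = 0 := by
    have : 0 ≤ ‖z'‖ ^ 2 := by positivity
    nlinarith [mul_pos hc hn']
  have h6 : z' = 0 := by simpa using h5
  exact congrArg WithLp.ofLp h6

variable {X : Matrix (Fin n) (Fin p) ℝ} {T : Finset (Fin p)}

/-- This is why `x_i' Σ̂⁻¹ a` are the right weights: they combine the rows into `n a`, so that the
linearized stationarity equation isolates `a'u`. -/
lemma sum_inner_invGram_smul (hn : 0 < n) (hu : IsUnit (gram X T)) (a : EuclideanSpace ℝ T) :
    ∑ i, inner ℝ (restr T (row X i)) (invGram X T a) • restr T (row X i) = (n : ℝ) • a := by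
  have hn' : (n : ℝ) ≠ 0 := by exact_mod_cast hn.ne'
  have h1 := gram_mulVec X T (invGram X T a)
  have h2 : gram X T *ᵥ (invGram X T a).ofLp = a.ofLp := by
    rw [invGram, Matrix.mulVec_mulVec, Matrix.mul_nonsing_inv _
      ((Matrix.isUnit_iff_isUnit_det _).1 hu), Matrix.one_mulVec]
  rw [h2] at h1
  have h3 : a = (n : ℝ)⁻¹ • ∑ i, inner ℝ (restr T (row X i)) (invGram X T a) • restr T (row X i) := by
    ext k; exact congrFun h1 k
  nth_rewrite 2 [h3]
  rw [smul_smul, mul_inv_cancel₀ hn', one_smul]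

lemma sum_inner_invGram_sq (hn : 0 < n) (hu : IsUnit (gram X T)) (a : EuclideanSpace ℝ T) :
    ∑ i, inner ℝ (restr T (row X i)) (invGram X T a) ^ 2 = n * invForm X T a a := by
  have := congrArg (fun w => inner ℝ w (invGram X T a)) (sum_inner_invGram_smul hn hu a)
  simpa [sum_inner, real_inner_smul_left, sq, invForm_eq_inner] using this

lemma invForm_self_nonneg (hn : 0 < n) (hu : IsUnit (gram X T)) (a : EuclideanSpace ℝ T) :
    0 ≤ invForm X T a a := by
  have hn' : (0 : ℝ) < n := by exact_mod_cast hn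
  have h := sum_inner_invGram_sq hn hu a
  have h0 : 0 ≤ ∑ i, inner ℝ (restr T (row X i)) (invGram X T a) ^ 2 :=
    Finset.sum_nonneg fun i _ => sq_nonneg _
  rw [h] at h0
  exact nonneg_of_mul_nonneg_right h0 hn'

/-- Cauchy–Schwarz in `ℝⁿ` for the two weight vectors `x_i' Σ̂⁻¹ a` and `x_i' Σ̂⁻¹ b`. It lets
diagonal leverages control the off-diagonal ones. -/
lemma invForm_sq_le (hn : 0 < n) (hu : IsUnit (gram X T)) (a b : EuclideanSpace ℝ T) :
    invForm X T a b ^ 2 ≤ invForm X T a a * invForm X T b b := by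
  have hn' : (0 : ℝ) < n := by exact_mod_cast hn
  have h1 : (n : ℝ) * invForm X T a b = ∑ i, inner ℝ (restr T (row X i)) (invGram X T a)
      * inner ℝ (restr T (row X i)) (invGram X T b) := by
    have := congrArg (fun w => inner ℝ w (invGram X T b)) (sum_inner_invGram_smul hn hu a)
    simpa [sum_inner, real_inner_smul_left, invForm_eq_inner] using this.symm
  have h2 := Finset.sum_mul_sq_le_sq_mul_sq Finset.univ
    (fun i => inner ℝ (restr T (row X i)) (invGram X T a))
    fun i => inner ℝ (restr T (row X i)) (invGram X T b)
  rw [← h1, sum_inner_invGram_sq hn hu, sum_inner_invGram_sq hn hu] at h2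
  refine le_of_mul_le_mul_left ?_ (pow_pos hn' 2)
  linarith

lemma norm_invGram_le {c : ℝ} (hn : 0 < n) (hu : IsUnit (gram X T))
    (hlow : ∀ z : EuclideanSpace ℝ T,
      c * n * ‖z‖ ^ 2 ≤ ∑ i, inner ℝ (restr T (row X i)) z ^ 2) (a : EuclideanSpace ℝ T) :
    c * ‖invGram X T a‖ ^ 2 ≤ invForm X T a a := by
  have hn' : (0 : ℝ) < n := by exact_mod_cast hn
  have h := hlow (invGram X T a)
  rw [sum_inner_invGram_sq hn hu] at h
  refine le_of_mul_le_mul_left ?_ hn'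
  linarith

lemma invForm_self_le {c : ℝ} (hc : 0 < c) (hn : 0 < n) (hu : IsUnit (gram X T))
    (hlow : ∀ z : EuclideanSpace ℝ T,
      c * n * ‖z‖ ^ 2 ≤ ∑ i, inner ℝ (restr T (row X i)) z ^ 2) (a : EuclideanSpace ℝ T) :
    invForm X T a a ≤ ‖a‖ ^ 2 / c := by
  have h1 := norm_invGram_le hn hu hlow a
  have h2 : invForm X T a a ≤ ‖a‖ * ‖invGram X T a‖ := by
    rw [invForm_eq_inner]; exact real_inner_le_norm _ _
  rw [le_div_iff₀ hc]
  have h0 := invForm_self_nonneg hn hu a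
  nlinarith [sq_nonneg (‖a‖ - c * ‖invGram X T a‖)]

end Gram

/-! ### The minimizer on a well-behaved sample -/

section Regular

variable {ι κ : Type*} [Fintype ι] [Fintype κ]

/-- Bounds on the moments of the rows of a design with `N` rows of size about `√τ`. -/
structure RegularDesign (x : ι → EuclideanSpace ℝ κ) (N τ L C c : ℝ) : Prop where
  N_pos : 0 < N
  one_le_τ : 1 ≤ τ
  one_le_L : 1 ≤ L
  one_le_C : 1 ≤ C
  c_pos : 0 < c
  norm_sq_le : ∀ i, ‖x i‖ ^ 2 ≤ C * τ * L
  sum_norm_sq_le : ∑ i, ‖x i‖ ^ 2 ≤ C * N * τ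
  quartic_le : ∀ z, ∑ i, inner ℝ (x i) z ^ 4 ≤ C * N * ‖z‖ ^ 4
  le_quadratic : ∀ z, c * N * ‖z‖ ^ 2 ≤ ∑ i, inner ℝ (x i) z ^ 2
  -- The first condition makes the linearization remainder at most `‖q‖`, the second absorbs the
  -- Frobenius fluctuation of the Hessian in half of its curvature, and the third puts the score
  -- bound strictly inside the ball.
  growth : C * 130 * τ * L ^ 5 ≤ √N
  growth_curv : 128 * C * τ * L ^ 2 ≤ c * √N
  log_large : 512 * C < c * L

/-- Noise for which the weighted sums entering the local analysis are controlled. -/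
structure RegularNoise (x : ι → EuclideanSpace ℝ κ) (L : ℝ) (η : ι → ℝ) : Prop where
  neg_one_lt : ∀ i, -1 < η i
  abs_le : ∀ i, |η i| ≤ 64 * L
  score_le : ‖∑ i, η i • x i‖ ≤ 64 * L * √(∑ i, ‖x i‖ ^ 2)
  hessian_le : ∀ k, ‖∑ i, η i • x i k • x i‖ ≤ 64 * L * √(∑ i, ‖x i k • x i‖ ^ 2)

variable {x : ι → EuclideanSpace ℝ κ} {N τ L C c : ℝ} {η : ι → ℝ}

/-- The localization radius `L² √(τ / N)`. -/
noncomputable def locRadius (N τ L : ℝ) : ℝ := L ^ 2 * √(τ / N)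

lemma locRadius_nonneg (N τ L : ℝ) : 0 ≤ locRadius N τ L := by unfold locRadius; positivity

lemma RegularDesign.sqrt_N_pos (hx : RegularDesign x N τ L C c) : 0 < √N :=
  Real.sqrt_pos.2 hx.N_pos

lemma RegularDesign.sum_sq_mul_norm_sq_le (hx : RegularDesign x N τ L C c) (q : ι → ℝ) :
    √(∑ i, ‖q i • x i‖ ^ 2) ≤ √(C * τ * L) * √(∑ i, q i ^ 2) := by
  have := hx.one_le_τ; have := hx.one_le_L; have := hx.one_le_C
  rw [← Real.sqrt_mul (by positivity)]
  refine Real.sqrt_le_sqrt ?_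
  rw [Finset.mul_sum]
  refine Finset.sum_le_sum fun i _ => ?_
  rw [norm_smul, mul_pow, Real.norm_eq_abs, sq_abs, mul_comm]
  exact mul_le_mul_of_nonneg_right (hx.norm_sq_le i) (sq_nonneg _)

lemma RegularDesign.sqrt_le (hx : RegularDesign x N τ L C c) : √(C * τ * L) ≤ C * √τ * L := by
  have h1 := hx.one_le_τ; have h2 := hx.one_le_L; have h3 := hx.one_le_C
  refine Real.sqrt_le_iff.2 ⟨by positivity, ?_⟩
  rw [mul_pow, mul_pow, Real.sq_sqrt (by positivity)]
  have h4 : C ≤ C ^ 2 := by nlinarith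
  have h5 : L ≤ L ^ 2 := by nlinarith
  gcongr

/-- Keeps every `x_i'u` in `[-1, 1]` on the localization ball, where the Taylor bounds for the
exponential apply. -/
lemma RegularDesign.abs_inner_le_one (hx : RegularDesign x N τ L C c) (i : ι) :
    ‖x i‖ * locRadius N τ L ≤ 1 := by
  have h1 := hx.one_le_τ; have h2 := hx.one_le_L; have h3 := hx.one_le_C
  have hN := hx.sqrt_N_pos
  have h4 : ‖x i‖ ≤ C * √τ * L :=
    (Real.le_sqrt_of_sq_le (hx.norm_sq_le i)).trans hx.sqrt_le
  have hτ : √τ * √τ = τ := Real.mul_self_sqrt (by linarith)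
  calc ‖x i‖ * locRadius N τ L ≤ (C * √τ * L) * locRadius N τ L :=
        mul_le_mul_of_nonneg_right h4 (locRadius_nonneg _ _ _)
    _ = C * τ * L ^ 3 / √N := by
        rw [locRadius, Real.sqrt_div (by linarith)]
        field_simp
        rw [sq, hτ]
    _ ≤ 1 := by
        rw [div_le_one hN]
        refine le_trans ?_ hx.growth
        have : L ^ 3 ≤ L ^ 5 := pow_le_pow_right₀ h2 (by norm_num)
        have : C * τ * L ^ 3 ≤ C * τ * L ^ 5 := by gcongr
        have : 0 ≤ C * τ * L ^ 5 := by positivity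
        nlinarith

/-- The squared Frobenius norm of the noise part is at most `(64L)² ∑ ‖x_i‖⁴`, of order `τ² N L³`,
which the growth condition places below `(cN/2)²`. Passing through the Frobenius norm avoids matrix
concentration; its dimensional loss is affordable because `τ` is much smaller than `√N`. -/
lemma RegularDesign.curvature (hx : RegularDesign x N τ L C c) (hη : RegularNoise x L η)
    (z : EuclideanSpace ℝ κ) :
    c * N / 2 * ‖z‖ ^ 2 ≤ ∑ i, (1 + η i) * inner ℝ (x i) z ^ 2 := by
  have h1 := hx.one_le_τ; have h2 := hx.one_le_L; have h3 := hx.one_le_C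
  have hN := hx.N_pos
  have hsN := hx.sqrt_N_pos
  have hF : √(∑ k, ‖∑ i, η i • x i k • x i‖ ^ 2) ≤ c * N / 2 := by
    have e1 : ∑ k, ‖∑ i, η i • x i k • x i‖ ^ 2 ≤ (64 * L) ^ 2 * (C * τ * L * (C * N * τ)) := by
      calc ∑ k, ‖∑ i, η i • x i k • x i‖ ^ 2
          ≤ ∑ k, (64 * L) ^ 2 * ∑ i, ‖x i k • x i‖ ^ 2 := by
            refine Finset.sum_le_sum fun k _ => ?_
            have hs : 0 ≤ ∑ i, ‖x i k • x i‖ ^ 2 := Finset.sum_nonneg fun i _ => sq_nonneg _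
            rw [← Real.sq_sqrt hs, ← mul_pow]
            exact pow_le_pow_left₀ (norm_nonneg _) (hη.hessian_le k) 2
        _ = (64 * L) ^ 2 * ∑ i, ‖x i‖ ^ 2 * ‖x i‖ ^ 2 := by
            rw [← Finset.mul_sum, Finset.sum_comm]
            congr 1
            refine Finset.sum_congr rfl fun i _ => ?_
            simp only [norm_smul, mul_pow, Real.norm_eq_abs, sq_abs]
            rw [← Finset.sum_mul, ← EuclideanSpace.real_norm_sq_eq]
        _ ≤ (64 * L) ^ 2 * ∑ i, C * τ * L * ‖x i‖ ^ 2 := by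
            gcongr with i
            exact hx.norm_sq_le i
        _ ≤ _ := by
            rw [← Finset.mul_sum]
            gcongr
            exact hx.sum_norm_sq_le
    refine Real.sqrt_le_iff.2 ⟨by have := hx.c_pos; positivity, e1.trans ?_⟩
    have e2 : (64 * L) ^ 2 * (C * τ * L * (C * N * τ)) ≤ (64 * C * τ * L ^ 2) ^ 2 * N := by
      have : L ^ 3 ≤ L ^ 4 := pow_le_pow_right₀ h2 (by norm_num)
      calc (64 * L) ^ 2 * (C * τ * L * (C * N * τ)) = 64 ^ 2 * C ^ 2 * τ ^ 2 * N * L ^ 3 := by ring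
        _ ≤ 64 ^ 2 * C ^ 2 * τ ^ 2 * N * L ^ 4 := by gcongr
        _ = _ := by ring
    refine e2.trans ?_
    have e3 : 64 * C * τ * L ^ 2 ≤ c * √N / 2 := by linarith [hx.growth_curv]
    calc (64 * C * τ * L ^ 2) ^ 2 * N ≤ (c * √N / 2) ^ 2 * N := by gcongr
      _ = (c / 2) ^ 2 * √N ^ 2 * N := by ring
      _ = (c * N / 2) ^ 2 := by rw [Real.sq_sqrt hN.le]; ring
  have hd := (abs_le.1 ((abs_sum_mul_inner_sq_le x η z).trans
    (mul_le_mul_of_nonneg_right hF (sq_nonneg _)))).1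
  have e : ∑ i, (1 + η i) * inner ℝ (x i) z ^ 2
      = ∑ i, inner ℝ (x i) z ^ 2 + ∑ i, η i * inner ℝ (x i) z ^ 2 := by
    rw [← Finset.sum_add_distrib]; exact Finset.sum_congr rfl fun i _ => by ring
  have := hx.le_quadratic z
  rw [e]; linarith

lemma RegularDesign.separating (hx : RegularDesign x N τ L C c) (u : EuclideanSpace ℝ κ)
    (hu : u ≠ 0) : ∃ i, inner ℝ (x i) u ≠ 0 := by
  by_contra h
  push Not at h
  have h1 := hx.le_quadratic u
  simp only [h] at h1
  have : 0 < c * N * ‖u‖ ^ 2 := by have := hx.c_pos; have := hx.N_pos; positivity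
  simp at h1
  linarith

/-- On a regular sample the constrained minimizer is a stationary point near `0`. -/
theorem RegularDesign.ballArgmin_spec (hx : RegularDesign x N τ L C c) (hη : RegularNoise x L η)
    {s : ι → ℝ} (hs : ∀ i, s i = 1 + η i) :
    ‖ballArgmin x (locRadius N τ L) s‖ ≤ locRadius N τ L ∧
    ‖ballArgmin x (locRadius N τ L) s‖ ≤ 8 * ‖∑ i, η i • x i‖ / (c * N) ∧
      ∑ i, (1 - (1 + η i) * Real.exp (-inner ℝ (x i) (ballArgmin x (locRadius N τ L) s))) • x i
        = 0 := by
  have h1 := hx.one_le_τ; have h2 := hx.one_le_L; have h3 := hx.one_le_C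
  have hN := hx.N_pos
  have hc := hx.c_pos
  have hsN := hx.sqrt_N_pos
  have hs0 : ∀ i, 0 < s i := fun i => by rw [hs]; linarith [hη.neg_one_lt i]
  have hsp := Hippo.ballArgmin_spec (locRadius_nonneg N τ L) hx.separating hs0
  have hg : ∑ i, (s i - 1) • x i = ∑ i, η i • x i :=
    Finset.sum_congr rfl fun i _ => by rw [hs]; congr 1; ring
  -- The score bound yields a distance of at most `512 C L √(τ/N) / c`, below `L² √(τ/N)` precisely
  -- when `512 C < c L`. The extra logarithm in the radius is there for this.
  have hscore : 4 * ‖∑ i, (s i - 1) • x i‖ / (c * N / 2) < locRadius N τ L := by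
    rw [hg, div_lt_iff₀ (by positivity), locRadius, Real.sqrt_div (by linarith)]
    have hS : √(∑ i, ‖x i‖ ^ 2) ≤ C * √N * √τ := by
      refine Real.sqrt_le_iff.2 ⟨by positivity, hx.sum_norm_sq_le.trans ?_⟩
      rw [mul_pow, mul_pow, Real.sq_sqrt hN.le, Real.sq_sqrt (by linarith)]
      have : C ≤ C ^ 2 := by nlinarith
      gcongr
    have h4 : ‖∑ i, η i • x i‖ ≤ 64 * L * (C * √N * √τ) := hη.score_le.trans (by gcongr)
    have e : L ^ 2 * (√τ / √N) * (c * N / 2) = L * √N * √τ * (c * L) / 2 := by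
      rw [← Real.sq_sqrt hN.le]; field_simp; rw [Real.sqrt_sq hsN.le]
    rw [e]
    have hp : 0 < L * √N * √τ := by positivity
    nlinarith [mul_lt_mul_of_pos_left hx.log_large hp]
  obtain ⟨ha, hb⟩ := norm_le_and_sum_smul_eq_zero_of_isMinOn (fun i => (hs0 i).le)
    (by positivity : 0 < c * N / 2)
    (fun z => by simpa only [hs] using hx.curvature hη z) hx.abs_inner_le_one hscore hsp.1 hsp.2
  refine ⟨by simpa using hsp.1, ?_, by simpa only [hs] using hb⟩
  rw [hg] at ha
  refine ha.trans (le_of_eq ?_)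
  field_simp; ring

/-- Linearization of weighted residuals on a regular sample, uniformly over the localization
ball. -/
theorem RegularDesign.linearization_le (hx : RegularDesign x N τ L C c) (hη : RegularNoise x L η)
    {u : EuclideanSpace ℝ κ} (hu : ‖u‖ ≤ locRadius N τ L) {q : ι → ℝ}
    (hq : ‖∑ i, η i • q i • x i‖ ≤ 64 * L * √(∑ i, ‖q i • x i‖ ^ 2)) :
    |∑ i, q i * (1 - (1 + η i) * Real.exp (-inner ℝ (x i) u))
        + ∑ i, η i * q i - inner ℝ (∑ i, q i • x i) u|
      ≤ 130 * C * τ * L ^ 5 / √N * √(∑ i, q i ^ 2) := by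
  have h1 := hx.one_le_τ; have h2 := hx.one_le_L; have h3 := hx.one_le_C
  have hN := hx.N_pos
  have hsN := hx.sqrt_N_pos
  have hτ : √τ ^ 2 = τ := Real.sq_sqrt (by linarith)
  have hbd : ∀ i, |inner ℝ (x i) u| ≤ 1 := fun i => (abs_real_inner_le_norm _ _).trans
    ((mul_le_mul_of_nonneg_left hu (norm_nonneg _)).trans (hx.abs_inner_le_one i))
  have hS : ∀ i, |1 + η i| ≤ 65 * L := fun i => by
    have := abs_add_le 1 (η i)
    rw [abs_one] at this
    linarith [hη.abs_le i]
  refine (abs_weighted_residual_sub_linearization_le hS hbd q).trans ?_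
  set Q := √(∑ i, q i ^ 2) with hQ
  have hr : locRadius N τ L = L ^ 2 * √τ / √N := by
    rw [locRadius, Real.sqrt_div (by linarith), mul_div_assoc]
  have e1 : ‖∑ i, η i • q i • x i‖ * ‖u‖ ≤ 64 * C * τ * L ^ 5 / √N * Q := by
    calc ‖∑ i, η i • q i • x i‖ * ‖u‖
        ≤ (64 * L * (C * √τ * L * Q)) * (L ^ 2 * √τ / √N) := by
          rw [← hr]
          gcongr
          exact hq.trans (mul_le_mul_of_nonneg_left ((hx.sum_sq_mul_norm_sq_le q).trans
            (mul_le_mul_of_nonneg_right hx.sqrt_le (Real.sqrt_nonneg _))) (by positivity))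
      _ = 64 * C * √τ ^ 2 * L ^ 4 / √N * Q := by ring
      _ = 64 * C * τ * L ^ 4 / √N * Q := by rw [hτ]
      _ ≤ 64 * C * τ * L ^ 5 / √N * Q := by
          gcongr
          norm_num
  have e2 : √(∑ i, inner ℝ (x i) u ^ 4) ≤ C * τ * L ^ 4 / √N := by
    refine Real.sqrt_le_iff.2 ⟨by positivity, (hx.quartic_le u).trans ?_⟩
    calc C * N * ‖u‖ ^ 4 ≤ C ^ 2 * N * (L ^ 2 * √τ / √N) ^ 4 := by
          rw [← hr]
          have : C ≤ C ^ 2 := by nlinarith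
          gcongr
      _ = C ^ 2 * N * ((√τ ^ 2) ^ 2 * L ^ 8 / (√N ^ 2) ^ 2) := by rw [div_pow]; ring
      _ = C ^ 2 * N * (τ ^ 2 * L ^ 8 / N ^ 2) := by rw [hτ, Real.sq_sqrt hN.le]
      _ = (C * τ * L ^ 4) ^ 2 / N := by field_simp
      _ = (C * τ * L ^ 4 / √N) ^ 2 := by rw [div_pow, Real.sq_sqrt hN.le]
  calc ‖∑ i, η i • q i • x i‖ * ‖u‖ + 65 * L * (Q * √(∑ i, inner ℝ (x i) u ^ 4))
      ≤ 64 * C * τ * L ^ 5 / √N * Q + 65 * L * (Q * (C * τ * L ^ 4 / √N)) := by gcongr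
    _ = 129 * C * τ * L ^ 5 / √N * Q := by ring
    _ ≤ _ := by gcongr; norm_num

end Regular

/-! ### Orders of magnitude -/

section Orders

lemma SubPoly.mul {f g : ℕ → ℝ} (hf : SubPoly f) (hg : SubPoly g) :
    SubPoly fun n => f n * g n := fun γ hγ => by
  refine ((hf (γ / 2) (half_pos hγ)).mul (hg (γ / 2) (half_pos hγ))).congr' .rfl ?_
  filter_upwards [eventually_gt_atTop 0] with n hn
  rw [← Real.rpow_add (by exact_mod_cast hn), add_halves]

lemma subPoly_const (c : ℝ) : SubPoly fun _ => c := fun γ hγ => by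
  refine isLittleO_const_left.2 (Or.inr ?_)
  have := (tendsto_rpow_atTop hγ).comp tendsto_natCast_atTop_atTop
  exact tendsto_norm_atTop_atTop.comp this

lemma SubPoly.pow {f : ℕ → ℝ} (hf : SubPoly f) (m : ℕ) : SubPoly fun n => f n ^ m := by
  induction m with
  | zero => simpa using subPoly_const 1
  | succ m ih => simpa only [pow_succ] using ih.mul hf

lemma SubPoly.tendsto_mul_polyDecay {f g : ℕ → ℝ} (hf : SubPoly f) (hg : PolyDecay g) :
    Tendsto (fun n => f n * g n) atTop (𝓝 0) := by
  obtain ⟨γ, hγ, hO⟩ := hg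
  have h := (hf γ hγ).mul_isBigO hO
  refine (isLittleO_one_iff ℝ).1 (h.congr' .rfl ?_)
  filter_upwards [eventually_gt_atTop 0] with n hn
  rw [← Real.rpow_add (by exact_mod_cast hn), add_neg_cancel, Real.rpow_zero]

/-- Replacing `t` by `t + 1` costs nothing since `1/√n` itself decays polynomially, and it keeps `τ
≥ 1` when the support is empty. -/
lemma PolyDecay.add_one_div_sqrt {t : ℕ → ℝ} (h : PolyDecay fun n => t n / √(n : ℝ)) :
    PolyDecay fun n => (t n + 1) / √(n : ℝ) := by
  obtain ⟨γ, hγ, hO⟩ := h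
  have hmono : ∀ a b : ℝ, a ≤ b →
      (fun n : ℕ => (n : ℝ) ^ (-b)) =O[atTop] fun n : ℕ => (n : ℝ) ^ (-a) := fun a b hab => by
    refine .of_bound 1 ?_
    filter_upwards [eventually_ge_atTop 1] with n hn
    have hn' : (1 : ℝ) ≤ n := by exact_mod_cast hn
    rw [one_mul, Real.norm_of_nonneg (by positivity), Real.norm_of_nonneg (by positivity)]
    exact Real.rpow_le_rpow_of_exponent_le hn' (by linarith)
  refine ⟨min γ (1 / 2), by positivity, ?_⟩
  have h1 := hO.trans (hmono _ _ (min_le_left γ (1 / 2)))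
  have h2 : (fun n : ℕ => 1 / √(n : ℝ)) =O[atTop] fun n : ℕ => (n : ℝ) ^ (-(min γ (1 / 2))) := by
    refine IsBigO.trans (.of_bound 1 (Eventually.of_forall fun n => ?_))
      (hmono _ _ (min_le_right γ (1 / 2)))
    rw [Real.rpow_neg (by positivity), ← Real.sqrt_eq_rpow, one_mul, one_div]
  refine (h1.add h2).congr_left fun n => ?_
  rw [add_div]

lemma tendsto_log_atTop_of_le {p : ℕ → ℕ} (hp : ∀ᶠ n in atTop, n ≤ p n) :
    Tendsto (fun n => Real.log (p n)) atTop atTop :=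
  Real.tendsto_log_atTop.comp (tendsto_natCast_atTop_atTop.comp
    (tendsto_atTop_mono' _ hp tendsto_id))

end Orders

/-! ### Events of vanishing probability -/

section Negligible

variable {Ω : ℕ → Type*} [∀ n, MeasurableSpace (Ω n)] {P : ∀ n, Measure (Ω n)}

lemma tendsto_measure_zero_of_subset {S R : ∀ n, Set (Ω n)}
    (hR : Tendsto (fun n => P n (R n)) atTop (𝓝 0)) (h : ∀ᶠ n in atTop, S n ⊆ R n) :
    Tendsto (fun n => P n (S n)) atTop (𝓝 0) :=
  tendsto_of_tendsto_of_tendsto_of_le_of_le' tendsto_const_nhds hR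
    (Eventually.of_forall fun _ => zero_le) (h.mono fun _ hn => measure_mono hn)

lemma tendsto_measure_zero_union {S R : ∀ n, Set (Ω n)}
    (hS : Tendsto (fun n => P n (S n)) atTop (𝓝 0))
    (hR : Tendsto (fun n => P n (R n)) atTop (𝓝 0)) :
    Tendsto (fun n => P n (S n ∪ R n)) atTop (𝓝 0) := by
  have := hS.add hR
  rw [add_zero] at this
  exact tendsto_of_tendsto_of_tendsto_of_le_of_le tendsto_const_nhds this
    (fun _ => zero_le) fun n => measure_union_le _ _

lemma isBigOP_of_tendsto_zero {Z : ∀ n, Ω n → ℝ} {r : ℕ → ℝ} (M : ℝ)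
    (h : Tendsto (fun n => P n {ω | M * r n < |Z n ω|}) atTop (𝓝 0)) : IsBigOP P Z r :=
  fun δ hδ => ⟨M, h.eventually_le_const (by simpa using hδ)⟩

/-- One factor `p` counts functionals and the other counts coordinates of vector-valued sums; the
tail is `2p⁻⁴`. -/
lemma tendsto_sq_mul_exp_neg_log {p : ℕ → ℕ} (hp : ∀ᶠ n in atTop, n ≤ p n) :
    Tendsto (fun n => (p n : ℝ≥0∞) * ((p n : ℝ≥0∞)
      * ENNReal.ofReal (2 * Real.exp (-(4 * Real.log (p n)))))) atTop (𝓝 0) := by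
  have h1 : Tendsto (fun n => (p n : ℝ)) atTop atTop :=
    tendsto_natCast_atTop_atTop.comp (tendsto_atTop_mono' _ hp tendsto_id)
  have h2 : Tendsto (fun n => 2 * ((p n : ℝ) ^ 2)⁻¹) atTop (𝓝 0) := by
    have := (tendsto_inv_atTop_zero.comp ((tendsto_pow_atTop (two_ne_zero)).comp h1)).const_mul
      (2 : ℝ)
    simpa using this
  have h3 := ENNReal.tendsto_ofReal h2
  rw [ENNReal.ofReal_zero] at h3
  refine h3.congr' ?_
  filter_upwards [h1.eventually_gt_atTop 0] with n hn
  rw [← ENNReal.ofReal_natCast, ← ENNReal.ofReal_mul hn.le, ← ENNReal.ofReal_mul hn.le]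
  congr 1
  have : Real.exp (-(4 * Real.log (p n))) = ((p n : ℝ) ^ 4)⁻¹ := by
    rw [Real.exp_neg, show (4 : ℝ) * Real.log (p n) = ((4 : ℕ) : ℝ) * Real.log (p n) by norm_num,
      Real.exp_nat_mul, Real.exp_log hn]
  rw [this]; field_simp

variable [∀ n, IsProbabilityMeasure (P n)] {ε : ∀ n, Fin n → Ω n → ℝ} {p : ℕ → ℕ}

lemma tendsto_measure_exists_abs_sum_gt (hp : ∀ᶠ n in atTop, n ≤ p n)
    (hlaw : ∀ n i, HasLaw (ε n i) (gaussianReal 0 1) (P n)) (hind : ∀ n, iIndepFun (ε n) (P n))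
    {J : ℕ → Type*} [∀ n, Fintype (J n)] (hJ : ∀ᶠ n in atTop, Fintype.card (J n) ≤ p n)
    {c : ∀ n, J n → Fin n → ℝ} {V B : ∀ n, J n → ℝ}
    (hV : ∀ᶠ n in atTop, ∀ j, ∑ i, c n j i ^ 2 ≤ V n j)
    (hB : ∀ᶠ n in atTop, ∀ j, 0 ≤ B n j ∧ ∀ i, |c n j i| ≤ B n j) :
    Tendsto (fun n => P n {ω | ∃ j, 32 * (√(Real.log (p n) * V n j) + Real.log (p n) * B n j)
      < |∑ i, (ε n i ω ^ 2 - 1) * c n j i|}) atTop (𝓝 0) := by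
  refine tendsto_of_tendsto_of_tendsto_of_le_of_le' tendsto_const_nhds
    (tendsto_sq_mul_exp_neg_log hp) (Eventually.of_forall fun _ => zero_le) ?_
  filter_upwards [hJ, hV, hB, (tendsto_log_atTop_of_le hp).eventually_gt_atTop 0, hp,
    eventually_gt_atTop 0] with n hJn hVn hBn hL hpn hn
  rw [Set.ofPred_exists]
  refine (measure_iUnion_fintype_le _ _).trans ((Finset.sum_le_sum fun j _ =>
    measure_abs_sum_mul_sq_sub_one_gt_le (hlaw n) (hind n) (c n j) hL (hVn j) (hBn j).1
      (hBn j).2).trans ?_)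
  rw [Finset.sum_const, Finset.card_univ, nsmul_eq_mul]
  -- Scalar sums need only one factor `p`; the second is inserted as a number at least `1` to reuse
  -- the same limit.
  refine mul_le_mul' (by exact_mod_cast hJn) (le_mul_of_one_le_left' ?_)
  exact_mod_cast hn.trans_le hpn

lemma tendsto_measure_exists_norm_sum_gt (hp : ∀ᶠ n in atTop, n ≤ p n)
    (hlaw : ∀ n i, HasLaw (ε n i) (gaussianReal 0 1) (P n)) (hind : ∀ n, iIndepFun (ε n) (P n))
    {J κ : ℕ → Type*} [∀ n, Fintype (J n)] [∀ n, Fintype (κ n)]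
    (hJ : ∀ᶠ n in atTop, Fintype.card (J n) ≤ p n)
    (hκ : ∀ᶠ n in atTop, Fintype.card (κ n) ≤ p n)
    (y : ∀ n, J n → Fin n → EuclideanSpace ℝ (κ n)) :
    Tendsto (fun n => P n {ω | ∃ j, 64 * Real.log (p n) * √(∑ i, ‖y n j i‖ ^ 2)
      < ‖∑ i, (ε n i ω ^ 2 - 1) • y n j i‖}) atTop (𝓝 0) := by
  refine tendsto_of_tendsto_of_tendsto_of_le_of_le' tendsto_const_nhds
    (tendsto_sq_mul_exp_neg_log hp) (Eventually.of_forall fun _ => zero_le) ?_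
  filter_upwards [hJ, hκ, (tendsto_log_atTop_of_le hp).eventually_ge_atTop 1] with n hJn hκn hL
  rw [Set.ofPred_exists]
  refine (measure_iUnion_fintype_le _ _).trans ((Finset.sum_le_sum fun j _ =>
    measure_norm_sum_smul_gt_le (hlaw n) (hind n) (y n j) hL).trans ?_)
  rw [Finset.sum_const, Finset.card_univ, nsmul_eq_mul]
  gcongr

end Negligible

/-! ### The constrained minimizer along the triangular array -/

section Array

variable {Ω : ℕ → Type*} [∀ n, MeasurableSpace (Ω n)] {P : ∀ n, Measure (Ω n)}
  [∀ n, IsProbabilityMeasure (P n)] {ε : ∀ n, Fin n → Ω n → ℝ} {p : ℕ → ℕ}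
  {κ : ℕ → Type*} [∀ n, Fintype (κ n)]

lemma tendsto_measure_not_regularNoise (hp : ∀ᶠ n in atTop, n ≤ p n)
    (hlaw : ∀ n i, HasLaw (ε n i) (gaussianReal 0 1) (P n)) (hind : ∀ n, iIndepFun (ε n) (P n))
    (hκ : ∀ᶠ n in atTop, Fintype.card (κ n) ≤ p n) (x : ∀ n, Fin n → EuclideanSpace ℝ (κ n)) :
    Tendsto (fun n => P n {ω | ¬ RegularNoise (x n) (Real.log (p n)) fun i => ε n i ω ^ 2 - 1})
      atTop (𝓝 0) := by
  -- The strict bound `η_i > -1` fails only when `ε_i = 0`, a null event. Strictness gives positive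
  -- weights and hence a unique minimizer.
  have h1 : Tendsto (fun n => P n {ω | ∃ i, ε n i ω = 0}) atTop (𝓝 0) := by
    have : ∀ n, P n {ω | ∃ i, ε n i ω = 0} = 0 := fun n => by
      rw [Set.ofPred_exists, measure_iUnion_null_iff]
      intro i
      have h := (hlaw n i).measure_eq (p := fun y => y = 0) (measurableSet_singleton 0)
      rw [h]
      have := nullSingletonClass_gaussianReal (μ := 0) (v := 1) one_ne_zero
      exact measure_singleton 0
    simp [this]
  -- Indicator weights turn the deviation inequality for sums into a maximal inequality for the
  -- individual `η_j`.
  have h2 := tendsto_measure_exists_abs_sum_gt hp hlaw hind (J := fun n => Fin n)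
    (by simpa using hp) (c := fun n j i => if i = j then 1 else 0) (V := fun _ _ => 1)
    (B := fun _ _ => 1) (Eventually.of_forall fun n j => by simp)
    (Eventually.of_forall fun n j => ⟨zero_le_one, fun i => by split_ifs <;> simp⟩)
  have h3 := tendsto_measure_exists_norm_sum_gt hp hlaw hind (J := fun _ => Unit)
    (by filter_upwards [hp, eventually_gt_atTop 0] with n h h'; simp; omega) hκ
    (fun n _ i => x n i)
  have h4 := tendsto_measure_exists_norm_sum_gt hp hlaw hind (J := κ) hκ hκ
    (fun n k i => x n i k • x n i)
  refine tendsto_measure_zero_of_subset (tendsto_measure_zero_union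
    (tendsto_measure_zero_union h1 h2) (tendsto_measure_zero_union h3 h4)) ?_
  filter_upwards [(tendsto_log_atTop_of_le hp).eventually_ge_atTop 1] with n hL ω hω
  by_contra hcon
  simp only [Set.mem_union, Set.mem_ofPred_eq, not_or, not_exists, not_lt] at hcon hω
  obtain ⟨⟨c1, c2⟩, c3, c4⟩ := hcon
  refine hω ⟨fun i => ?_, fun i => ?_, c3 (), c4⟩
  · have := c1 i
    have : 0 < ε n i ω ^ 2 := by positivity
    linarith
  · have := c2 i
    simp only [mul_ite, mul_one, mul_zero, Finset.sum_ite_eq', Finset.mem_univ, if_true] at this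
    refine this.trans ?_
    have : √(Real.log (p n)) ≤ Real.log (p n) :=
      Real.sqrt_le_iff.2 ⟨by linarith, by nlinarith⟩
    linarith

/-- The constrained minimizer for the noise `ε`. -/
noncomputable def arrayArgmin (x : ∀ n, Fin n → EuclideanSpace ℝ (κ n)) (τ : ℕ → ℝ) (p : ℕ → ℕ)
    (ε : ∀ n, Fin n → Ω n → ℝ) (n : ℕ) (ω : Ω n) : EuclideanSpace ℝ (κ n) :=
  ballArgmin (x n) (locRadius n (τ n) (Real.log (p n))) fun i => ε n i ω ^ 2

variable {x : ∀ n, Fin n → EuclideanSpace ℝ (κ n)} {τ : ℕ → ℝ} {C c : ℝ}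

lemma tendsto_measure_not_stationary (hp : ∀ᶠ n in atTop, n ≤ p n)
    (hlaw : ∀ n i, HasLaw (ε n i) (gaussianReal 0 1) (P n)) (hind : ∀ n, iIndepFun (ε n) (P n))
    (hκ : ∀ᶠ n in atTop, Fintype.card (κ n) ≤ p n)
    (hreg : ∀ᶠ n in atTop, RegularDesign (x n) n (τ n) (Real.log (p n)) C c) :
    Tendsto (fun n => P n {ω | ¬ (
      ‖arrayArgmin x τ p ε n ω‖ ≤ locRadius n (τ n) (Real.log (p n)) ∧
      ‖arrayArgmin x τ p ε n ω‖ ≤ 8 * ‖∑ i, (ε n i ω ^ 2 - 1) • x n i‖ / (c * n) ∧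
      ∑ i, (1 - ε n i ω ^ 2 * Real.exp (-inner ℝ (x n i) (arrayArgmin x τ p ε n ω))) • x n i
        = 0)}) atTop (𝓝 0) := by
  refine tendsto_measure_zero_of_subset
    (tendsto_measure_not_regularNoise hp hlaw hind hκ x) ?_
  filter_upwards [hreg] with n hn ω hω hcon
  refine hω ?_
  have := hn.ballArgmin_spec hcon (s := fun i => ε n i ω ^ 2) (fun i => by ring)
  simp only [add_sub_cancel] at this
  exact this

lemma tendsto_measure_exists_linearization_gt (hp : ∀ᶠ n in atTop, n ≤ p n)
    (hlaw : ∀ n i, HasLaw (ε n i) (gaussianReal 0 1) (P n)) (hind : ∀ n, iIndepFun (ε n) (P n))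
    (hκ : ∀ᶠ n in atTop, Fintype.card (κ n) ≤ p n)
    (hreg : ∀ᶠ n in atTop, RegularDesign (x n) n (τ n) (Real.log (p n)) C c)
    {J : ℕ → Type*} [∀ n, Fintype (J n)] (hJ : ∀ᶠ n in atTop, Fintype.card (J n) ≤ p n)
    (q : ∀ n, J n → Fin n → ℝ) :
    Tendsto (fun n => P n {ω | ∃ j,
      130 * C * τ n * Real.log (p n) ^ 5 / √(n : ℝ) * √(∑ i, q n j i ^ 2) <
      |∑ i, q n j i * (1 - ε n i ω ^ 2 * Real.exp (-inner ℝ (x n i) (arrayArgmin x τ p ε n ω)))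
        + ∑ i, (ε n i ω ^ 2 - 1) * q n j i
        - inner ℝ (∑ i, q n j i • x n i) (arrayArgmin x τ p ε n ω)|}) atTop (𝓝 0) := by
  refine tendsto_measure_zero_of_subset (tendsto_measure_zero_union (tendsto_measure_zero_union
    (tendsto_measure_not_regularNoise hp hlaw hind hκ x)
    (tendsto_measure_not_stationary hp hlaw hind hκ hreg))
    (tendsto_measure_exists_norm_sum_gt hp hlaw hind hJ hκ fun n j i => q n j i • x n i)) ?_
  filter_upwards [hreg] with n hn ω hω
  by_contra hcon
  simp only [Set.mem_union, Set.mem_ofPred_eq, not_or, not_exists, not_lt, not_not] at hcon hω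
  obtain ⟨⟨c1, c2⟩, c3⟩ := hcon
  obtain ⟨j, hj⟩ := hω
  have := hn.linearization_le c1 c2.1 (c3 j)
  simp only [add_sub_cancel] at this
  exact absurd hj (not_lt.2 this)

/-- The rate of the constrained minimizer. -/
lemma isBigOP_norm_arrayArgmin (hp : ∀ᶠ n in atTop, n ≤ p n)
    (hlaw : ∀ n i, HasLaw (ε n i) (gaussianReal 0 1) (P n)) (hind : ∀ n, iIndepFun (ε n) (P n))
    (hκ : ∀ᶠ n in atTop, Fintype.card (κ n) ≤ p n)
    (hreg : ∀ᶠ n in atTop, RegularDesign (x n) n (τ n) (Real.log (p n)) C c)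
    {t : ℕ → ℝ} {D : ℝ} (hD : 0 ≤ D) (ht : ∀ n, 0 ≤ t n)
    (hsum : ∀ᶠ n in atTop, ∑ i, ‖x n i‖ ^ 2 ≤ D * (n * t n)) :
    IsBigOP P (fun n ω => ‖arrayArgmin x τ p ε n ω‖) fun n => √(t n / n) := by
  intro δ hδ
  -- Chosen so that Chebyshev's bound `2/A²` is `δ/2`; the other half of `δ` pays for failure of
  -- stationarity.
  set A : ℝ := √(4 / δ) with hA
  have hA0 : 0 < A := Real.sqrt_pos.2 (by positivity)
  have hA2 : 2 / A ^ 2 = δ / 2 := by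
    rw [hA, Real.sq_sqrt (by positivity)]; field_simp; norm_num
  have hst := (tendsto_measure_not_stationary (P := P) hp hlaw hind hκ hreg).eventually_le_const
    (show (0 : ℝ≥0∞) < ENNReal.ofReal (δ / 2) by simpa using hδ)
  refine ⟨8 * A * √D / c, ?_⟩
  filter_upwards [hst, hsum, hreg, eventually_gt_atTop 0] with n hn hs hr hn0
  have hn' : (0 : ℝ) < n := by exact_mod_cast hn0
  have hc := hr.c_pos
  have hch := measure_norm_sum_smul_gt_le_div_sq (hlaw n) (hind n) (x n) hA0
  rw [hA2] at hch
  refine (measure_mono fun ω hω => ?_).trans ((measure_union_le _ _).trans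
    ((add_le_add hn hch).trans ?_))
  · by_contra hcon
    simp only [Set.mem_union, Set.mem_ofPred_eq, not_or, not_lt, not_not] at hcon hω
    obtain ⟨⟨_, c1, _⟩, c2⟩ := hcon
    refine absurd hω (not_lt.2 ?_)
    rw [abs_of_nonneg (norm_nonneg _)]
    have h3 : √(∑ i, ‖x n i‖ ^ 2) ≤ √D * √(n * t n) := by
      rw [← Real.sqrt_mul hD]; exact Real.sqrt_le_sqrt hs
    calc ‖arrayArgmin x τ p ε n ω‖ ≤ 8 * (A * (√D * √(n * t n))) / (c * n) := by
          refine c1.trans ?_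
          gcongr
          exact c2.trans (by gcongr)
      _ = 8 * A * √D / c * (√(n * t n) / n) := by field_simp
      _ = _ := by
          rw [Real.sqrt_mul hn'.le, Real.sqrt_div (ht n)]
          congr 1
          nth_rewrite 2 [← Real.mul_self_sqrt hn'.le]
          have : 0 < √(n : ℝ) := Real.sqrt_pos.2 hn'
          field_simp
  · rw [← ENNReal.ofReal_add (by positivity) (by positivity), add_halves]

end Array

/-! ### Regularity of the design from the moment assumptions -/

section Design

lemma momentForm_le_lambdaMax {n p : ℕ} (X : Matrix (Fin n) (Fin p) ℝ) (T : Finset (Fin p)) (k : ℕ)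
    {z : EuclideanSpace ℝ T} (hz : ‖z‖ = 1) : momentForm X T k z ≤ lambdaMax X T k := by
  have hc : Continuous fun z : Metric.sphere (0 : EuclideanSpace ℝ T) 1 => momentForm X T k z := by
    unfold momentForm
    fun_prop
  exact le_ciSup (f := fun z : Metric.sphere (0 : EuclideanSpace ℝ T) 1 => momentForm X T k z)
    (isCompact_range hc).bddAbove ⟨z, by simpa using hz⟩

lemma norm_inv_norm_smul {E : Type*} [NormedAddCommGroup E] [NormedSpace ℝ E] {z : E}
    (hz : z ≠ 0) : ‖‖z‖⁻¹ • z‖ = 1 := by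
  rw [norm_smul, norm_inv, norm_norm, inv_mul_cancel₀ (norm_ne_zero_iff.2 hz)]

lemma sum_inner_pow_eq {n p : ℕ} (hn : 0 < n) (X : Matrix (Fin n) (Fin p) ℝ) (T : Finset (Fin p))
    (k : ℕ) {z : EuclideanSpace ℝ T} (hz : z ≠ 0) :
    ∑ i, inner ℝ (restr T (row X i)) z ^ k = n * ‖z‖ ^ k * momentForm X T k (‖z‖⁻¹ • z) := by
  have hn' : (n : ℝ) ≠ 0 := by exact_mod_cast hn.ne'
  have hz' : ‖z‖ ≠ 0 := norm_ne_zero_iff.2 hz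
  simp only [momentForm, inner_smul_right, mul_pow, inv_pow, ← Finset.mul_sum]
  field_simp

lemma eventually_mul_pow_le_sqrt {t L : ℕ → ℝ} (ht : PolyDecay fun n => t n / √(n : ℝ))
    (hL : SubPoly L) (K : ℝ) (m : ℕ) :
    ∀ᶠ n in atTop, K * (t n + 1) * L n ^ m ≤ √(n : ℝ) := by
  have h := ((subPoly_const K).mul (hL.pow m)).tendsto_mul_polyDecay ht.add_one_div_sqrt
  filter_upwards [h.eventually_le_const one_pos, eventually_gt_atTop 0] with n hn hn0
  have hs : 0 < √(n : ℝ) := Real.sqrt_pos.2 (by exact_mod_cast hn0)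
  rw [← mul_div_assoc, div_le_one hs] at hn
  linarith

variable {p : ℕ → ℕ} {X : ∀ n, Matrix (Fin n) (Fin (p n)) ℝ} {T : ∀ n, Finset (Fin (p n))}
  {t : ℕ → ℝ}

/-- The moment conditions extend from the unit sphere by homogeneity. The growth conditions hold
because every power of `log p` is subpolynomial while `(t+1)/√n` decays polynomially. -/
theorem exists_eventually_regularDesign (hp : ∀ᶠ n in atTop, n ≤ p n) (ht : ∀ n, 0 ≤ t n)
    (hmax : (fun n => ⨆ i, ‖restr (T n) (row (X n) i)‖)
      =O[atTop] fun n => √(t n * Real.log (p n)))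
    (htwo : (fun n => ∑ i, ‖restr (T n) (row (X n) i)‖ ^ 2) =O[atTop] fun n => (n : ℝ) * t n)
    (hfour : (fun n => lambdaMax (X n) (T n) 4) =O[atTop] fun _ => (1 : ℝ))
    {c : ℝ} (hc : 0 < c) (hmin : ∀ᶠ n in atTop, ∀ z : EuclideanSpace ℝ (T n), ‖z‖ = 1 →
      c < momentForm (X n) (T n) 2 z)
    (htsmall : PolyDecay fun n => t n / √(n : ℝ)) (hlogp : SubPoly fun n => Real.log (p n)) :
    ∃ C : ℝ, ∀ᶠ n in atTop, RegularDesign (fun i => restr (T n) (row (X n) i)) n (t n + 1)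
      (Real.log (p n)) C c := by
  obtain ⟨C₁, hC₁, h1⟩ := hmax.exists_pos
  obtain ⟨C₂, hC₂, h2⟩ := htwo.exists_pos
  obtain ⟨C₄, hC₄, h4⟩ := hfour.exists_pos
  set C : ℝ := 1 + C₁ ^ 2 + C₂ + C₄ with hC
  have hL := tendsto_log_atTop_of_le hp
  refine ⟨C, ?_⟩
  filter_upwards [h1.bound, h2.bound, h4.bound, hmin, eventually_gt_atTop 0,
    hL.eventually_ge_atTop 1, hL.eventually_gt_atTop (512 * C / c),
    eventually_mul_pow_le_sqrt htsmall hlogp (C * 130) 5,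
    eventually_mul_pow_le_sqrt htsmall hlogp (128 * C / c) 2] with n b1 b2 b4 bm hn bL bL' g1 g2
  have hn' : (0 : ℝ) < n := by exact_mod_cast hn
  have htn := ht n
  refine ⟨hn', by linarith, bL, by rw [hC]; nlinarith [sq_nonneg C₁], hc, fun i => ?_, ?_,
    fun z => ?_, fun z => ?_, g1, ?_, ?_⟩
  · have h5 : ‖restr (T n) (row (X n) i)‖ ≤ C₁ * √(t n * Real.log (p n)) := by
      refine (le_ciSup (f := fun i => ‖restr (T n) (row (X n) i)‖)
        (Set.finite_range _).bddAbove i).trans ((le_abs_self _).trans ?_)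
      rw [Real.norm_eq_abs, Real.norm_of_nonneg (Real.sqrt_nonneg _)] at b1
      exact b1
    calc ‖restr (T n) (row (X n) i)‖ ^ 2 ≤ (C₁ * √(t n * Real.log (p n))) ^ 2 := by gcongr
      _ = C₁ ^ 2 * (t n * Real.log (p n)) := by rw [mul_pow, Real.sq_sqrt (by positivity)]
      _ ≤ C * ((t n + 1) * Real.log (p n)) := by
          gcongr
          · rw [hC]; linarith
          · linarith
      _ = _ := by ring
  · rw [Real.norm_of_nonneg (by positivity), Real.norm_of_nonneg (by positivity)] at b2
    calc _ ≤ C₂ * (n * t n) := b2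
      _ ≤ C * (n * (t n + 1)) := by
          gcongr
          · rw [hC]; nlinarith [sq_nonneg C₁]
          · linarith
      _ = _ := by ring
  · rcases eq_or_ne z 0 with rfl | hz
    · simp
    rw [sum_inner_pow_eq hn _ _ _ hz]
    have h5 := momentForm_le_lambdaMax (X n) (T n) 4 (z := ‖z‖⁻¹ • z) (norm_inv_norm_smul hz)
    have h6 : lambdaMax (X n) (T n) 4 ≤ C := by
      refine (le_abs_self _).trans ?_
      rw [← Real.norm_eq_abs]
      refine b4.trans ?_
      rw [norm_one, mul_one, hC]; nlinarith [sq_nonneg C₁]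
    calc _ ≤ (n : ℝ) * ‖z‖ ^ 4 * C := by gcongr; exact h5.trans h6
      _ = _ := by ring
  · rcases eq_or_ne z 0 with rfl | hz
    · simp
    rw [sum_inner_pow_eq hn _ _ _ hz]
    have h5 := bm (‖z‖⁻¹ • z) (norm_inv_norm_smul hz)
    calc c * n * ‖z‖ ^ 2 = (n : ℝ) * ‖z‖ ^ 2 * c := by ring
      _ ≤ _ := by gcongr
  · have := mul_le_mul_of_nonneg_left g2 hc.le
    refine le_trans (le_of_eq ?_) this
    field_simp
  · rw [div_lt_iff₀ hc] at bL'
    linarith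

end Design

/-! ### Linear functionals of the constrained minimizer -/

section Functional

variable {Ω : ℕ → Type*} [∀ n, MeasurableSpace (Ω n)] {P : ∀ n, Measure (Ω n)}
  [∀ n, IsProbabilityMeasure (P n)] {ε : ∀ n, Fin n → Ω n → ℝ} {p : ℕ → ℕ}
  {X : ∀ n, Matrix (Fin n) (Fin (p n)) ℝ} {T : ∀ n, Finset (Fin (p n))} {τ : ℕ → ℝ} {C c : ℝ}

lemma RegularDesign.isUnit_gram {n p : ℕ} {X : Matrix (Fin n) (Fin p) ℝ} {T : Finset (Fin p)}
    {τ L C c : ℝ} (h : RegularDesign (fun i => restr T (row X i)) n τ L C c) :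
    IsUnit (gram X T) :=
  Hippo.isUnit_gram h.c_pos (by exact_mod_cast h.N_pos) h.le_quadratic

/-- For the weights `q_i = x_i' Σ̂⁻¹ a` the weighted residual sum vanishes by stationarity and the
linear term is `n a'u`. As `‖q‖ = √(n a'Σ̂⁻¹a)`, the factor `√n` cancels the one in the remainder.
-/
lemma tendsto_measure_exists_functional_gt (hp : ∀ᶠ n in atTop, n ≤ p n)
    (hlaw : ∀ n i, HasLaw (ε n i) (gaussianReal 0 1) (P n)) (hind : ∀ n, iIndepFun (ε n) (P n))
    (hreg : ∀ᶠ n in atTop, RegularDesign (fun i => restr (T n) (row (X n) i)) n (τ n)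
      (Real.log (p n)) C c)
    {J : ℕ → Type*} [∀ n, Fintype (J n)] (hJ : ∀ᶠ n in atTop, Fintype.card (J n) ≤ p n)
    (a : ∀ n, J n → EuclideanSpace ℝ (T n)) :
    Tendsto (fun n => P n {ω | ∃ j,
      130 * C * τ n * Real.log (p n) ^ 5 * √(invForm (X n) (T n) (a n j) (a n j)) <
      |n * inner ℝ (a n j) (arrayArgmin (fun n i => restr (T n) (row (X n) i)) τ p ε n ω)
        - ∑ i, (ε n i ω ^ 2 - 1)
          * inner ℝ (restr (T n) (row (X n) i)) (invGram (X n) (T n) (a n j))|}) atTop (𝓝 0) := by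
  have hκ : ∀ᶠ n in atTop, Fintype.card (T n) ≤ p n :=
    Eventually.of_forall fun n => by simpa using Finset.card_le_univ (T n)
  refine tendsto_measure_zero_of_subset (tendsto_measure_zero_union
    (tendsto_measure_not_stationary hp hlaw hind hκ hreg)
    (tendsto_measure_exists_linearization_gt hp hlaw hind hκ hreg hJ
      fun n j i => inner ℝ (restr (T n) (row (X n) i)) (invGram (X n) (T n) (a n j)))) ?_
  filter_upwards [hreg] with n hn ω hω
  by_contra hcon
  simp only [Set.mem_union, Set.mem_ofPred_eq, not_or, not_exists, not_lt, not_not] at hcon hω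
  obtain ⟨⟨_, _, c1⟩, c2⟩ := hcon
  obtain ⟨j, hj⟩ := hω
  have hn0 : 0 < n := by exact_mod_cast hn.N_pos
  have hu := hn.isUnit_gram
  have c3 := c2 j
  set u := arrayArgmin (fun n i => restr (T n) (row (X n) i)) τ p ε n ω
  have c4 := congrArg (fun w => inner ℝ w (invGram (X n) (T n) (a n j))) c1
  simp only [sum_inner, real_inner_smul_left, inner_zero_left] at c4
  rw [sum_inner_invGram_smul hn0 hu, sum_inner_invGram_sq hn0 hu, real_inner_smul_left,
    Real.sqrt_mul hn.N_pos.le, Finset.sum_congr rfl fun i _ => mul_comm _ _, c4, zero_add,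
    abs_sub_comm, ← mul_assoc, div_mul_cancel₀ _ hn.sqrt_N_pos.ne'] at c3
  exact absurd hj (not_lt.2 c3)

end Functional

/-! ### Normal limit, fitted values and coordinates of the constrained minimizer. -/

section Conclusions

variable {Ω : ℕ → Type*} [∀ n, MeasurableSpace (Ω n)] {P : ∀ n, Measure (Ω n)}
  [∀ n, IsProbabilityMeasure (P n)] {ε : ∀ n, Fin n → Ω n → ℝ} {p : ℕ → ℕ}
  {X : ∀ n, Matrix (Fin n) (Fin (p n)) ℝ} {T : ∀ n, Finset (Fin (p n))} {t : ℕ → ℝ} {C c : ℝ}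

lemma RegularDesign.abs_inner_invGram_le {n p : ℕ} {X : Matrix (Fin n) (Fin p) ℝ}
    {T : Finset (Fin p)} {τ L C c : ℝ}
    (h : RegularDesign (fun i => restr T (row X i)) n τ L C c) (a : EuclideanSpace ℝ T)
    (i : Fin n) : |inner ℝ (restr T (row X i)) (invGram X T a)|
      ≤ √(C * τ * L * (invForm X T a a / c)) := by
  have hn : 0 < n := by exact_mod_cast h.N_pos
  have h1 := h.one_le_τ; have h2 := h.one_le_L; have h3 := h.one_le_C
  refine Real.abs_le_sqrt ?_
  have h4 := norm_invGram_le hn h.isUnit_gram h.le_quadratic a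
  have h5 : ‖invGram X T a‖ ^ 2 ≤ invForm X T a a / c := by
    rw [le_div_iff₀ h.c_pos]; linarith
  calc inner ℝ (restr T (row X i)) (invGram X T a) ^ 2
      ≤ (‖restr T (row X i)‖ * ‖invGram X T a‖) ^ 2 := by
        rw [← sq_abs]
        exact pow_le_pow_left₀ (abs_nonneg _) (abs_real_inner_le_norm _ _) 2
    _ = ‖restr T (row X i)‖ ^ 2 * ‖invGram X T a‖ ^ 2 := mul_pow _ _ _
    _ ≤ _ := mul_le_mul (h.norm_sq_le i) h5 (sq_nonneg _) (by positivity)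

/-- Asymptotic normality of linear functionals of the constrained minimizer. -/
theorem tendstoInDistribution_functional (hp : ∀ᶠ n in atTop, n ≤ p n)
    (hlaw : ∀ n i, HasLaw (ε n i) (gaussianReal 0 1) (P n)) (hind : ∀ n, iIndepFun (ε n) (P n))
    (hreg : ∀ᶠ n in atTop, RegularDesign (fun i => restr (T n) (row (X n) i)) n (t n + 1)
      (Real.log (p n)) C c)
    (htsmall : PolyDecay fun n => t n / √(n : ℝ)) (hlogp : SubPoly fun n => Real.log (p n))
    (a : ∀ n, EuclideanSpace ℝ (T n)) {v : ℝ≥0}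
    (hv : Tendsto (fun n => invForm (X n) (T n) (a n) (a n)) atTop (𝓝 (v : ℝ)))
    {Y : ∀ n, Ω n → ℝ} (hYm : ∀ n, AEMeasurable (Y n) (P n))
    (hY : ∀ n ω, Y n ω = √(n : ℝ) * inner ℝ (a n)
      (arrayArgmin (fun n i => restr (T n) (row (X n) i)) (fun n => t n + 1) p ε n ω)) :
    TendstoInDistribution Y atTop (id : ℝ → ℝ) P (gaussianReal 0 (2 * v)) := by
  set q : ∀ n, Fin n → ℝ := fun n i =>
    inner ℝ (restr (T n) (row (X n) i)) (invGram (X n) (T n) (a n)) with hq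
  have hvle : ∀ᶠ n in atTop, invForm (X n) (T n) (a n) (a n) ≤ v + 1 :=
    hv.eventually_le_const (by linarith)
  refine tendstoInDistribution_of_sub_sum_mul_sq_sub_one hlaw hind
    (c := fun n i => q n i / √(n : ℝ)) ?_ ?_ hYm ?_
  · refine hv.congr' ?_
    filter_upwards [hreg] with n hn
    have hn0 : 0 < n := by exact_mod_cast hn.N_pos
    simp only [div_pow, ← Finset.sum_div]
    rw [hq, sum_inner_invGram_sq hn0 hn.isUnit_gram, Real.sq_sqrt hn.N_pos.le,
      mul_div_cancel_left₀ _ hn.N_pos.ne']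
  -- Uniform smallness of the weights: `q_i²/n` is at most `C (t+1) L (v+1) / (c n)`, which tends to
  -- `0`.
  · intro δ hδ
    filter_upwards [hreg, hvle,
      eventually_mul_pow_le_sqrt htsmall hlogp (C * ((v + 1) / c) / δ ^ 2) 1] with n hn hvn hg i
    have hs := hn.sqrt_N_pos
    have hc := hn.c_pos
    have h1 := hn.one_le_τ; have h2 := hn.one_le_L; have h3 := hn.one_le_C
    have hn1 : (1 : ℝ) ≤ n := by
      have : 0 < n := by exact_mod_cast hn.N_pos
      exact_mod_cast this
    rw [abs_div, abs_of_pos hs, div_le_iff₀ hs]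
    refine (hn.abs_inner_invGram_le (a n) i).trans (Real.sqrt_le_iff.2 ⟨by positivity, ?_⟩)
    rw [mul_pow, Real.sq_sqrt hn.N_pos.le]
    have h4 : √(n : ℝ) ≤ n := Real.sqrt_le_iff.2 ⟨by linarith, by nlinarith⟩
    calc C * (t n + 1) * Real.log (p n) * (invForm (X n) (T n) (a n) (a n) / c)
        ≤ C * (t n + 1) * Real.log (p n) * ((v + 1) / c) := by gcongr
      _ = δ ^ 2 * (C * ((v + 1) / c) / δ ^ 2 * (t n + 1) * Real.log (p n) ^ 1) := by
          field_simp
      _ ≤ δ ^ 2 * n := mul_le_mul_of_nonneg_left (hg.trans h4) (sq_nonneg _)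
  · intro δ hδ
    refine tendsto_measure_zero_of_subset (tendsto_measure_exists_functional_gt hp hlaw hind hreg
      (J := fun _ => Unit) (by
        filter_upwards [hp, eventually_gt_atTop 0] with n h h'
        simp only [Fintype.card_unit]; omega) fun n _ => a n) ?_
    filter_upwards [hreg, hvle,
      eventually_mul_pow_le_sqrt htsmall hlogp (130 * C * √(v + 1) / δ) 5] with n hn hvn hg ω hω
    refine ⟨(), ?_⟩
    simp only [Set.mem_ofPred_eq] at hω
    have hs := hn.sqrt_N_pos
    have h1 := hn.one_le_τ; have h2 := hn.one_le_L; have h3 := hn.one_le_C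
    set u := arrayArgmin (fun n i => restr (T n) (row (X n) i)) (fun n => t n + 1) p ε n ω
    have e : Y n ω - ∑ i, (ε n i ω ^ 2 - 1) * (q n i / √(n : ℝ))
        = (n * inner ℝ (a n) u - ∑ i, (ε n i ω ^ 2 - 1) * q n i) / √(n : ℝ) := by
      simp only [← mul_div_assoc, ← Finset.sum_div]
      have hYu : Y n ω = √(n : ℝ) * inner ℝ (a n) u := hY n ω
      rw [hYu, sub_div]
      congr 1
      nth_rewrite 2 [← Real.mul_self_sqrt hn.N_pos.le]
      field_simp
    rw [e, abs_div, abs_of_pos hs, lt_div_iff₀ hs] at hω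
    refine lt_of_le_of_lt ?_ hω
    calc 130 * C * (t n + 1) * Real.log (p n) ^ 5 * √(invForm (X n) (T n) (a n) (a n))
        ≤ 130 * C * (t n + 1) * Real.log (p n) ^ 5 * √(v + 1) := by gcongr
      _ = δ * (130 * C * √(v + 1) / δ * (t n + 1) * Real.log (p n) ^ 5) := by field_simp
      _ ≤ δ * √(n : ℝ) := mul_le_mul_of_nonneg_left hg hδ.le

/-- Simultaneous bound on the fitted values of the constrained minimizer. -/
theorem isBigOP_iSup_fitted (hp : ∀ᶠ n in atTop, n ≤ p n)
    (hlaw : ∀ n i, HasLaw (ε n i) (gaussianReal 0 1) (P n)) (hind : ∀ n, iIndepFun (ε n) (P n))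
    (hreg : ∀ᶠ n in atTop, RegularDesign (fun i => restr (T n) (row (X n) i)) n (t n + 1)
      (Real.log (p n)) C c) :
    IsBigOP P
      (fun (n : ℕ) ω => ⨆ j, (n : ℝ) * |inner ℝ (restr (T n) (row (X n) j))
        (arrayArgmin (fun n i => restr (T n) (row (X n) i)) (fun n => t n + 1) p ε n ω)|)
      (fun n => ⨆ j, (√((n : ℝ) * invForm (X n) (T n) (restr (T n) (row (X n) j))
              (restr (T n) (row (X n) j)) * Real.log (p n))
            + ⨆ i, invForm (X n) (T n) (restr (T n) (row (X n) j))
                (restr (T n) (row (X n) i)) * Real.log (p n))) := by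
  -- The largest leverage, called `M` below, serves as the common scale: it bounds each variance
  -- term by `n M`, and by Cauchy–Schwarz each weight by `M`.
  set x : ∀ n, Fin n → EuclideanSpace ℝ (T n) := fun n i => restr (T n) (row (X n) i) with hx
  set M : ℕ → ℝ := fun n => ⨆ j, invForm (X n) (T n) (x n j) (x n j) with hM
  have hIM : ∀ n j, invForm (X n) (T n) (x n j) (x n j) ≤ M n := fun n j =>
    le_ciSup (f := fun j => invForm (X n) (T n) (x n j) (x n j)) (Set.finite_range _).bddAbove j
  have hcard : ∀ᶠ n in atTop, Fintype.card (Fin n) ≤ p n := by simpa using hp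
  have hS := tendsto_measure_exists_abs_sum_gt hp hlaw hind (J := fun n => Fin n) hcard
    (c := fun n j i => inner ℝ (x n i) (invGram (X n) (T n) (x n j)))
    (V := fun n j => n * M n) (B := fun n j => M n)
    (by
      filter_upwards [hreg] with n hn j
      have hn0 : 0 < n := by exact_mod_cast hn.N_pos
      rw [hx, sum_inner_invGram_sq hn0 hn.isUnit_gram]
      exact mul_le_mul_of_nonneg_left (hIM n j) hn.N_pos.le)
    (by
      filter_upwards [hreg] with n hn j
      have hn0 : 0 < n := by exact_mod_cast hn.N_pos
      have hu := hn.isUnit_gram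
      have hM0 : 0 ≤ M n := (invForm_self_nonneg hn0 hu _).trans (hIM n j)
      refine ⟨hM0, fun i => ?_⟩
      rw [← invForm_eq_inner]
      refine abs_le_of_sq_le_sq ?_ hM0
      refine (invForm_sq_le hn0 hu _ _).trans ?_
      rw [sq]
      exact mul_le_mul (hIM n i) (hIM n j) (invForm_self_nonneg hn0 hu _) hM0)
  refine isBigOP_of_tendsto_zero 33 (tendsto_measure_zero_of_subset (tendsto_measure_zero_union hS
    (tendsto_measure_exists_functional_gt hp hlaw hind hreg (J := fun n => Fin n) hcard x)) ?_)
  filter_upwards [hreg] with n hn ω hω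
  by_contra hcon
  simp only [Set.mem_union, Set.mem_ofPred_eq, not_or, not_exists, not_lt] at hcon hω
  obtain ⟨c1, c2⟩ := hcon
  refine absurd hω (not_lt.2 ?_)
  have hn0 : 0 < n := by exact_mod_cast hn.N_pos
  have hN := hn.N_pos
  have hu := hn.isUnit_gram
  have h1 := hn.one_le_τ; have h2 := hn.one_le_L; have h3 := hn.one_le_C
  have : Nonempty (Fin n) := ⟨⟨0, hn0⟩⟩
  -- A row of maximal leverage, with its own diagonal entry, shows that the stated rate is at least
  -- `√(n M L) + M L`. The constant `33` is `32` from the deviation bound plus `1` from the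
  -- linearization error.
  obtain ⟨j₀, hj₀⟩ := exists_eq_ciSup_of_finite (f := fun j => invForm (X n) (T n) (x n j) (x n j))
  have hj₀' : invForm (X n) (T n) (x n j₀) (x n j₀) = M n := hj₀
  have hM0 : 0 ≤ M n := (invForm_self_nonneg hn0 hu _).trans (hIM n j₀)
  set L := Real.log (p n)
  set r : ℝ := ⨆ j, (√((n : ℝ) * invForm (X n) (T n) (x n j) (x n j) * L)
            + ⨆ i, invForm (X n) (T n) (x n j) (x n i) * L) with hr
  have hrM : √(n * M n * L) + M n * L ≤ r := by
    refine le_trans ?_ (le_ciSup (f := fun j => (√((n : ℝ) * invForm (X n) (T n) (x n j) (x n j) * L)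
      + ⨆ i, invForm (X n) (T n) (x n j) (x n i) * L)) (Set.finite_range _).bddAbove j₀)
    simp only [hj₀']
    gcongr
    rw [← hj₀']
    exact le_ciSup (f := fun i => invForm (X n) (T n) (x n j₀) (x n i) * L)
      (Set.finite_range _).bddAbove j₀
  rw [abs_of_nonneg (Real.iSup_nonneg fun j => by positivity)]
  refine ciSup_le fun j => ?_
  have c1j := c1 j
  have c2j := c2 j
  set u := arrayArgmin x (fun n => t n + 1) p ε n ω
  have e1 : (n : ℝ) * |inner ℝ (x n j) u| = |n * inner ℝ (x n j) u| := by
    rw [abs_mul, abs_of_pos hN]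
  have e2 : 130 * C * (t n + 1) * L ^ 5 * √(invForm (X n) (T n) (x n j) (x n j))
      ≤ √(n * M n * L) := by
    calc _ ≤ √(n : ℝ) * √(M n) := by
          gcongr
          · exact le_trans (le_of_eq (by ring)) hn.growth
          · exact hIM n j
      _ = √(n * M n) := (Real.sqrt_mul hN.le _).symm
      _ ≤ _ := Real.sqrt_le_sqrt (le_mul_of_one_le_right (by positivity) h2)
  have e3 : √(L * (n * M n)) = √(n * M n * L) := by rw [mul_comm]
  rw [e1]
  have h4 := abs_sub_abs_le_abs_sub (n * inner ℝ (x n j) u)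
    (∑ i, (ε n i ω ^ 2 - 1) * inner ℝ (x n i) (invGram (X n) (T n) (x n j)))
  rw [e3] at c1j
  have h5 : 0 ≤ M n * L := by positivity
  linarith

/-- Coordinatewise bound of order `√(log p / n)` for the constrained minimizer. -/
lemma tendsto_measure_exists_abs_coord_gt (hp : ∀ᶠ n in atTop, n ≤ p n)
    (hlaw : ∀ n i, HasLaw (ε n i) (gaussianReal 0 1) (P n)) (hind : ∀ n, iIndepFun (ε n) (P n))
    (hreg : ∀ᶠ n in atTop, RegularDesign (fun i => restr (T n) (row (X n) i)) n (t n + 1)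
      (Real.log (p n)) C c) :
    Tendsto (fun n => P n {ω | ∃ k : T n, (33 / √c + 32 / c) * (√(Real.log (p n)) / √(n : ℝ)) <
      |arrayArgmin (fun n i => restr (T n) (row (X n) i)) (fun n => t n + 1) p ε n ω k|})
      atTop (𝓝 0) := by
  classical
  have hcard : ∀ᶠ n in atTop, Fintype.card (T n) ≤ p n :=
    Eventually.of_forall fun n => by simpa using Finset.card_le_univ (T n)
  set x : ∀ n, Fin n → EuclideanSpace ℝ (T n) := fun n i => restr (T n) (row (X n) i) with hx
  -- For coordinate vectors the inverse form is at most `1/c`. In the final constant, `32/√c` comes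
  -- from the variance term, `1/√c` from the linearization, and `32/c` from the largest weight.
  set a : ∀ n, T n → EuclideanSpace ℝ (T n) := fun n k => EuclideanSpace.single k 1 with ha
  have hI : ∀ᶠ n in atTop, ∀ k, invForm (X n) (T n) (a n k) (a n k) ≤ 1 / c := by
    filter_upwards [hreg] with n hn k
    have hn0 : 0 < n := by exact_mod_cast hn.N_pos
    refine (invForm_self_le hn.c_pos hn0 hn.isUnit_gram hn.le_quadratic _).trans ?_
    simp [ha]
  have hS := tendsto_measure_exists_abs_sum_gt hp hlaw hind (J := fun n => T n) hcard
    (c := fun n k i => inner ℝ (x n i) (invGram (X n) (T n) (a n k)))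
    (V := fun n k => n / c) (B := fun n k => √(C * (t n + 1) * Real.log (p n)) / c)
    (by
      filter_upwards [hreg, hI] with n hn hIn k
      have hn0 : 0 < n := by exact_mod_cast hn.N_pos
      rw [hx, sum_inner_invGram_sq hn0 hn.isUnit_gram, div_eq_mul_one_div]
      exact mul_le_mul_of_nonneg_left (hIn k) hn.N_pos.le)
    (by
      filter_upwards [hreg, hI] with n hn hIn k
      have hc := hn.c_pos
      have h1 := hn.one_le_τ; have h2 := hn.one_le_L; have h3 := hn.one_le_C
      refine ⟨by positivity, fun i => (hn.abs_inner_invGram_le (a n k) i).trans ?_⟩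
      refine Real.sqrt_le_iff.2 ⟨by positivity, ?_⟩
      rw [div_pow, Real.sq_sqrt (by positivity)]
      calc _ ≤ C * (t n + 1) * Real.log (p n) * (1 / c / c) := by gcongr; exact hIn k
        _ = _ := by field_simp)
  refine tendsto_measure_zero_of_subset (tendsto_measure_zero_union hS
    (tendsto_measure_exists_functional_gt hp hlaw hind hreg (J := fun n => T n) hcard a)) ?_
  filter_upwards [hreg, hI] with n hn hIn ω hω
  by_contra hcon
  simp only [Set.mem_union, Set.mem_ofPred_eq, not_or, not_exists, not_lt] at hcon hω
  obtain ⟨c1, c2⟩ := hcon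
  obtain ⟨k, hk⟩ := hω
  refine absurd hk (not_lt.2 ?_)
  have hN := hn.N_pos
  have hs := hn.sqrt_N_pos
  have hc := hn.c_pos
  have h1 := hn.one_le_τ; have h2 := hn.one_le_L; have h3 := hn.one_le_C
  have c1k := c1 k
  have c2k := c2 k
  set u := arrayArgmin x (fun n => t n + 1) p ε n ω
  set L := Real.log (p n)
  have hL : 0 < √L := Real.sqrt_pos.2 (by linarith)
  have eu : inner ℝ (a n k) u = u k := by simp [ha, EuclideanSpace.inner_single_left]
  rw [eu] at c2k
  have hsL : √(n : ℝ) ≤ √L * √(n : ℝ) :=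
    le_mul_of_one_le_left hs.le (Real.one_le_sqrt.2 h2)
  have e2 : 130 * C * (t n + 1) * L ^ 5 * √(invForm (X n) (T n) (a n k) (a n k))
      ≤ √L * √(n : ℝ) / √c := by
    calc _ ≤ √(n : ℝ) * √(1 / c) := by
          gcongr
          · exact le_trans (le_of_eq (by ring)) hn.growth
          · exact hIn k
      _ = √(n : ℝ) / √c := by rw [Real.sqrt_div zero_le_one, Real.sqrt_one, mul_one_div]
      _ ≤ _ := by gcongr
  have e3 : √(L * (n / c)) = √L * √(n : ℝ) / √c := by
    rw [Real.sqrt_mul (by linarith), Real.sqrt_div hN.le, mul_div_assoc]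
  have e4 : L * (√(C * (t n + 1) * L) / c) ≤ √L * √(n : ℝ) / c := by
    rw [← mul_div_assoc]
    refine div_le_div_of_nonneg_right ?_ hc.le
    refine le_trans ?_ hsL
    refine le_trans ?_ hn.growth
    have h5 : √(C * (t n + 1) * L) ≤ C * (t n + 1) * L := by
      have h7 : 1 ≤ C * (t n + 1) * L :=
        one_le_mul_of_one_le_of_one_le (one_le_mul_of_one_le_of_one_le h3 h1) h2
      exact Real.sqrt_le_iff.2 ⟨by linarith, by nlinarith⟩
    have h6 : L ^ 2 ≤ L ^ 5 := pow_le_pow_right₀ h2 (by norm_num)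
    calc L * √(C * (t n + 1) * L) ≤ L * (C * (t n + 1) * L) := by gcongr
      _ = C * 1 * (t n + 1) * L ^ 2 := by ring
      _ ≤ C * 130 * (t n + 1) * L ^ 5 := by gcongr; norm_num
  rw [e3] at c1k
  have h4 := abs_sub_abs_le_abs_sub ((n : ℝ) * u k)
    (∑ i, (ε n i ω ^ 2 - 1) * inner ℝ (x n i) (invGram (X n) (T n) (a n k)))
  have h8 : n * |u k| ≤ (33 / √c + 32 / c) * (√L * √(n : ℝ)) := by
    rw [← abs_of_pos hN, ← abs_mul, abs_of_pos hN]
    have : (33 / √c + 32 / c) * (√L * √(n : ℝ))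
      = 33 * (√L * √(n : ℝ) / √c) + 32 * (√L * √(n : ℝ) / c) := by ring
    rw [this]; linarith
  refine le_of_mul_le_mul_left (h8.trans (le_of_eq ?_)) hN
  nth_rewrite 2 [← Real.mul_self_sqrt hN.le]
  field_simp

end Conclusions

/-! ### The score off the support and the penalty levels on it. -/

section OffSupport

variable {Ω : ℕ → Type*} [∀ n, MeasurableSpace (Ω n)] {P : ∀ n, Measure (Ω n)}
  [∀ n, IsProbabilityMeasure (P n)] {ε : ∀ n, Fin n → Ω n → ℝ} {p : ℕ → ℕ}
  {X : ∀ n, Matrix (Fin n) (Fin (p n)) ℝ} {T : ∀ n, Finset (Fin (p n))} {t : ℕ → ℝ} {C c : ℝ}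

lemma norm_col_sq {n p : ℕ} (X : Matrix (Fin n) (Fin p) ℝ) (j : Fin p) :
    ‖col X j‖ ^ 2 = ∑ i, X i j ^ 2 := by
  rw [EuclideanSpace.real_norm_sq_eq]; rfl

/-- Squaring the product of the incoherence bound `κ` and the radius gives `(κ/n^{1/4})² L⁴
(t+1)/√n`: a subpolynomial factor times a polynomially decaying one. -/
lemma eventually_incoherence_mul_locRadius_le (ht : ∀ n, 0 ≤ t n)
    (htsmall : PolyDecay fun n => t n / √(n : ℝ)) (hlogp : SubPoly fun n => Real.log (p n))
    (hinc : SubPoly fun n => (⨆ j : {j : Fin (p n) // j ∉ T n},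
      ‖∑ i, (X n i j / ‖col (X n) j‖) • restr (T n) (row (X n) i)‖) / (n : ℝ) ^ (1 / 4 : ℝ)) :
    ∀ᶠ n in atTop, ∀ j ∉ T n, ‖∑ i, (X n i j / ‖col (X n) j‖) • restr (T n) (row (X n) i)‖
      * locRadius n (t n + 1) (Real.log (p n)) ≤ 1 := by
  have h := ((hinc.mul (hlogp.pow 2)).pow 2).tendsto_mul_polyDecay htsmall.add_one_div_sqrt
  filter_upwards [h.eventually_le_const one_pos, eventually_gt_atTop 0] with n hn hn0 j hj
  have hn' : (0 : ℝ) < n := by exact_mod_cast hn0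
  have hs : 0 < √(n : ℝ) := Real.sqrt_pos.2 hn'
  have htn := ht n
  set κ : ℝ := ⨆ j : {j : Fin (p n) // j ∉ T n},
      ‖∑ i, (X n i j / ‖col (X n) j‖) • restr (T n) (row (X n) i)‖ with hκ
  have h1 : ‖∑ i, (X n i j / ‖col (X n) j‖) • restr (T n) (row (X n) i)‖ ≤ κ :=
    le_ciSup (f := fun j : {j : Fin (p n) // j ∉ T n} =>
      ‖∑ i, (X n i j / ‖col (X n) j‖) • restr (T n) (row (X n) i)‖)
      (Set.finite_range _).bddAbove ⟨j, hj⟩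
  refine (mul_le_mul_of_nonneg_right h1 (locRadius_nonneg _ _ _)).trans ?_
  have h2 : (κ * locRadius n (t n + 1) (Real.log (p n))) ^ 2
      = (κ / (n : ℝ) ^ (1 / 4 : ℝ) * Real.log (p n) ^ 2) ^ 2 * ((t n + 1) / √(n : ℝ)) := by
    have h3 : ((n : ℝ) ^ (1 / 4 : ℝ)) ^ 2 = √(n : ℝ) := by
      rw [← Real.rpow_natCast, ← Real.rpow_mul hn'.le, Real.sqrt_eq_rpow]; norm_num
    rw [locRadius, mul_pow, mul_pow, mul_pow, div_pow, h3, Real.sq_sqrt (by positivity)]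
    nth_rewrite 1 [← Real.mul_self_sqrt hn'.le]
    field_simp
  have h4 := h2.trans_le hn
  exact (abs_le.1 (sq_le_one_iff_abs_le_one _ |>.1 h4)).2

/-- The score of the constrained minimizer is dominated by the penalty slope off the support. -/
theorem tendsto_measure_exists_score_gt (hp : ∀ᶠ n in atTop, n ≤ p n)
    (hlaw : ∀ n i, HasLaw (ε n i) (gaussianReal 0 1) (P n)) (hind : ∀ n, iIndepFun (ε n) (P n))
    (hX : ∀ᶠ n in atTop, ∀ j, col (X n) j ≠ 0)
    (hreg : ∀ᶠ n in atTop, RegularDesign (fun i => restr (T n) (row (X n) i)) n (t n + 1)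
      (Real.log (p n)) C c)
    (ht : ∀ n, 0 ≤ t n)
    (htsmall : PolyDecay fun n => t n / √(n : ℝ)) (hlogp : SubPoly fun n => Real.log (p n))
    (hinc : SubPoly fun n => (⨆ j : {j : Fin (p n) // j ∉ T n},
      ‖∑ i, (X n i j / ‖col (X n) j‖) • restr (T n) (row (X n) i)‖) / (n : ℝ) ^ (1 / 4 : ℝ))
    (hentry : (fun n => ⨆ i, ⨆ j, |X n i j / ‖col (X n) j‖|)
      =O[atTop] fun n => (Real.log (p n)) ^ (-(1 / 2) : ℝ))
    {lam : ℕ → ℝ} (hlam_pos : ∀ n, 0 < lam n)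
    (hlam : (fun n => √(Real.log (p n)) / √(n : ℝ)) =o[atTop] lam) :
    Tendsto (fun n => P n {ω | ∃ j ∉ T n, 2 * n * (lam n * ‖col (X n) j‖ / √(n : ℝ)) <
      |∑ i, X n i j * (1 - ε n i ω ^ 2 * Real.exp (-inner ℝ (restr (T n) (row (X n) i))
        (arrayArgmin (fun n i => restr (T n) (row (X n) i)) (fun n => t n + 1) p ε n ω)))|})
      atTop (𝓝 0) := by
  have hκ : ∀ᶠ n in atTop, Fintype.card (T n) ≤ p n :=
    Eventually.of_forall fun n => by simpa using Finset.card_le_univ (T n)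
  have hJ : ∀ᶠ n in atTop, Fintype.card (Fin (p n)) ≤ p n := Eventually.of_forall fun n => by simp
  set q : ∀ n, Fin (p n) → Fin n → ℝ := fun n j i => X n i j / ‖col (X n) j‖ with hq
  have hq1 : ∀ᶠ n in atTop, ∀ j, ∑ i, q n j i ^ 2 = 1 := by
    filter_upwards [hX] with n hn j
    have : ‖col (X n) j‖ ≠ 0 := norm_ne_zero_iff.2 (hn j)
    simp only [hq, div_pow, ← Finset.sum_div, ← norm_col_sq]
    field_simp
  obtain ⟨D, hD, hDb⟩ := hentry.exists_pos
  have hL := tendsto_log_atTop_of_le hp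
  -- Entries of order `L^(-1/2)` make the Bernstein term `L B` equal to `D √L`, the same order as
  -- the variance term.
  have hB : ∀ᶠ n in atTop, ∀ j : Fin (p n), 0 ≤ D * (Real.log (p n)) ^ (-(1 / 2) : ℝ) ∧
      ∀ i, |q n j i| ≤ D * (Real.log (p n)) ^ (-(1 / 2) : ℝ) := by
    filter_upwards [hDb.bound, hL.eventually_gt_atTop 0] with n hn hLn j
    refine ⟨by positivity, fun i => ?_⟩
    rw [Real.norm_of_nonneg (by positivity : 0 ≤ Real.log (p n) ^ (-(1 / 2) : ℝ))] at hn
    refine le_trans ?_ ((le_abs_self _).trans hn)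
    exact (le_ciSup (f := fun j => |X n i j / ‖col (X n) j‖|) (Set.finite_range _).bddAbove
      j).trans (le_ciSup (f := fun i => ⨆ j, |X n i j / ‖col (X n) j‖|)
        (Set.finite_range _).bddAbove i)
  have hS := tendsto_measure_exists_abs_sum_gt hp hlaw hind hJ (c := q) (V := fun _ _ => 1)
    (hq1.mono fun n hn j => (hn j).le) hB
  -- The parts are `32√L` from the variance, `32 D √L` from the largest entry, and `1` each from the
  -- linear term and the linearization error, with `√L ≥ 1`.
  set K : ℝ := 32 * (1 + D) + 2 with hK
  have hK0 : 0 < K := by positivity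
  refine tendsto_measure_zero_of_subset (tendsto_measure_zero_union (tendsto_measure_zero_union hS
    (tendsto_measure_not_stationary hp hlaw hind hκ hreg))
    (tendsto_measure_exists_linearization_gt hp hlaw hind hκ hreg hJ q)) ?_
  filter_upwards [hreg, hX, hq1, eventually_incoherence_mul_locRadius_le ht htsmall hlogp hinc,
    hlam.def (show 0 < K⁻¹ by positivity)] with n hn hXn hqn hincn hlamn ω hω
  by_contra hcon
  simp only [Set.mem_union, Set.mem_ofPred_eq, not_or, not_exists, not_lt, not_not] at hcon hω
  obtain ⟨⟨c1, c2, _⟩, c3⟩ := hcon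
  obtain ⟨j, hjT, hj⟩ := hω
  refine absurd hj (not_lt.2 ?_)
  have hN := hn.N_pos
  have hs := hn.sqrt_N_pos
  have h1 := hn.one_le_τ; have h2 := hn.one_le_L; have h3 := hn.one_le_C
  have c1j := c1 j
  have c3j := c3 j
  set u := arrayArgmin (fun n i => restr (T n) (row (X n) i)) (fun n => t n + 1) p ε n ω
  set L := Real.log (p n)
  have hcol : 0 < ‖col (X n) j‖ := norm_pos_iff.2 (hXn j)
  have hL1 : 1 ≤ √L := Real.one_le_sqrt.2 h2
  have e1 : L * (D * L ^ (-(1 / 2) : ℝ)) = D * √L := by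
    have : L * L ^ (-(1 / 2) : ℝ) = √L := by
      rw [Real.sqrt_eq_rpow]
      nth_rewrite 1 [← Real.rpow_one L]
      rw [← Real.rpow_add (by linarith)]; norm_num
    rw [← this]; ring
  rw [mul_one, e1] at c1j
  rw [hqn j, Real.sqrt_one, mul_one] at c3j
  have e2 : 130 * C * (t n + 1) * L ^ 5 / √(n : ℝ) ≤ 1 := by
    rw [div_le_one hs]
    exact le_trans (le_of_eq (by ring)) hn.growth
  have e3 : |inner ℝ (∑ i, q n j i • restr (T n) (row (X n) i)) u| ≤ 1 :=
    (abs_real_inner_le_norm _ _).trans ((mul_le_mul_of_nonneg_left c2 (norm_nonneg _)).trans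
      (hincn j hjT))
  have e4 : |∑ i, q n j i * (1 - ε n i ω ^ 2 * Real.exp (-inner ℝ (restr (T n) (row (X n) i)) u))|
      ≤ K * √L := by
    have h4 := abs_le.1 c3j
    have h5 := abs_le.1 c1j
    have h6 := abs_le.1 e3
    rw [abs_le, hK]
    constructor <;> nlinarith
  have e5 : K * √L ≤ √(n : ℝ) * lam n := by
    rw [Real.norm_of_nonneg (by positivity), Real.norm_of_nonneg (hlam_pos n).le,
      inv_mul_eq_div, div_le_div_iff₀ hs hK0] at hlamn
    linarith
  have e6 : ∑ i, X n i j * (1 - ε n i ω ^ 2 * Real.exp (-inner ℝ (restr (T n) (row (X n) i)) u))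
      = ‖col (X n) j‖ * ∑ i, q n j i
        * (1 - ε n i ω ^ 2 * Real.exp (-inner ℝ (restr (T n) (row (X n) i)) u)) := by
    rw [Finset.mul_sum]
    refine Finset.sum_congr rfl fun i _ => ?_
    simp only [hq]
    field_simp
  rw [e6, abs_mul, abs_of_pos hcol]
  have e7 : 2 * n * (lam n * ‖col (X n) j‖ / √(n : ℝ)) = ‖col (X n) j‖ * (2 * (√(n : ℝ) * lam n)) := by
    nth_rewrite 1 [← Real.mul_self_sqrt hN.le]
    field_simp
  rw [e7]
  refine mul_le_mul_of_nonneg_left ?_ hcol.le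
  have := (hlam_pos n).le
  have : 0 ≤ √(n : ℝ) * lam n := by positivity
  linarith

/-- Columns indexed by the support have norm of order at most `√n`. -/
lemma exists_eventually_norm_col_le
    (htwo : (fun n => lambdaMax (X n) (T n) 2) =O[atTop] fun _ => (1 : ℝ)) :
    ∃ D : ℝ, 0 < D ∧ ∀ᶠ n in atTop, ∀ j ∈ T n, ‖col (X n) j‖ ≤ D * √(n : ℝ) := by
  classical
  obtain ⟨D, hD, hb⟩ := htwo.exists_pos
  refine ⟨√D, Real.sqrt_pos.2 hD, ?_⟩
  filter_upwards [hb.bound, eventually_gt_atTop 0] with n hn hn0 j hj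
  have hn' : (0 : ℝ) < n := by exact_mod_cast hn0
  rw [norm_one, mul_one] at hn
  have h1 := (momentForm_le_lambdaMax (X n) (T n) 2
    (z := EuclideanSpace.single (⟨j, hj⟩ : T n) 1) (by simp)).trans ((le_abs_self _).trans hn)
  have h2 : momentForm (X n) (T n) 2 (EuclideanSpace.single (⟨j, hj⟩ : T n) 1)
      = (n : ℝ)⁻¹ * ‖col (X n) j‖ ^ 2 := by
    rw [norm_col_sq, momentForm]
    congr 1
    refine Finset.sum_congr rfl fun i _ => ?_
    rw [real_inner_comm, EuclideanSpace.inner_single_left]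
    simp [restr, row]
  rw [h2, inv_mul_le_iff₀ hn'] at h1
  rw [← Real.sqrt_mul hD.le]
  refine Real.le_sqrt_of_sq_le ?_
  linarith

end OffSupport

lemma oracleEstimator_response {n p : ℕ} (X : Matrix (Fin n) (Fin p) ℝ) (T : Finset (Fin p))
    (β θ : EuclideanSpace ℝ (Fin p)) (r : ℝ) (e : Fin n → ℝ) :
    oracleEstimator X T β θ r (response X β θ e)
      = θ + extend T (ballArgmin (fun i => restr T (row X i)) r fun i => e i ^ 2) := by
  rw [oracleEstimator]
  congr 3
  funext i
  exact stdSqResidual_response X β θ e i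

end Hippo

/-! ### Assembly: the oracle estimator and its properties. -/

theorem theorem1
    -- the triangular array: dimension, design, parameters, noise
    (p : ℕ → ℕ) (hp : ∀ᶠ n in atTop, n ≤ p n)
    (X : ∀ n, Matrix (Fin n) (Fin (p n)) ℝ)
    (hX : ∀ᶠ n in atTop, ∀ j, Hippo.col (X n) j ≠ 0)
    (β θ : ∀ n, EuclideanSpace ℝ (Fin (p n)))
    {Ω : ℕ → Type*} [∀ n, MeasurableSpace (Ω n)] (P : ∀ n, Measure (Ω n))
    [∀ n, IsProbabilityMeasure (P n)]
    (ε : ∀ n, Fin n → Ω n → ℝ)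
    (hε_law : ∀ n i, HasLaw (ε n i) (gaussianReal 0 1) (P n))
    (hε_indep : ∀ n, iIndepFun (ε n) (P n))
    -- the support of the variance parameter and its size
    (T : ∀ n, Finset (Fin (p n))) (hT : ∀ n, T n = Hippo.supp (θ n))
    (t : ℕ → ℝ) (ht : ∀ n, t n = ((T n).card : ℝ))
    -- the penalty
    (ρ : ℝ → ℝ → ℝ) (hρ : Hippo.IsPenalty ρ)
    -- size of the rows
    (hA1_max : (fun n => ⨆ i, ‖Hippo.restr (T n) (Hippo.row (X n) i)‖)
      =O[atTop] fun n => √(t n * Real.log (p n)))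
    (hA1_two : (fun n => ∑ i, ‖Hippo.restr (T n) (Hippo.row (X n) i)‖ ^ 2)
      =O[atTop] fun n => (n : ℝ) * t n)
    (hA1_three : (fun n => ∑ i, ‖Hippo.restr (T n) (Hippo.row (X n) i)‖ ^ 3)
      =O[atTop] fun n => (n : ℝ) * t n ^ (3 / 2 : ℝ))
    -- restricted eigenvalues
    (hA2_max : ∀ k ∈ ({2, 3, 4, 6} : Finset ℕ),
      (fun n => Hippo.lambdaMax (X n) (T n) k) =O[atTop] fun _ => (1 : ℝ))
    (hA2_min : ∃ c₂ : ℝ, 0 < c₂ ∧ ∀ᶠ n in atTop, ∀ z : EuclideanSpace ℝ (T n), ‖z‖ = 1 →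
      c₂ < Hippo.momentForm (X n) (T n) 2 z)
    -- sparsity, incoherence, dimension, variances
    (ht_small : Hippo.PolyDecay fun n => t n / √(n : ℝ))
    (hinc : Hippo.SubPoly fun n => (⨆ j : {j : Fin (p n) // j ∉ T n},
      ‖∑ i, (X n i j / ‖Hippo.col (X n) j‖) • Hippo.restr (T n) (Hippo.row (X n) i)‖)
        / (n : ℝ) ^ (1 / 4 : ℝ))
    (hentry : (fun n => ⨆ i, ⨆ j, |X n i j / ‖Hippo.col (X n) j‖|)
      =O[atTop] fun n => (Real.log (p n)) ^ (-(1 / 2) : ℝ))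
    (hlogp : Hippo.SubPoly fun n => Real.log (p n))
    (hσ_max : Hippo.SubPoly fun n => ⨆ i, Hippo.sigma (X n) (θ n) i)
    (hσ_min : Hippo.SubPoly fun n => (⨅ i, Hippo.sigma (X n) (θ n) i)⁻¹)
    -- the minimal signal dominates `√(log p / n)`
    (hsignal : ∀ C : ℝ, 0 < C → ∀ᶠ n in atTop, ∀ j ∈ T n,
      C * (√(Real.log (p n)) / √(n : ℝ)) ≤ |θ n j|)
    -- the tuning parameter lies strictly between the two orders
    (lam : ℕ → ℝ) (hlam_pos : ∀ n, 0 < lam n)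
    (hlam_signal : ∀ c : ℝ, 0 < c → ∀ᶠ n in atTop, ∀ j ∈ T n, lam n ≤ c * |θ n j|)
    (hlam_noise : (fun n => √(Real.log (p n)) / √(n : ℝ)) =o[atTop] lam) :
    ∃ θhat : ∀ n, (Fin n → ℝ) → EuclideanSpace ℝ (Fin (p n)),
      (∀ n, Measurable (θhat n)) ∧
      -- it vanishes off the support
      (∀ n y, ∀ j ∉ T n, θhat n y j = 0) ∧
      -- it is a local minimizer with probability tending to one
      Tendsto (fun n => P n {ω |
          ¬ IsLocalMin
            (Hippo.objective ρ (X n) (Hippo.response (X n) (β n) (θ n) fun i => ε n i ω) (β n)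
              (lam n))
            (θhat n (Hippo.response (X n) (β n) (θ n) fun i => ε n i ω))})
        atTop (𝓝 0) ∧
      -- asymptotic normality of linear functionals
      (∀ (a : ∀ n, EuclideanSpace ℝ (Fin (p n))) (v : ℝ≥0),
        Tendsto (fun n => Hippo.invForm (X n) (T n) (Hippo.restr (T n) (a n))
          (Hippo.restr (T n) (a n))) atTop (𝓝 (v : ℝ)) →
        TendstoInDistribution
          (fun (n : ℕ) ω => √(n : ℝ) * inner ℝ (a n)
            (θhat n (Hippo.response (X n) (β n) (θ n) fun i => ε n i ω) - θ n))
          atTop (id : ℝ → ℝ) P (gaussianReal 0 (2 * v))) ∧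
      -- simultaneous bound on the fitted log-variances
      Hippo.IsBigOP P
        (fun (n : ℕ) ω => ⨆ j, (n : ℝ) * |inner ℝ (Hippo.row (X n) j)
          (θhat n (Hippo.response (X n) (β n) (θ n) fun i => ε n i ω) - θ n)|)
        (fun n => ⨆ j,
          (√((n : ℝ) * Hippo.invForm (X n) (T n) (Hippo.restr (T n) (Hippo.row (X n) j))
              (Hippo.restr (T n) (Hippo.row (X n) j)) * Real.log (p n))
            + ⨆ i, Hippo.invForm (X n) (T n) (Hippo.restr (T n) (Hippo.row (X n) j))
                (Hippo.restr (T n) (Hippo.row (X n) i)) * Real.log (p n))) ∧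
      -- rate in Euclidean norm
      Hippo.IsBigOP P
        (fun n ω => ‖θhat n (Hippo.response (X n) (β n) (θ n) fun i => ε n i ω) - θ n‖)
        (fun n => √(t n / n)) := by
  have ht0 : ∀ n, 0 ≤ t n := fun n => by rw [ht]; positivity
  obtain ⟨c, hc, hmin⟩ := hA2_min
  obtain ⟨C, hreg⟩ := Hippo.exists_eventually_regularDesign hp ht0 hA1_max hA1_two
    (hA2_max 4 (by simp)) hc hmin ht_small hlogp
  set u : ∀ n, Ω n → EuclideanSpace ℝ (T n) := Hippo.arrayArgmin
    (fun n i => Hippo.restr (T n) (Hippo.row (X n) i)) (fun n => t n + 1) p ε with hu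
  set θhat : ∀ n, (Fin n → ℝ) → EuclideanSpace ℝ (Fin (p n)) := fun n =>
    Hippo.oracleEstimator (X n) (T n) (β n) (θ n)
      (Hippo.locRadius n (t n + 1) (Real.log (p n))) with hθhat
  have hθT : ∀ n, ∀ j ∉ T n, θ n j = 0 := fun n j hj => by
    rw [hT] at hj
    simpa [Hippo.supp] using hj
  have hθT' : ∀ n, ∀ j ∈ T n, θ n j ≠ 0 := fun n j hj => by
    rw [hT] at hj
    simpa [Hippo.supp] using hj
  have hmeas : ∀ n, Measurable (θhat n) := fun n => Hippo.measurable_oracleEstimator _ _ _ _ _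
  have hval : ∀ n ω, θhat n (Hippo.response (X n) (β n) (θ n) fun i => ε n i ω)
      = θ n + Hippo.extend (T n) (u n ω) := fun n ω => Hippo.oracleEstimator_response _ _ _ _ _ _
  have hdiff : ∀ n ω, θhat n (Hippo.response (X n) (β n) (θ n) fun i => ε n i ω) - θ n
      = Hippo.extend (T n) (u n ω) := fun n ω => by rw [hval, add_sub_cancel_left]
  have hinner : ∀ n ω (a : EuclideanSpace ℝ (Fin (p n))), inner ℝ a
      (θhat n (Hippo.response (X n) (β n) (θ n) fun i => ε n i ω) - θ n)
      = inner ℝ (Hippo.restr (T n) a) (u n ω) := fun n ω a => by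
    rw [hdiff, Hippo.inner_extend]
  have hκ : ∀ᶠ n in atTop, Fintype.card (T n) ≤ p n :=
    Eventually.of_forall fun n => by simpa using Finset.card_le_univ (T n)
  refine ⟨θhat, hmeas, fun n y j hj => ?_, ?_, fun a v hv => ?_, ?_, ?_⟩
  · simp only [hθhat, Hippo.oracleEstimator, PiLp.add_apply, hθT n j hj,
      Hippo.extend_apply_notMem _ hj, add_zero]
  · obtain ⟨b, hb, hflat⟩ := hρ.exists_flat
    obtain ⟨D, hD, hcol⟩ := Hippo.exists_eventually_norm_col_le (hA2_max 2 (by simp))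
    refine Hippo.tendsto_measure_zero_of_subset (Hippo.tendsto_measure_zero_union
      (Hippo.tendsto_measure_zero_union
        (Hippo.tendsto_measure_not_stationary hp hε_law hε_indep hκ hreg)
        (Hippo.tendsto_measure_exists_abs_coord_gt hp hε_law hε_indep hreg))
      (Hippo.tendsto_measure_exists_score_gt hp hε_law hε_indep hX hreg ht0 ht_small hlogp hinc
        hentry hlam_pos hlam_noise)) ?_
    -- The factor `2` in the signal condition makes the estimation error at most `|θ⋆_j|/2`. The
    -- constant `1/(4bD)`, with `‖X_j‖ ≤ D√n` on `T`, puts the flat region's threshold `bλ_j` at or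
    -- below `|θ⋆_j|/4`. Hence `θ̂_j` lies strictly inside the flat region.
    filter_upwards [hreg, hX, hcol, hsignal (2 * (33 / √c + 32 / c)) (by positivity),
      hlam_signal (1 / (4 * b * D)) (by positivity)] with n hn hXn hcoln hsn hln ω hω
    by_contra hcon
    simp only [Set.mem_union, Set.mem_ofPred_eq, not_or, not_exists, not_lt, not_not] at hcon hω
    obtain ⟨⟨⟨_, _, c1⟩, c2⟩, c3⟩ := hcon
    have hs := hn.sqrt_N_pos
    have hres : ∀ i, (Hippo.response (X n) (β n) (θ n) (fun i => ε n i ω) i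
        - inner ℝ (Hippo.row (X n) i) (β n)) ^ 2
        * Real.exp (-inner ℝ (Hippo.row (X n) i) (θ n + Hippo.extend (T n) (u n ω)))
        = ε n i ω ^ 2 * Real.exp (-inner ℝ (Hippo.restr (T n) (Hippo.row (X n) i)) (u n ω)) :=
      fun i => by
        have h := Hippo.stdSqResidual_response (X n) (β n) (θ n) (fun i => ε n i ω) i
        rw [Hippo.stdSqResidual] at h
        rw [inner_add_right, Hippo.inner_extend, neg_add, Real.exp_add, ← mul_assoc, h]
    refine hω ?_
    rw [hval]
    refine Hippo.isLocalMin_objective hρ hb (fun lam hlam => (hflat lam hlam).2) (T := T n)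
      (fun j => ?_) (fun j hj => ?_) (fun j hj => ?_) (fun j hj => ?_) (fun j hj => ?_)
    · have h1 := hlam_pos n
      have h2 := norm_pos_iff.2 (hXn j)
      positivity
    · rw [PiLp.add_apply, hθT n j hj, Hippo.extend_apply_notMem _ hj, add_zero]
    · have h1 : |u n ω ⟨j, hj⟩| ≤ |θ n j| / 2 := by
        have := hsn j hj
        have := c2 ⟨j, hj⟩
        linarith
      have h2 : b * (lam n * ‖Hippo.col (X n) j‖ / √(n : ℝ)) ≤ |θ n j| / 4 := by
        have h3 : lam n * ‖Hippo.col (X n) j‖ / √(n : ℝ) ≤ 1 / (4 * b * D) * |θ n j| * D := by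
          rw [div_le_iff₀ hs, mul_assoc]
          exact mul_le_mul (hln j hj) (hcoln j hj) (norm_nonneg _) (by positivity)
        calc _ ≤ b * (1 / (4 * b * D) * |θ n j| * D) := mul_le_mul_of_nonneg_left h3 hb.le
          _ = _ := by field_simp
      have h4 : 0 < |θ n j| := abs_pos.2 (hθT' n j hj)
      have h5 : (θ n + Hippo.extend (T n) (u n ω)).ofLp j = θ n j + u n ω ⟨j, hj⟩ := by
        rw [PiLp.add_apply, Hippo.extend_apply_mem (u n ω) ⟨j, hj⟩]
      have h6 := abs_sub_abs_le_abs_sub (θ n j) (-(u n ω ⟨j, hj⟩))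
      rw [abs_neg, sub_neg_eq_add] at h6
      rw [h5]
      linarith
    · simp only [hres]
      have h := congrArg (fun w : EuclideanSpace ℝ (T n) => w ⟨j, hj⟩) c1
      simp only [WithLp.ofLp_sum, Finset.sum_apply, WithLp.ofLp_smul, Pi.smul_apply,
        smul_eq_mul, WithLp.ofLp_zero, Pi.zero_apply] at h
      rw [← h]
      exact Finset.sum_congr rfl fun i _ => mul_comm _ _
    · simp only [hres]
      exact not_lt.1 fun h => c3 j ⟨hj, h⟩
  · refine Hippo.tendstoInDistribution_functional hp hε_law hε_indep hreg ht_small hlogp _ hv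
      (fun n => ?_) fun n ω => by rw [hinner]
    have hε : ∀ i, AEMeasurable (ε n i) (P n) := fun i => (hε_law n i).aemeasurable
    have hy : AEMeasurable (fun ω => Hippo.response (X n) (β n) (θ n) fun i => ε n i ω) (P n) := by
      refine aemeasurable_pi_lambda _ fun i => ?_
      unfold Hippo.response
      fun_prop
    have := (hmeas n).comp_aemeasurable hy
    simp only [Function.comp_def] at this
    fun_prop
  · simp only [hinner]
    exact Hippo.isBigOP_iSup_fitted hp hε_law hε_indep hreg
  · obtain ⟨D, hD, hb⟩ := hA1_two.exists_pos
    simp only [hdiff, Hippo.norm_extend]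
    refine Hippo.isBigOP_norm_arrayArgmin hp hε_law hε_indep hκ hreg hD.le ht0 ?_
    filter_upwards [hb.bound] with n hn
    have := ht0 n
    rwa [Real.norm_of_nonneg (by positivity), Real.norm_of_nonneg (by positivity)] at hn
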